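/- There is an algorithm that, given a dimension $d\ge 0$ and a matrix $A\in\mathbb{A}^{d\times d}$, where $\mathbb{A}\subset\mathbb{C}$ is the field of algebraic numbers, computes the (complex) Zariski closure $\overline{\{e^{At} : t\in\mathbb{R}_{\ge 0}\}}\subseteq\mathbb{C}^{d\times d}$. Precisely: an algebraic number $z$ is represented by a nonzero polynomial with integer coefficients together with a disc $\{w\in\mathbb{C} : |w-\frac{u+vi}{n+1}|<\frac1{n+1}\}$ ($u,v\in\mathbb{Z}$, $n\in\mathbb{N}$) in which $z$ is the only root of that polynomial (every algebraic number has such representations); matrices are represented entry by entry, and polynomials by finite lists of terms with algebraic coefficients. There is a single partial recursive function that, for every $d$, every $A\in\mathbb{A}^{d\times d}$ and every representation of $A$, halts and outputs a representation of a finite list of polynomials $p_1,\dots,p_k\in\mathbb{A}[x_{ij} : 1\le i,j\le d]$ such that $$\{X\in\mathbb{C}^{d\times d} : p_1(X)=\dots=p_k(X)=0\}=\overline{\{e^{At} : t\in\mathbb{R}_{\ge 0}\}},$$ the smallest algebraic subset of $\mathbb{C}^{d\times d}$ that contains every $e^{At}$ with $t\in\mathbb{R}_{\ge 0}$, and such that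 moreover $p_1,\dots,p_k$ generate the ideal of all polynomials in $\mathbb{C}[x_{ij}]$ that vanish at every $e^{At}$ with $t\in\mathbb{R}_{\ge 0}$. -/

import Mathlib

namespace AlgFlow

/-! ### Exact representations of algebraic data -/

/-- A code `(a, u, v, n)` for an algebraic number: `a` is the coefficient list, constant term
first, of an integer polynomial, and `(u, v, n)` describes the open disc in the complex plane with
centre `(u + v i) / (n + 1)` and radius `1 / (n + 1)`. -/
abbrev NumCode : Type := List ℤ × ℤ × ℤ × ℕ

/-- The integer polynomial of a code. -/
noncomputable def NumCode.poly (c : NumCode) : Polynomial ℤ :=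
  ∑ k ∈ Finset.range c.1.length, Polynomial.C (c.1.getD k 0) * Polynomial.X ^ k

/-- The isolating disc of a code. -/
def NumCode.disc (c : NumCode) : Set ℂ :=
  Metric.ball (((c.2.1 : ℂ) + (c.2.2.1 : ℂ) * Complex.I) / ((c.2.2.2 : ℂ) + 1))
    (1 / ((c.2.2.2 : ℝ) + 1))

/-- `c` represents `z`: the polynomial of `c` is nonzero, and `z` is its one and only root in the
disc of `c`. -/
def NumCode.Represents (c : NumCode) (z : ℂ) : Prop :=
  c.poly ≠ 0 ∧ {w ∈ c.disc | Polynomial.aeval w c.poly = 0} = {z}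

theorem NumCode.poly_ofList (p : Polynomial ℤ) (x : ℤ × ℤ × ℕ) :
    NumCode.poly ((List.range (p.natDegree + 1)).map p.coeff, x) = p := by
  conv_rhs => rw [p.as_sum_range_C_mul_X_pow]
  simp only [NumCode.poly, List.length_map, List.length_range]
  refine Finset.sum_congr rfl fun k hk => ?_
  have := Finset.mem_range.1 hk
  simp [List.getD, this]

/-- The complex numbers that have a code are exactly the algebraic numbers. -/
theorem NumCode.exists_represents_iff (z : ℂ) :
    (∃ c : NumCode, c.Represents z) ↔ IsAlgebraic ℚ z := by
  constructor
  · rintro ⟨c, h0, h⟩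
    have hz : z ∈ {w ∈ c.disc | Polynomial.aeval w c.poly = 0} := by rw [h]; rfl
    exact (IsFractionRing.isAlgebraic_iff ℤ ℚ ℂ).1 ⟨_, h0, hz.2⟩
  · intro hz
    obtain ⟨p, h0, hp⟩ := (IsFractionRing.isAlgebraic_iff ℤ ℚ ℂ).2 hz
    have hfin : (p.rootSet ℂ \ {z}).Finite := (p.rootSet_finite ℂ).subset Set.sdiff_subset
    obtain ⟨ε, hε, hb⟩ := Metric.isOpen_iff.1 hfin.isClosed.isOpen_compl z (by simp)
    obtain ⟨n, hn⟩ := exists_nat_one_div_lt (half_pos hε)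
    have hN : (0 : ℝ) < n + 1 := by positivity
    let w : ℂ := ((round ((n + 1) * z.re) : ℤ) : ℂ) + ((round ((n + 1) * z.im) : ℤ) : ℂ) * Complex.I
    have hd : dist z (w / ((n : ℂ) + 1)) < 1 / ((n : ℝ) + 1) := by
      have hN' : ((n : ℂ) + 1) ≠ 0 := by exact_mod_cast hN.ne'
      have e : z - w / ((n : ℂ) + 1) = (((n : ℂ) + 1) * z - w) / ((n : ℂ) + 1) := by
        field_simp
      have e2 : ‖((n : ℂ) + 1)‖ = n + 1 := by
        have := Complex.norm_natCast (n + 1); push_cast at this; exact this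
      rw [dist_eq_norm, e, norm_div, e2]
      refine div_lt_div_of_pos_right ?_ hN
      have h1 := abs_sub_round ((n + 1) * z.re)
      have h2 := abs_sub_round ((n + 1) * z.im)
      rw [← sq_lt_one_iff₀ (norm_nonneg _), Complex.sq_norm, Complex.normSq_apply]
      have r1 : (((n : ℂ) + 1) * z - w).re = (n + 1) * z.re - round ((n + 1) * z.re) := by
        simp [w]
      have r2 : (((n : ℂ) + 1) * z - w).im = (n + 1) * z.im - round ((n + 1) * z.im) := by
        simp [w]
      rw [r1, r2]
      rw [abs_le] at h1 h2
      nlinarith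
    refine ⟨((List.range (p.natDegree + 1)).map p.coeff, round ((n + 1) * z.re),
      round ((n + 1) * z.im), n), ?_, ?_⟩
    · rw [NumCode.poly_ofList]; exact h0
    · rw [NumCode.poly_ofList]
      ext y
      simp only [NumCode.disc, Metric.mem_ball, Set.mem_singleton_iff]
      constructor
      · rintro ⟨hy, hy0⟩
        by_contra hne
        have : y ∈ Metric.ball z ε := by
          have := dist_triangle_right y z (w / ((n : ℂ) + 1))
          rw [Metric.mem_ball]
          simp only [w] at *
          linarith
        exact hb this ⟨Polynomial.mem_rootSet.2 ⟨h0, hy0⟩, hne⟩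
      · rintro rfl
        exact ⟨hd, hp⟩

/-- Codes for square matrices of algebraic numbers: the list of the rows. -/
abbrev MatCode : Type := List (List NumCode)

/-- `c` represents the `d × d` matrix `A`: it consists of `d` rows of `d` codes each, and the codes
represent the entries of `A`. -/
def MatCode.Represents {d : ℕ} (c : MatCode) (A : Matrix (Fin d) (Fin d) ℂ) : Prop :=
  List.Forall₂ (List.Forall₂ NumCode.Represents) c
    (List.ofFn fun i => List.ofFn fun j => A i j)

/-- Codes for a term: a table of exponents, given by its rows, and a coefficient. -/
abbrev TermCode : Type := List (List ℕ) × NumCode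

/-- `t` represents the term `z * ∏ x_ij ^ e_ij`, where `z` is the coefficient and `e` the table
of exponents of `t` (missing exponents count as `0`). -/
def TermCode.Represents {d : ℕ} (t : TermCode) (q : MvPolynomial (Fin d × Fin d) ℂ) : Prop :=
  ∃ z : ℂ, NumCode.Represents t.2 z ∧
    q = MvPolynomial.C z *
      ∏ ij : Fin d × Fin d, MvPolynomial.X ij ^ ((t.1.getD ij.1 []).getD ij.2 0)

/-- Codes for polynomials with algebraic coefficients: lists of terms. -/
abbrev PolyCode : Type := List TermCode

/-- `c` represents the polynomial `p` in the entries of a `d × d` matrix: `p` is the sum of the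
terms that are listed in `c`. -/
def PolyCode.Represents {d : ℕ} (c : PolyCode) (p : MvPolynomial (Fin d × Fin d) ℂ) : Prop :=
  ∃ qs : List (MvPolynomial (Fin d × Fin d) ℂ),
    List.Forall₂ TermCode.Represents c qs ∧ p = qs.sum

/-! ### The Zariski closure -/

/-- Algebraic sets (affine varieties) in the affine space `K ^ σ`. -/
def IsAlgebraicSet {K σ : Type*} [Field K] (X : Set (σ → K)) : Prop :=
  ∃ I : Ideal (MvPolynomial σ K), X = MvPolynomial.zeroLocus K I

/-- The Zariski closure of a subset of the affine space `K ^ σ`. -/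
def zariskiClosure {K σ : Type*} [Field K] (S : Set (σ → K)) : Set (σ → K) :=
  ⋂₀ {X | IsAlgebraicSet X ∧ S ⊆ X}

/-- The set of the matrices `exp (A t)`, for real `t ≥ 0`, in the affine space of complex `d × d`
matrices. -/
noncomputable def flow {d : ℕ} (A : Matrix (Fin d) (Fin d) ℂ) : Set (Fin d × Fin d → ℂ) :=
  {x | ∃ t : ℝ, 0 ≤ t ∧ x = fun ij => NormedSpace.exp ((t : ℂ) • A) ij.1 ij.2}

end AlgFlow

/-! ### Primitive recursive functions: a `fun_prop` library -/

namespace AlgFlow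

attribute [fun_prop] Primrec

section PrimrecLib

variable {α β γ σ : Type*} [Primcodable α] [Primcodable β] [Primcodable γ] [Primcodable σ]

@[fun_prop]
theorem primrec_id : Primrec fun a : α => a := Primrec.id

@[fun_prop]
theorem primrec_comp {f : β → γ} {g : α → β} (hf : Primrec f) (hg : Primrec g) :
    Primrec fun a => f (g a) := hf.comp hg

attribute [fun_prop] Primrec.const Primrec.pair

@[fun_prop]
theorem primrec_fst {f : α → β × γ} (hf : Primrec f) : Primrec fun a => (f a).1 :=
  Primrec.fst.comp hf

@[fun_prop]
theorem primrec_snd {f : α → β × γ} (hf : Primrec f) : Primrec fun a => (f a).2 :=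
  Primrec.snd.comp hf

@[fun_prop]
theorem primrec_encode {f : α → β} (hf : Primrec f) : Primrec fun a => Encodable.encode (f a) :=
  Primrec.encode.comp hf

/-! Booleans -/

@[fun_prop]
theorem primrec_and {f g : α → Bool} (hf : Primrec f) (hg : Primrec g) :
    Primrec fun a => f a && g a := Primrec.and.comp hf hg

@[fun_prop]
theorem primrec_or {f g : α → Bool} (hf : Primrec f) (hg : Primrec g) :
    Primrec fun a => f a || g a := Primrec.or.comp hf hg

@[fun_prop]
theorem primrec_cond {c : α → Bool} {f g : α → β} (hc : Primrec c) (hf : Primrec f)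
    (hg : Primrec g) : Primrec fun a => bif c a then f a else g a := Primrec.cond hc hf hg

@[fun_prop]
theorem primrec_decide_eq [DecidableEq β] {f g : α → β} (hf : Primrec f) (hg : Primrec g) :
    Primrec fun a => decide (f a = g a) := by
  obtain ⟨_, h⟩ := Primrec.eq.comp hf hg
  exact h.of_eq fun a => by congr

/-! Natural numbers -/

@[fun_prop]
theorem primrec_nat_add {f g : α → ℕ} (hf : Primrec f) (hg : Primrec g) :
    Primrec fun a => f a + g a := Primrec.nat_add.comp hf hg

@[fun_prop]
theorem primrec_nat_mul {f g : α → ℕ} (hf : Primrec f) (hg : Primrec g) :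
    Primrec fun a => f a * g a := Primrec.nat_mul.comp hf hg

@[fun_prop]
theorem primrec_nat_sub {f g : α → ℕ} (hf : Primrec f) (hg : Primrec g) :
    Primrec fun a => f a - g a := Primrec.nat_sub.comp hf hg

@[fun_prop]
theorem primrec_nat_div {f g : α → ℕ} (hf : Primrec f) (hg : Primrec g) :
    Primrec fun a => f a / g a := Primrec.nat_div.comp hf hg

@[fun_prop]
theorem primrec_nat_mod {f g : α → ℕ} (hf : Primrec f) (hg : Primrec g) :
    Primrec fun a => f a % g a := Primrec.nat_mod.comp hf hg

@[fun_prop]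
theorem primrec_nat_le {f g : α → ℕ} (hf : Primrec f) (hg : Primrec g) :
    Primrec fun a => decide (f a ≤ g a) := by
  obtain ⟨_, h⟩ := Primrec.nat_le.comp hf hg
  exact h.of_eq fun a => by congr

@[fun_prop]
theorem primrec_nat_lt {f g : α → ℕ} (hf : Primrec f) (hg : Primrec g) :
    Primrec fun a => decide (f a < g a) :=
  primrec_nat_le (f := fun a => f a + 1) (by fun_prop) hg

@[fun_prop]
theorem primrec_nat_rec {f : α → ℕ} {g : α → β} {h : α → ℕ → β → β} (hf : Primrec f)
    (hg : Primrec g) (hh : Primrec fun p : α × (ℕ × β) => h p.1 p.2.1 p.2.2) :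
    Primrec fun a => Nat.rec (motive := fun _ => β) (g a) (h a) (f a) :=
  Primrec.nat_rec' (h := fun a p => h a p.1 p.2) hf hg hh

@[fun_prop]
theorem primrec_nat_pow {f g : α → ℕ} (hf : Primrec f) (hg : Primrec g) :
    Primrec fun a => f a ^ g a := by
  have : Primrec fun a => Nat.rec (motive := fun _ => ℕ) 1 (fun _ y => y * f a) (g a) := by
    fun_prop
  refine this.of_eq fun a => ?_
  induction g a with
  | zero => rfl
  | succ n ih => rw [pow_succ, ← ih]

/-! Integers -/

theorem Int.encode_ofNat (n : ℕ) : Encodable.encode (n : ℤ) = 2 * n := rfl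

theorem Int.encode_negSucc (n : ℕ) : Encodable.encode (Int.negSucc n) = 2 * n + 1 := rfl

@[fun_prop]
theorem primrec_toNat {f : α → ℤ} (hf : Primrec f) : Primrec fun a => (f a).toNat := by
  have : Primrec fun a => bif decide (Encodable.encode (f a) % 2 = 0) then
      Encodable.encode (f a) / 2 else 0 := by fun_prop
  refine this.of_eq fun a => ?_
  rcases f a with n | n
  · simp only [Int.ofNat_eq_natCast, Int.encode_ofNat]; simp
  · rw [Int.encode_negSucc]; simp [show (2 * n + 1) % 2 = 1 by omega]

theorem primrec_neg_toNat {f : α → ℤ} (hf : Primrec f) : Primrec fun a => (-f a).toNat := by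
  have : Primrec fun a => bif decide (Encodable.encode (f a) % 2 = 0) then 0 else
      Encodable.encode (f a) / 2 + 1 := by fun_prop
  refine this.of_eq fun a => ?_
  rcases f a with n | n
  · simp only [Int.ofNat_eq_natCast, Int.encode_ofNat]; simp
  · rw [Int.encode_negSucc]
    simp [show (2 * n + 1) % 2 = 1 by omega, show (2 * n + 1) / 2 = n by omega]

theorem primrec_nat_subInt {f g : α → ℕ} (hf : Primrec f) (hg : Primrec g) :
    Primrec fun a => (f a : ℤ) - g a := by
  refine Primrec.encode_iff.1 ?_
  have : Primrec fun a => bif decide (g a ≤ f a) then 2 * (f a - g a) else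
      2 * (g a - f a - 1) + 1 := by fun_prop
  refine this.of_eq fun a => ?_
  by_cases h : g a ≤ f a
  · rw [← Nat.cast_sub h, Int.encode_ofNat]; simp [h]
  · rw [show (f a : ℤ) - g a = Int.negSucc (g a - f a - 1) by
      rw [Int.negSucc_eq]; omega, Int.encode_negSucc]
    simp [h]

@[fun_prop]
theorem primrec_int_cast {f : α → ℕ} (hf : Primrec f) : Primrec fun a => (f a : ℤ) :=
  (primrec_nat_subInt hf (Primrec.const 0)).of_eq fun a => by simp

@[fun_prop]
theorem primrec_int_add {f g : α → ℤ} (hf : Primrec f) (hg : Primrec g) :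
    Primrec fun a => f a + g a := by
  have h1 := primrec_neg_toNat hf
  have h2 := primrec_neg_toNat hg
  have : Primrec fun a => (((f a).toNat + (g a).toNat : ℕ) : ℤ) -
      (((-f a).toNat + (-g a).toNat : ℕ) : ℤ) := primrec_nat_subInt (by fun_prop) (by fun_prop)
  exact this.of_eq fun a => by push_cast; omega

@[fun_prop]
theorem primrec_int_neg {f : α → ℤ} (hf : Primrec f) : Primrec fun a => -f a :=
  (primrec_nat_subInt (primrec_neg_toNat hf) (primrec_toNat hf)).of_eq fun a => by omega

@[fun_prop]
theorem primrec_int_sub {f g : α → ℤ} (hf : Primrec f) (hg : Primrec g) :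
    Primrec fun a => f a - g a := by
  simp only [sub_eq_add_neg]; fun_prop

@[fun_prop]
theorem primrec_int_mul {f g : α → ℤ} (hf : Primrec f) (hg : Primrec g) :
    Primrec fun a => f a * g a := by
  have h1 : Primrec fun a => (-f a).toNat := by fun_prop
  have h2 : Primrec fun a => (-g a).toNat := by fun_prop
  have : Primrec fun a =>
      (((f a).toNat * (g a).toNat + (-f a).toNat * (-g a).toNat : ℕ) : ℤ) -
      (((f a).toNat * (-g a).toNat + (-f a).toNat * (g a).toNat : ℕ) : ℤ) :=
    primrec_nat_subInt (by fun_prop) (by fun_prop)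
  refine this.of_eq fun a => ?_
  have e1 : ((f a).toNat : ℤ) - (-f a).toNat = f a := by omega
  have e2 : ((g a).toNat : ℤ) - (-g a).toNat = g a := by omega
  conv_rhs => rw [← e1, ← e2]
  push_cast
  ring

@[fun_prop]
theorem primrec_natAbs {f : α → ℤ} (hf : Primrec f) : Primrec fun a => (f a).natAbs := by
  have : Primrec fun a => (f a).toNat + (-f a).toNat := by fun_prop
  exact this.of_eq fun a => by omega

@[fun_prop]
theorem primrec_int_lt {f g : α → ℤ} (hf : Primrec f) (hg : Primrec g) :
    Primrec fun a => decide (f a < g a) := by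
  have : Primrec fun a => decide (0 < (g a - f a).toNat) := by fun_prop
  exact this.of_eq fun a => by congr 1; exact propext (by omega)

/-! Lists -/

@[fun_prop]
theorem primrec_cons {f : α → β} {g : α → List β} (hf : Primrec f) (hg : Primrec g) :
    Primrec fun a => f a :: g a := Primrec.list_cons.comp hf hg

@[fun_prop]
theorem primrec_append {f g : α → List β} (hf : Primrec f) (hg : Primrec g) :
    Primrec fun a => f a ++ g a := Primrec.list_append.comp hf hg

@[fun_prop]
theorem primrec_length {f : α → List β} (hf : Primrec f) : Primrec fun a => (f a).length :=
  Primrec.list_length.comp hf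

@[fun_prop]
theorem primrec_range {f : α → ℕ} (hf : Primrec f) : Primrec fun a => List.range (f a) :=
  Primrec.list_range.comp hf

@[fun_prop]
theorem primrec_getD {f : α → List β} {g : α → ℕ} {d : β} (hf : Primrec f) (hg : Primrec g) :
    Primrec fun a => (f a).getD (g a) d := (Primrec.list_getD d).comp hf hg

@[fun_prop]
theorem primrec_map {f : α → List β} {g : α → β → γ} (hf : Primrec f)
    (hg : Primrec fun p : α × β => g p.1 p.2) : Primrec fun a => (f a).map (g a) :=
  Primrec.list_map hf hg

@[fun_prop]
theorem primrec_flatMap {f : α → List β} {g : α → β → List γ} (hf : Primrec f)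
    (hg : Primrec fun p : α × β => g p.1 p.2) : Primrec fun a => (f a).flatMap (g a) :=
  Primrec.list_flatMap hf hg

@[fun_prop]
theorem primrec_foldr {f : α → List β} {g : α → γ} {h : α → β → γ → γ} (hf : Primrec f)
    (hg : Primrec g) (hh : Primrec fun p : α × (β × γ) => h p.1 p.2.1 p.2.2) :
    Primrec fun a => (f a).foldr (h a) (g a) :=
  Primrec.list_foldr hf hg (h := fun a p => h a p.1 p.2) hh

@[fun_prop]
theorem primrec_all {f : α → List β} {p : α → β → Bool} (hf : Primrec f)
    (hp : Primrec fun q : α × β => p q.1 q.2) : Primrec fun a => (f a).all (p a) := by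
  have : Primrec fun a => (f a).foldr (fun x b => p a x && b) true := by fun_prop
  refine this.of_eq fun a => ?_
  induction f a with
  | nil => rfl
  | cons x l ih => simp [ih]

@[fun_prop]
theorem primrec_filter {f : α → List β} {p : α → β → Bool} (hf : Primrec f)
    (hp : Primrec fun q : α × β => p q.1 q.2) : Primrec fun a => (f a).filter (p a) := by
  have : Primrec fun a => (f a).foldr (fun x l => bif p a x then x :: l else l) [] := by fun_prop
  refine this.of_eq fun a => ?_
  induction f a with
  | nil => rfl
  | cons x l ih => by_cases h : p a x <;> simp [h, ih]

end PrimrecLib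

/-- Unbounded search for a certificate. -/
theorem partrec_search {α β γ : Type*} [Primcodable α] [Primcodable β] [Primcodable γ]
    {chk : α → β → Bool} {out : α → β → γ}
    (hchk : Primrec fun p : α × β => chk p.1 p.2) (hout : Primrec fun p : α × β => out p.1 p.2) :
    ∃ F : α →. γ, Partrec F ∧ ∀ a, (∃ b, chk a b = true) →
      ∃ b, chk a b = true ∧ out a b ∈ F a := by
  let g : α → ℕ → Option γ := fun a n =>
    (Encodable.decode (α := β) n).bind fun b => bif chk a b then some (out a b) else none
  have hg : Primrec₂ g := by
    refine Primrec.option_bind (f := fun p : α × ℕ => Encodable.decode (α := β) p.2)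
      (g := fun (p : α × ℕ) b => bif chk p.1 b then some (out p.1 b) else none)
      (Primrec.decode.comp Primrec.snd) ?_
    refine Primrec.cond (hchk.comp (f := fun p : α × β => chk p.1 p.2)
      (g := fun q : (α × ℕ) × β => (q.1.1, q.2)) (by fun_prop))
      (Primrec.option_some.comp (hout.comp (f := fun p : α × β => out p.1 p.2)
      (g := fun q : (α × ℕ) × β => (q.1.1, q.2)) (by fun_prop))) (Primrec.const none)
  refine ⟨fun a => Nat.rfindOpt (g a), Partrec.rfindOpt hg.to_comp, fun a ⟨b, hb⟩ => ?_⟩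
  have hdom : (Nat.rfindOpt (g a)).Dom :=
    Nat.rfindOpt_dom.2 ⟨Encodable.encode b, out a b, by simp [g, hb]⟩
  obtain ⟨n, hn⟩ := Nat.rfindOpt_spec (Part.get_mem hdom)
  simp only [g, Option.mem_def, Option.bind_eq_some_iff] at hn
  obtain ⟨b', -, hb'⟩ := hn
  refine ⟨b', ?_⟩
  cases h : chk a b' with
  | false => simp [h] at hb'
  | true =>
    simp only [h, cond_true, Option.some.injEq] at hb'
    exact ⟨rfl, hb' ▸ Part.get_mem hdom⟩

end AlgFlow

/-! ### The certificate checker -/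

namespace AlgFlow

section Defs

/-- The list of the first `m` values of `g`. -/
def vec (m : ℕ) (g : ℕ → ℤ) : List ℤ := (List.range m).map g

/-- The first `m` coordinates of `v`, padded with zeros. -/
def trunc (m : ℕ) (v : List ℤ) : List ℤ := vec m fun i => v.getD i 0

/-- Sum of coordinate vectors. -/
def kadd (m : ℕ) (v w : List ℤ) : List ℤ := vec m fun i => v.getD i 0 + w.getD i 0

/-- Integer multiple of a coordinate vector. -/
def ksmul (m : ℕ) (z : ℤ) (v : List ℤ) : List ℤ := vec m fun i => z * v.getD i 0

/-- Multiplication by the generator `x` in `ℤ[x] / (x ^ m + ∑ f_i x ^ i)`, `m = f.length`. -/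
def kshift (f v : List ℤ) : List ℤ :=
  vec f.length fun i => (bif decide (i = 0) then 0 else v.getD (i - 1) 0) -
    v.getD (f.length - 1) 0 * f.getD i 0

/-- Multiplication in `ℤ[x] / (x ^ m + ∑ f_i x ^ i)`. -/
def kmul (f v w : List ℤ) : List ℤ :=
  (trunc f.length v).foldr (fun a acc => kadd f.length (kshift f acc) (ksmul f.length a w)) []

/-- Finite sums of coordinate vectors. -/
def ksum (m n : ℕ) (g : ℕ → List ℤ) : List ℤ :=
  (List.range n).foldr (fun i acc => kadd m (g i) acc) []

/-- Equality of the first `m` coordinates. -/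
def keq (m : ℕ) (v w : List ℤ) : Bool :=
  (List.range m).all fun i => decide (v.getD i 0 = w.getD i 0)

/-- Evaluation of the integer polynomial `p` at an element of the quotient ring. -/
def khorner (f p h : List ℤ) : List ℤ :=
  p.foldr (fun a acc => kadd f.length [a] (kmul f h acc)) []

/-- The coefficients `p_i * N ^ (p.length - i)`. -/
def homog (p : List ℤ) (N : ℕ) : List ℤ :=
  (List.range p.length).map fun i => p.getD i 0 * ((N ^ (p.length - i) : ℕ) : ℤ)

/-- Data of an approximation: a centre `(u + v i) / s`, a radius `1 / r`, and a bound `R`. -/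
abbrev Approx : Type := ℤ × ℤ × ℕ × ℕ × ℕ

/-- One step of `num`. -/
def numStep (x : Approx) (a : ℤ) (y : (ℤ × ℤ) × (ℤ × ℤ) × ℤ × ℤ × ℤ × ℤ) :
    (ℤ × ℤ) × (ℤ × ℤ) × ℤ × ℤ × ℤ × ℤ :=
  ((a * (x.2.2.1 * y.2.2.1) + (x.1 * y.1.1 - x.2.1 * y.1.2), x.1 * y.1.2 + x.2.1 * y.1.1),
    (x.2.2.1 * y.1.1 + (x.1 * y.2.1.1 - x.2.1 * y.2.1.2),
      x.2.2.1 * y.1.2 + (x.1 * y.2.1.2 + x.2.1 * y.2.1.1)),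
    x.2.2.1 * y.2.2.1, (a.natAbs : ℤ) + x.2.2.2.2 * y.2.2.2.1,
    x.2.2.2.2 * y.2.2.2.2.1 + y.2.2.2.1, 2 * y.2.2.2.2.1 + x.2.2.2.2 * y.2.2.2.2.2)

/-- Numerical evaluation of an integer polynomial at the centre of an approximation: the numerators
of the value and of the derivative, their common denominator, and bounds for the values, for the
first differences and for the second differences. -/
def num (x : Approx) (p : List ℤ) : (ℤ × ℤ) × (ℤ × ℤ) × ℤ × ℤ × ℤ × ℤ :=
  p.foldr (numStep x) ((0, 0), (0, 0), 1, 0, 0, 0)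

/-- Test that `h(θ) / N` lies in the disc of a code. -/
def inDisc (x : Approx) (N : ℕ) (h : List ℤ) (c : NumCode) : Bool :=
  let y := num x h
  let X1 := (c.2.2.2 + 1) * y.1.1 - N * y.2.2.1 * c.2.1
  let X2 := (c.2.2.2 + 1) * y.1.2 - N * y.2.2.1 * c.2.2.1
  let Y := N * y.2.2.1 * x.2.2.2.1 - (c.2.2.2 + 1) * y.2.2.1 * y.2.2.2.2.1
  decide (0 < Y) && decide ((x.2.2.2.1 * x.2.2.2.1) * (X1 * X1 + X2 * X2) < Y * Y)

/-- Test that `h(θ)` is nonzero. -/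
def farZero (x : Approx) (h : List ℤ) : Bool :=
  let y := num x h
  decide ((y.2.2.1 * y.2.2.2.2.1) * (y.2.2.1 * y.2.2.2.2.1) <
    (x.2.2.2.1 * x.2.2.2.1) * (y.1.1 * y.1.1 + y.1.2 * y.1.2))

/-- Test that the bound of an approximation is large enough. -/
def boundOK (x : Approx) : Bool :=
  decide (x.1.natAbs + x.2.1.natAbs + x.2.2.1 ≤ x.2.2.2.2 * x.2.2.1)

/-- Test that the monic polynomial with lower coefficients `f` has a root near the centre. -/
def rootOK (x : Approx) (f : List ℤ) : Bool :=
  let y := num x (f ++ [1])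
  decide (((x.2.2.2.1 ^ f.length * x.2.2.2.1 ^ f.length : ℕ) : ℤ) *
    (y.1.1 * y.1.1 + y.1.2 * y.1.2) < y.2.2.1 * y.2.2.1)

/-- The disc of a code as an approximation. -/
def codeApprox (R : ℕ) (c : NumCode) : Approx := (c.2.1, c.2.2.1, c.2.2.2 + 1, c.2.2.2 + 1, R)

/-- Test that the polynomial of a code is injective on its disc. -/
def uniqOK (R : ℕ) (c : NumCode) : Bool :=
  let y := num (codeApprox R c) c.1
  boundOK (codeApprox R c) &&
  decide ((y.2.2.1 * y.2.2.2.2.2) * (y.2.2.1 * y.2.2.2.2.2) <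
    ((c.2.2.2 + 1) * (c.2.2.2 + 1)) * (y.2.1.1 * y.2.1.1 + y.2.1.2 * y.2.1.2))

/-- Test that `h(θ) / N` is a root of the polynomial of the code, in the disc of the code. -/
def repOK (f : List ℤ) (x : Approx) (N : ℕ) (h : List ℤ) (c : NumCode) : Bool :=
  keq f.length (khorner f (homog c.1 N) h) [] && inDisc x N (trunc f.length h) c

/-- All integer vectors of length `m` with entries of absolute value at most `B`. -/
def box (B m : ℕ) : List (List ℤ) :=
  Nat.rec [[]] (fun _ ls => (List.range (2 * B + 1)).flatMap fun (i : ℕ) =>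
    ls.map fun l => ((i : ℤ) - (B : ℤ)) :: l) m

/-- A bound for the coefficients of the monic divisors of a monic polynomial. -/
def boxBound (f : List ℤ) : ℕ :=
  (2 * (1 + f.foldr (fun a acc => a.natAbs + acc) 0)) ^ f.length

/-- Test that no nonzero vector in the box vanishes at `θ`. -/
def boxOK (x : Approx) (f : List ℤ) : Bool :=
  (box (boxBound f) f.length).all fun v => keq f.length v [] || farZero x v

/-- Pairs of words, which stand for pairs of monomials. -/
abbrev WordPair : Type := List ℕ × List ℕ

/-- The sum of the values of `e` over a word. -/
def wordSum (e : List ℤ) (w : List ℕ) : ℤ := w.foldr (fun k acc => e.getD k 0 + acc) 0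

/-- The linear form `e` on a pair of words. -/
def pairVal (e : List ℤ) (t : WordPair) : ℤ := wordSum e t.1 - wordSum e t.2

/-- All lists of length at most `L` with entries in `G`. -/
def listsUpTo {α : Type*} (G : List α) (L : ℕ) : List (List α) :=
  Nat.rec [[]] (fun _ ls => [] :: G.flatMap fun g => ls.map fun l => g :: l) L

/-- The concatenation of pairs of words. -/
def pairSum (ws : List WordPair) : WordPair :=
  ws.foldr (fun w acc => (w.1 ++ acc.1, w.2 ++ acc.2)) ([], [])

/-- One step of `gens`. -/
def genStep (e : List ℤ) (G : List WordPair) : List WordPair :=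
  ((listsUpTo G (2 * G.foldr (fun g acc => (pairVal e g).natAbs + acc) 0 + 1)).filter
    fun ws => decide (pairVal e (pairSum ws) = 0)).map pairSum

/-- Generators of the monoid of the pairs of words on which all forms in `eqs` vanish. -/
def gens (n : ℕ) (eqs : List (List ℤ)) : List WordPair :=
  eqs.foldr genStep
    (((List.range n).map fun k => ([k], [])) ++ ((List.range n).map fun k => ([], [k])))

/-- Matrices of coordinate vectors. -/
abbrev KMat : Type := List (List (List ℤ))

/-- Entries of a matrix. -/
def ent (M : KMat) (a b : ℕ) : List ℤ := (M.getD a []).getD b []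

/-- A term `t ^ j * exp (λ t) * M` of the matrix exponential, and a dual form for `M`. -/
abbrev Term : Type := List ℤ × ℕ × KMat × KMat

/-- The term with index `k`. -/
def tm (ts : List Term) (k : ℕ) : Term := ts.getD k ([], 0, [], [])

/-- Polynomials as sums of words with coefficients. -/
abbrev WPoly : Type := List (List (ℕ × ℕ) × List ℤ)

/-- Product of polynomials. -/
def wmul (f : List ℤ) (p q : WPoly) : WPoly :=
  p.flatMap fun t => q.map fun r => (t.1 ++ r.1, kmul f t.2 r.2)

/-- Multiple of a polynomial. -/
def wscale (f h : List ℤ) (p : WPoly) : WPoly := p.map fun t => (t.1, kmul f h t.2)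

/-- The linear form with coefficients `E`. -/
def lform (d : ℕ) (E : KMat) : WPoly :=
  (List.range d).flatMap fun a => (List.range d).map fun b => ([(a, b)], ent E a b)

/-- The product of the linear forms over a word. -/
def wordProd (f : List ℤ) (d : ℕ) (ts : List Term) (w : List ℕ) : WPoly :=
  w.foldr (fun k acc => wmul f (lform d (tm ts k).2.2.2) acc) [([], [1])]

/-- The linear generators of the ideal. -/
def linGen (f : List ℤ) (N d : ℕ) (ts : List Term) (a b : ℕ) : WPoly :=
  ([(a, b)], [((N * N : ℕ) : ℤ)]) :: (List.range ts.length).flatMap fun k =>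
    wscale f (ksmul f.length (-1) (ent (tm ts k).2.2.1 a b)) (lform d (tm ts k).2.2.2)

/-- The generators of the ideal that come from binomials. -/
def binGen (f : List ℤ) (N d : ℕ) (ts : List Term) (t : WordPair) : WPoly :=
  wscale f [((N ^ t.2.length : ℕ) : ℤ)] (wordProd f d ts t.1) ++
    wscale f [-((N ^ t.1.length : ℕ) : ℤ)] (wordProd f d ts t.2)

/-- The integer linear relations that the exponents of a balanced pair satisfy. -/
def relEqs (m : ℕ) (ts : List Term) : List (List ℤ) :=
  (ts.map fun T => (T.2.1 : ℤ)) :: (List.range m).map fun i => ts.map fun T => T.1.getD i 0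

/-- Generators of the vanishing ideal. -/
def idealGens (f : List ℤ) (N d : ℕ) (ts : List Term) : List WPoly :=
  ((List.range d).flatMap fun a => (List.range d).map fun b => linGen f N d ts a b) ++
    (gens ts.length (relEqs f.length ts)).map fun t => binGen f N d ts t

/-- The table of the exponents of a word. -/
def expTable (d : ℕ) (w : List (ℕ × ℕ)) : List (List ℕ) :=
  (List.range d).map fun a => (List.range d).map fun b =>
    (w.filter fun x => decide (x = (a, b))).length

/-- Certificates: the lower coefficients of the minimal polynomial of `θ`, an approximation of `θ`,
a common denominator, the matrix, the terms of its exponential, and a dictionary of codes. -/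
abbrev Cert : Type := List ℤ × Approx × ℕ × KMat × List Term × List NumCode

/-- Entries of the dictionary. -/
def lookupCode (D : List NumCode) (h : List ℤ) : NumCode :=
  D.getD (Encodable.encode h) ([], 0, 0, 0)

/-- The output that belongs to a certificate. -/
def certOut (c : MatCode) (C : Cert) : List PolyCode :=
  (idealGens C.1 C.2.2.1 c.length C.2.2.2.2.1).map fun W => W.map fun t =>
    (expTable c.length t.1, lookupCode C.2.2.2.2.2 t.2)

/-- Tests for the generator `θ` of the number field. -/
def fieldOK (f : List ℤ) (x : Approx) (N : ℕ) : Bool :=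
  decide (0 < f.length) && decide (0 < N) && decide (0 < x.2.2.1) && decide (0 < x.2.2.2.1) &&
    boundOK x && rootOK x f && boxOK x f

/-- Test that the input codes represent the matrix. -/
def inputOK (f : List ℤ) (x : Approx) (N : ℕ) (AA : KMat) (c : MatCode) : Bool :=
  (List.range c.length).all fun a => (List.range c.length).all fun b =>
    repOK f x N (ent AA a b) ((c.getD a []).getD b ([], 0, 0, 0))

/-- Test that the terms are ordered in chains. -/
def chainOK (ts : List Term) : Bool :=
  decide ((tm ts 0).2.1 = 0) && (List.range ts.length).all fun k =>
    decide ((tm ts (k + 1)).2.1 = 0) || (decide ((tm ts (k + 1)).1 = (tm ts k).1) &&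
      decide ((tm ts (k + 1)).2.1 = (tm ts k).2.1 + 1))

/-- Test of the differential equation for the sum of the terms. -/
def odeOK (f : List ℤ) (N d : ℕ) (AA : KMat) (ts : List Term) : Bool :=
  (List.range ts.length).all fun k => (List.range d).all fun a => (List.range d).all fun b =>
    keq f.length (ksum f.length d fun c => kmul f (ent AA a c) (ent (tm ts k).2.2.1 c b))
      (kadd f.length (kmul f (tm ts k).1 (ent (tm ts k).2.2.1 a b))
        (ksmul f.length ((N * (tm ts (k + 1)).2.1 : ℕ) : ℤ) (ent (tm ts (k + 1)).2.2.1 a b)))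

/-- Test of the initial value of the sum of the terms. -/
def initOK (f : List ℤ) (N d : ℕ) (ts : List Term) : Bool :=
  (List.range d).all fun a => (List.range d).all fun b =>
    keq f.length (ksum f.length ts.length fun k =>
      bif decide ((tm ts k).2.1 = 0) then ent (tm ts k).2.2.1 a b else [])
      [bif decide (a = b) then (N : ℤ) else 0]

/-- Test that the dual forms are dual to the matrices of the terms. -/
def dualOK (f : List ℤ) (N d : ℕ) (ts : List Term) : Bool :=
  (List.range ts.length).all fun k => (List.range ts.length).all fun l =>
    keq f.length (ksum f.length d fun a => ksum f.length d fun b =>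
      kmul f (ent (tm ts k).2.2.2 a b) (ent (tm ts l).2.2.1 a b))
      [bif decide (k = l) then ((N * N : ℕ) : ℤ) else 0]

/-- Test of the codes for the coefficients of the output. -/
def dictOK (f : List ℤ) (x : Approx) (D : List NumCode) (Ws : List WPoly) : Bool :=
  Ws.all fun W => W.all fun t =>
    repOK f x 1 t.2 (lookupCode D t.2) && uniqOK x.2.2.2.2 (lookupCode D t.2)

/-- The test of a certificate. -/
def certOK (c : MatCode) (C : Cert) : Bool :=
  fieldOK C.1 C.2.1 C.2.2.1 && inputOK C.1 C.2.1 C.2.2.1 C.2.2.2.1 c && chainOK C.2.2.2.2.1 &&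
    odeOK C.1 C.2.2.1 c.length C.2.2.2.1 C.2.2.2.2.1 && initOK C.1 C.2.2.1 c.length C.2.2.2.2.1 &&
    dualOK C.1 C.2.2.1 c.length C.2.2.2.2.1 &&
    dictOK C.1 C.2.1 C.2.2.2.2.2 (idealGens C.1 C.2.2.1 c.length C.2.2.2.2.1)

end Defs

section Primrec

variable {α β : Type*} [Primcodable α] [Primcodable β]

@[fun_prop]
theorem primrec_vec {m : α → ℕ} {g : α → ℕ → ℤ} (hm : Primrec m)
    (hg : Primrec fun p : α × ℕ => g p.1 p.2) : Primrec fun a => vec (m a) (g a) := by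
  unfold vec; fun_prop

@[fun_prop]
theorem primrec_trunc {m : α → ℕ} {v : α → List ℤ} (hm : Primrec m) (hv : Primrec v) :
    Primrec fun a => trunc (m a) (v a) := by
  unfold trunc; fun_prop

@[fun_prop]
theorem primrec_kadd {m : α → ℕ} {v w : α → List ℤ} (hm : Primrec m) (hv : Primrec v)
    (hw : Primrec w) : Primrec fun a => kadd (m a) (v a) (w a) := by
  unfold kadd; fun_prop

@[fun_prop]
theorem primrec_ksmul {m : α → ℕ} {z : α → ℤ} {v : α → List ℤ} (hm : Primrec m) (hz : Primrec z)
    (hv : Primrec v) : Primrec fun a => ksmul (m a) (z a) (v a) := by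
  unfold ksmul; fun_prop

@[fun_prop]
theorem primrec_kshift {f v : α → List ℤ} (hf : Primrec f) (hv : Primrec v) :
    Primrec fun a => kshift (f a) (v a) := by
  unfold kshift; fun_prop

@[fun_prop]
theorem primrec_kmul {f v w : α → List ℤ} (hf : Primrec f) (hv : Primrec v) (hw : Primrec w) :
    Primrec fun a => kmul (f a) (v a) (w a) := by
  unfold kmul; fun_prop

@[fun_prop]
theorem primrec_ksum {m n : α → ℕ} {g : α → ℕ → List ℤ} (hm : Primrec m) (hn : Primrec n)
    (hg : Primrec fun p : α × ℕ => g p.1 p.2) : Primrec fun a => ksum (m a) (n a) (g a) := by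
  unfold ksum; fun_prop

@[fun_prop]
theorem primrec_keq {m : α → ℕ} {v w : α → List ℤ} (hm : Primrec m) (hv : Primrec v)
    (hw : Primrec w) : Primrec fun a => keq (m a) (v a) (w a) := by
  unfold keq; fun_prop

@[fun_prop]
theorem primrec_khorner {f p h : α → List ℤ} (hf : Primrec f) (hp : Primrec p) (hh : Primrec h) :
    Primrec fun a => khorner (f a) (p a) (h a) := by
  unfold khorner; fun_prop

@[fun_prop]
theorem primrec_homog {p : α → List ℤ} {N : α → ℕ} (hp : Primrec p) (hN : Primrec N) :
    Primrec fun a => homog (p a) (N a) := by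
  unfold homog; fun_prop

@[fun_prop]
theorem primrec_numStep {x : α → Approx} {z : α → ℤ}
    {y : α → (ℤ × ℤ) × (ℤ × ℤ) × ℤ × ℤ × ℤ × ℤ} (hx : Primrec x) (hz : Primrec z)
    (hy : Primrec y) : Primrec fun a => numStep (x a) (z a) (y a) := by
  unfold numStep; fun_prop

@[fun_prop]
theorem primrec_num {x : α → Approx} {p : α → List ℤ} (hx : Primrec x) (hp : Primrec p) :
    Primrec fun a => num (x a) (p a) := by
  unfold num; fun_prop

@[fun_prop]
theorem primrec_inDisc {x : α → Approx} {N : α → ℕ} {h : α → List ℤ} {c : α → NumCode}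
    (hx : Primrec x) (hN : Primrec N) (hh : Primrec h) (hc : Primrec c) :
    Primrec fun a => inDisc (x a) (N a) (h a) (c a) := by
  unfold inDisc; fun_prop

@[fun_prop]
theorem primrec_farZero {x : α → Approx} {h : α → List ℤ} (hx : Primrec x) (hh : Primrec h) :
    Primrec fun a => farZero (x a) (h a) := by
  unfold farZero; fun_prop

@[fun_prop]
theorem primrec_boundOK {x : α → Approx} (hx : Primrec x) : Primrec fun a => boundOK (x a) := by
  unfold boundOK; fun_prop

@[fun_prop]
theorem primrec_rootOK {x : α → Approx} {f : α → List ℤ} (hx : Primrec x) (hf : Primrec f) :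
    Primrec fun a => rootOK (x a) (f a) := by
  unfold rootOK; fun_prop

@[fun_prop]
theorem primrec_uniqOK {R : α → ℕ} {c : α → NumCode} (hR : Primrec R) (hc : Primrec c) :
    Primrec fun a => uniqOK (R a) (c a) := by
  unfold uniqOK codeApprox; fun_prop

@[fun_prop]
theorem primrec_repOK {f : α → List ℤ} {x : α → Approx} {N : α → ℕ} {h : α → List ℤ}
    {c : α → NumCode} (hf : Primrec f) (hx : Primrec x) (hN : Primrec N) (hh : Primrec h)
    (hc : Primrec c) : Primrec fun a => repOK (f a) (x a) (N a) (h a) (c a) := by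
  unfold repOK; fun_prop

@[fun_prop]
theorem primrec_box {B m : α → ℕ} (hB : Primrec B) (hm : Primrec m) :
    Primrec fun a => box (B a) (m a) := by
  unfold box; fun_prop

@[fun_prop]
theorem primrec_boxOK {x : α → Approx} {f : α → List ℤ} (hx : Primrec x) (hf : Primrec f) :
    Primrec fun a => boxOK (x a) (f a) := by
  unfold boxOK boxBound; fun_prop

@[fun_prop]
theorem primrec_pairVal {e : α → List ℤ} {t : α → WordPair} (he : Primrec e) (ht : Primrec t) :
    Primrec fun a => pairVal (e a) (t a) := by
  unfold pairVal wordSum; fun_prop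

@[fun_prop]
theorem primrec_listsUpTo {G : α → List β} {L : α → ℕ} (hG : Primrec G) (hL : Primrec L) :
    Primrec fun a => listsUpTo (G a) (L a) := by
  unfold listsUpTo; fun_prop

@[fun_prop]
theorem primrec_pairSum {ws : α → List WordPair} (hw : Primrec ws) :
    Primrec fun a => pairSum (ws a) := by
  unfold pairSum; fun_prop

@[fun_prop]
theorem primrec_genStep {e : α → List ℤ} {G : α → List WordPair} (he : Primrec e)
    (hG : Primrec G) : Primrec fun a => genStep (e a) (G a) := by
  unfold genStep; fun_prop

@[fun_prop]
theorem primrec_gens {n : α → ℕ} {eqs : α → List (List ℤ)} (hn : Primrec n) (he : Primrec eqs) :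
    Primrec fun a => gens (n a) (eqs a) := by
  unfold gens; fun_prop

@[fun_prop]
theorem primrec_ent {M : α → KMat} {i j : α → ℕ} (hM : Primrec M) (hi : Primrec i)
    (hj : Primrec j) : Primrec fun a => ent (M a) (i a) (j a) := by
  unfold ent; fun_prop

@[fun_prop]
theorem primrec_tm {ts : α → List Term} {k : α → ℕ} (ht : Primrec ts) (hk : Primrec k) :
    Primrec fun a => tm (ts a) (k a) := by
  unfold tm; fun_prop

@[fun_prop]
theorem primrec_wmul {f : α → List ℤ} {p q : α → WPoly} (hf : Primrec f) (hp : Primrec p)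
    (hq : Primrec q) : Primrec fun a => wmul (f a) (p a) (q a) := by
  unfold wmul; fun_prop

@[fun_prop]
theorem primrec_wscale {f h : α → List ℤ} {p : α → WPoly} (hf : Primrec f) (hh : Primrec h)
    (hp : Primrec p) : Primrec fun a => wscale (f a) (h a) (p a) := by
  unfold wscale; fun_prop

@[fun_prop]
theorem primrec_lform {d : α → ℕ} {E : α → KMat} (hd : Primrec d) (hE : Primrec E) :
    Primrec fun a => lform (d a) (E a) := by
  unfold lform; fun_prop

@[fun_prop]
theorem primrec_wordProd {f : α → List ℤ} {d : α → ℕ} {ts : α → List Term} {w : α → List ℕ}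
    (hf : Primrec f) (hd : Primrec d) (ht : Primrec ts) (hw : Primrec w) :
    Primrec fun a => wordProd (f a) (d a) (ts a) (w a) := by
  unfold wordProd; fun_prop

@[fun_prop]
theorem primrec_linGen {f : α → List ℤ} {N d : α → ℕ} {ts : α → List Term} {i j : α → ℕ}
    (hf : Primrec f) (hN : Primrec N) (hd : Primrec d) (ht : Primrec ts) (hi : Primrec i)
    (hj : Primrec j) : Primrec fun a => linGen (f a) (N a) (d a) (ts a) (i a) (j a) := by
  unfold linGen; fun_prop

@[fun_prop]
theorem primrec_binGen {f : α → List ℤ} {N d : α → ℕ} {ts : α → List Term} {t : α → WordPair}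
    (hf : Primrec f) (hN : Primrec N) (hd : Primrec d) (hts : Primrec ts) (ht : Primrec t) :
    Primrec fun a => binGen (f a) (N a) (d a) (ts a) (t a) := by
  unfold binGen; fun_prop

@[fun_prop]
theorem primrec_idealGens {f : α → List ℤ} {N d : α → ℕ} {ts : α → List Term}
    (hf : Primrec f) (hN : Primrec N) (hd : Primrec d) (hts : Primrec ts) :
    Primrec fun a => idealGens (f a) (N a) (d a) (ts a) := by
  unfold idealGens relEqs; fun_prop

@[fun_prop]
theorem primrec_expTable {d : α → ℕ} {w : α → List (ℕ × ℕ)} (hd : Primrec d) (hw : Primrec w) :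
    Primrec fun a => expTable (d a) (w a) := by
  unfold expTable; fun_prop

@[fun_prop]
theorem primrec_lookupCode {D : α → List NumCode} {h : α → List ℤ} (hD : Primrec D)
    (hh : Primrec h) : Primrec fun a => lookupCode (D a) (h a) := by
  unfold lookupCode; fun_prop

theorem primrec_certOut : Primrec fun p : MatCode × Cert => certOut p.1 p.2 := by
  unfold certOut; fun_prop

@[fun_prop]
theorem primrec_fieldOK {f : α → List ℤ} {x : α → Approx} {N : α → ℕ} (hf : Primrec f)
    (hx : Primrec x) (hN : Primrec N) : Primrec fun a => fieldOK (f a) (x a) (N a) := by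
  unfold fieldOK; fun_prop

@[fun_prop]
theorem primrec_inputOK {f : α → List ℤ} {x : α → Approx} {N : α → ℕ} {M : α → KMat}
    {c : α → MatCode} (hf : Primrec f) (hx : Primrec x) (hN : Primrec N) (hM : Primrec M)
    (hc : Primrec c) : Primrec fun a => inputOK (f a) (x a) (N a) (M a) (c a) := by
  unfold inputOK; fun_prop

@[fun_prop]
theorem primrec_chainOK {ts : α → List Term} (hts : Primrec ts) :
    Primrec fun a => chainOK (ts a) := by
  unfold chainOK; fun_prop

@[fun_prop]
theorem primrec_odeOK {f : α → List ℤ} {N d : α → ℕ} {M : α → KMat} {ts : α → List Term}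
    (hf : Primrec f) (hN : Primrec N) (hd : Primrec d) (hM : Primrec M) (hts : Primrec ts) :
    Primrec fun a => odeOK (f a) (N a) (d a) (M a) (ts a) := by
  unfold odeOK; fun_prop

@[fun_prop]
theorem primrec_initOK {f : α → List ℤ} {N d : α → ℕ} {ts : α → List Term}
    (hf : Primrec f) (hN : Primrec N) (hd : Primrec d) (hts : Primrec ts) :
    Primrec fun a => initOK (f a) (N a) (d a) (ts a) := by
  unfold initOK; fun_prop

@[fun_prop]
theorem primrec_dualOK {f : α → List ℤ} {N d : α → ℕ} {ts : α → List Term}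
    (hf : Primrec f) (hN : Primrec N) (hd : Primrec d) (hts : Primrec ts) :
    Primrec fun a => dualOK (f a) (N a) (d a) (ts a) := by
  unfold dualOK; fun_prop

@[fun_prop]
theorem primrec_dictOK {f : α → List ℤ} {x : α → Approx} {D : α → List NumCode}
    {Ws : α → List WPoly} (hf : Primrec f) (hx : Primrec x) (hD : Primrec D) (hW : Primrec Ws) :
    Primrec fun a => dictOK (f a) (x a) (D a) (Ws a) := by
  unfold dictOK; fun_prop

theorem primrec_certOK : Primrec fun p : MatCode × Cert => certOK p.1 p.2 := by
  unfold certOK; fun_prop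

end Primrec

end AlgFlow

/-! ### Values of coordinate vectors -/

namespace AlgFlow

open Finset

/-- The value at `θ` of the polynomial with coefficient list `p`. -/
def evalList (θ : ℂ) (p : List ℤ) : ℂ := p.foldr (fun a acc => a + θ * acc) 0

theorem evalList_eq_sum (θ : ℂ) (p : List ℤ) :
    evalList θ p = ∑ i ∈ range p.length, (p.getD i 0 : ℂ) * θ ^ i := by
  induction p with
  | nil => simp [evalList]
  | cons a p ih =>
    rw [List.length_cons, sum_range_succ']
    have : evalList θ (a :: p) = a + θ * evalList θ p := rfl
    rw [this, ih, mul_sum, add_comm]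
    simp only [List.getD_cons_succ, List.getD_cons_zero, pow_zero, mul_one, add_left_inj]
    refine sum_congr rfl fun i _ => ?_
    ring

theorem aeval_poly (θ : ℂ) (c : NumCode) : Polynomial.aeval θ c.poly = evalList θ c.1 := by
  rw [evalList_eq_sum, NumCode.poly, map_sum]
  simp

/-- The value at `θ` of a coordinate vector of length `m`. -/
def kval (m : ℕ) (θ : ℂ) (v : List ℤ) : ℂ := ∑ i ∈ range m, (v.getD i 0 : ℂ) * θ ^ i

theorem getD_vec (m : ℕ) (g : ℕ → ℤ) (i : ℕ) : (vec m g).getD i 0 = if i < m then g i else 0 := by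
  by_cases h : i < m <;> simp [vec, List.getD, h]

theorem length_vec (m : ℕ) (g : ℕ → ℤ) : (vec m g).length = m := by simp [vec]

theorem length_trunc (m : ℕ) (v : List ℤ) : (trunc m v).length = m := length_vec _ _

theorem kval_vec (m : ℕ) (θ : ℂ) (g : ℕ → ℤ) :
    kval m θ (vec m g) = ∑ i ∈ range m, (g i : ℂ) * θ ^ i :=
  sum_congr rfl fun i hi => by rw [getD_vec, if_pos (mem_range.1 hi)]

theorem kval_trunc (m : ℕ) (θ : ℂ) (v : List ℤ) : kval m θ (trunc m v) = kval m θ v :=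
  kval_vec _ _ _

theorem evalList_trunc (m : ℕ) (θ : ℂ) (v : List ℤ) : evalList θ (trunc m v) = kval m θ v := by
  rw [evalList_eq_sum, length_trunc]; exact kval_trunc m θ v

theorem kval_nil (m : ℕ) (θ : ℂ) : kval m θ [] = 0 := by simp [kval]

theorem kval_const {m : ℕ} (hm : 0 < m) (θ : ℂ) (a : ℤ) : kval m θ [a] = a := by
  obtain ⟨n, rfl⟩ := Nat.exists_eq_succ_of_ne_zero hm.ne'
  rw [kval, sum_range_succ']
  simp

theorem kval_kadd (m : ℕ) (θ : ℂ) (v w : List ℤ) :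
    kval m θ (kadd m v w) = kval m θ v + kval m θ w := by
  rw [kadd, kval_vec, kval, kval, ← sum_add_distrib]
  exact sum_congr rfl fun i _ => by push_cast; ring

theorem kval_ksmul (m : ℕ) (θ : ℂ) (z : ℤ) (v : List ℤ) :
    kval m θ (ksmul m z v) = z * kval m θ v := by
  rw [ksmul, kval_vec, kval, mul_sum]
  exact sum_congr rfl fun i _ => by push_cast; ring

theorem kval_ksum (m n : ℕ) (θ : ℂ) (g : ℕ → List ℤ) :
    kval m θ (ksum m n g) = ∑ i ∈ range n, kval m θ (g i) := by
  have : ∀ l : List ℕ, kval m θ (l.foldr (fun i acc => kadd m (g i) acc) []) =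
      (l.map fun i => kval m θ (g i)).sum := by
    intro l
    induction l with
    | nil => simp [kval_nil]
    | cons a l ih => simp [kval_kadd, ih]
  rw [ksum, this]
  rfl

/-- `θ` is a root of the monic polynomial with lower coefficients `f`. -/
def IsRootOf (f : List ℤ) (θ : ℂ) : Prop := kval f.length θ f + θ ^ f.length = 0

/-- The powers of `θ` with exponent less than `m` are linearly independent over `ℤ`. -/
def PowIndep (m : ℕ) (θ : ℂ) : Prop := ∀ v, kval m θ v = 0 → ∀ i < m, v.getD i 0 = 0

variable {f : List ℤ} {θ : ℂ}

theorem kval_kshift (hm : 0 < f.length) (hf : IsRootOf f θ) (v : List ℤ) :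
    kval f.length θ (kshift f v) = θ * kval f.length θ v := by
  obtain ⟨n, hn⟩ := Nat.exists_eq_succ_of_ne_zero hm.ne'
  have hf' : kval f.length θ f = -θ ^ f.length := eq_neg_of_add_eq_zero_left hf
  rw [kshift, kval_vec]
  have : ∀ i ∈ range f.length, (((bif decide (i = 0) then 0 else v.getD (i - 1) 0) -
      v.getD (f.length - 1) 0 * f.getD i 0 : ℤ) : ℂ) * θ ^ i =
      ((bif decide (i = 0) then 0 else v.getD (i - 1) 0 : ℤ) : ℂ) * θ ^ i -
      (v.getD (f.length - 1) 0 : ℂ) * ((f.getD i 0 : ℂ) * θ ^ i) := by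
    intro i _; push_cast; ring
  rw [sum_congr rfl this, sum_sub_distrib, ← mul_sum]
  change _ - _ * kval f.length θ f = _
  rw [hf', kval, hn, sum_range_succ', mul_sum, sum_range_succ]
  simp only [Nat.succ_eq_add_one, Nat.add_eq_zero_iff, one_ne_zero, and_false, decide_false,
    cond_false, Nat.add_sub_cancel, decide_true, cond_true, Int.cast_zero, zero_mul, add_zero]
  rw [sum_congr rfl fun i _ => show (v.getD i 0 : ℂ) * θ ^ (i + 1) =
    θ * ((v.getD i 0 : ℂ) * θ ^ i) by ring]
  ring

theorem kval_kmul (hm : 0 < f.length) (hf : IsRootOf f θ) (v w : List ℤ) :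
    kval f.length θ (kmul f v w) = kval f.length θ v * kval f.length θ w := by
  have : ∀ l : List ℤ, kval f.length θ (l.foldr
      (fun a acc => kadd f.length (kshift f acc) (ksmul f.length a w)) []) =
      evalList θ l * kval f.length θ w := by
    intro l
    induction l with
    | nil => simp [kval_nil, evalList]
    | cons a l ih =>
      have e : evalList θ (a :: l) = a + θ * evalList θ l := rfl
      simp only [List.foldr_cons, kval_kadd, kval_kshift hm hf, kval_ksmul, ih, e]
      ring
  rw [kmul, this, evalList_trunc]

theorem kval_khorner (hm : 0 < f.length) (hf : IsRootOf f θ) (p h : List ℤ) :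
    kval f.length θ (khorner f p h) = evalList (kval f.length θ h) p := by
  induction p with
  | nil => simp [khorner, kval_nil, evalList]
  | cons a p ih =>
    have e : khorner f (a :: p) h = kadd f.length [a] (kmul f h (khorner f p h)) := rfl
    have e' : evalList (kval f.length θ h) (a :: p) =
      a + kval f.length θ h * evalList (kval f.length θ h) p := rfl
    rw [e, e', kval_kadd, kval_const hm, kval_kmul hm hf, ih]

theorem evalList_homog (p : List ℤ) {N : ℕ} (hN : 0 < N) (z : ℂ) :
    evalList z (homog p N) = N ^ p.length * evalList (z / N) p := by
  have hN' : (N : ℂ) ≠ 0 := by exact_mod_cast hN.ne'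
  rw [evalList_eq_sum, evalList_eq_sum, mul_sum]
  simp only [homog, List.length_map, List.length_range]
  refine sum_congr rfl fun i hi => ?_
  have hi := mem_range.1 hi
  have : (((List.range p.length).map fun i => p.getD i 0 * ((N ^ (p.length - i) : ℕ) : ℤ)).getD i 0)
      = p.getD i 0 * ((N ^ (p.length - i) : ℕ) : ℤ) := by
    simp [List.getD, hi]
  rw [this, div_pow]
  obtain ⟨k, hk⟩ := Nat.exists_eq_add_of_le hi.le
  rw [hk, Nat.add_sub_cancel_left, pow_add]
  push_cast
  field_simp

theorem keq_iff {m : ℕ} {v w : List ℤ} : keq m v w = true ↔ ∀ i < m, v.getD i 0 = w.getD i 0 := by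
  simp [keq]

theorem kval_eq_of_keq {m : ℕ} {v w : List ℤ} (h : keq m v w = true) : kval m θ v = kval m θ w :=
  sum_congr rfl fun i hi => by rw [keq_iff.1 h i (mem_range.1 hi)]

theorem keq_of_kval_eq {m : ℕ} (hi : PowIndep m θ) {v w : List ℤ} (h : kval m θ v = kval m θ w) :
    keq m v w = true := by
  rw [keq_iff]
  intro i him
  have := hi (kadd m v (ksmul m (-1) w)) (by rw [kval_kadd, kval_ksmul, h]; push_cast; ring) i him
  rw [kadd, getD_vec, if_pos him, ksmul, getD_vec, if_pos him] at this
  linarith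

theorem keq_iff_kval {m : ℕ} (hi : PowIndep m θ) {v w : List ℤ} :
    keq m v w = true ↔ kval m θ v = kval m θ w :=
  ⟨kval_eq_of_keq, keq_of_kval_eq hi⟩

theorem keq_khorner_iff (hm : 0 < f.length) (hf : IsRootOf f θ) (hi : PowIndep f.length θ)
    (c : NumCode) {N : ℕ} (hN : 0 < N) (h : List ℤ) :
    keq f.length (khorner f (homog c.1 N) h) [] = true ↔
      Polynomial.aeval (kval f.length θ h / N) c.poly = 0 := by
  rw [keq_iff_kval hi, kval_khorner hm hf, kval_nil, evalList_homog _ hN, aeval_poly]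
  have hN' : (N : ℂ) ≠ 0 := by exact_mod_cast hN.ne'
  simp [hN']

end AlgFlow

/-! ### Numerical tests -/

namespace AlgFlow

open Complex

/-- The centre of an approximation. -/
noncomputable def Approx.center (x : Approx) : ℂ := ((x.1 : ℂ) + (x.2.1 : ℂ) * I) / (x.2.2.1 : ℂ)

/-- The derivative at `c` of the polynomial with coefficient list `p`. -/
noncomputable def derivList (c : ℂ) : List ℤ → ℂ
  | [] => 0
  | _ :: p => evalList c p + c * derivList c p

/-- A bound for the values on the disc of radius `R`. -/
def valBound (R : ℕ) : List ℤ → ℕ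
  | [] => 0
  | a :: p => a.natAbs + R * valBound R p

/-- A Lipschitz constant on the disc of radius `R`. -/
def lipBound (R : ℕ) : List ℤ → ℕ
  | [] => 0
  | _ :: p => R * lipBound R p + valBound R p

/-- A bound for the second differences on the disc of radius `R`. -/
def sndBound (R : ℕ) : List ℤ → ℕ
  | [] => 0
  | _ :: p => 2 * lipBound R p + R * sndBound R p

theorem evalList_cons (θ : ℂ) (a : ℤ) (p : List ℤ) :
    evalList θ (a :: p) = a + θ * evalList θ p := rfl

theorem num_cons (x : Approx) (a : ℤ) (p : List ℤ) : num x (a :: p) = numStep x a (num x p) := rfl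

theorem num_spec (x : Approx) (hs : 0 < x.2.2.1) (p : List ℤ) :
    0 < (num x p).2.2.1 ∧
    ((num x p).1.1 : ℂ) + ((num x p).1.2 : ℂ) * I = (num x p).2.2.1 * evalList x.center p ∧
    ((num x p).2.1.1 : ℂ) + ((num x p).2.1.2 : ℂ) * I = (num x p).2.2.1 * derivList x.center p ∧
    (num x p).2.2.2.1 = valBound x.2.2.2.2 p ∧ (num x p).2.2.2.2.1 = lipBound x.2.2.2.2 p ∧
    (num x p).2.2.2.2.2 = sndBound x.2.2.2.2 p := by
  have hs' : (x.2.2.1 : ℂ) ≠ 0 := by exact_mod_cast hs.ne'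
  have hc : (x.1 : ℂ) + (x.2.1 : ℂ) * I = x.2.2.1 * x.center := by
    rw [Approx.center]; field_simp
  induction p with
  | nil => simp [num, evalList, derivList, valBound, lipBound, sndBound]
  | cons a p ih =>
    obtain ⟨h1, h2, h3, h4, h5, h6⟩ := ih
    rw [num_cons]
    generalize num x p = y at *
    refine ⟨?_, ?_, ?_, ?_, ?_, ?_⟩
    · simp only [numStep]; positivity
    · simp only [numStep, evalList_cons]
      push_cast
      have : ((x.1 : ℂ) + (x.2.1 : ℂ) * I) * ((y.1.1 : ℂ) + (y.1.2 : ℂ) * I) =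
        (x.2.2.1 * x.center) * (y.2.2.1 * evalList x.center p) := by rw [hc, h2]
      linear_combination this - (x.2.1 : ℂ) * y.1.2 * I_sq
    · simp only [numStep, derivList]
      push_cast
      have : ((x.1 : ℂ) + (x.2.1 : ℂ) * I) * ((y.2.1.1 : ℂ) + (y.2.1.2 : ℂ) * I) =
        (x.2.2.1 * x.center) * (y.2.2.1 * derivList x.center p) := by rw [hc, h3]
      linear_combination this - (x.2.1 : ℂ) * y.2.1.2 * I_sq + (x.2.2.1 : ℂ) * h2
    · simp only [numStep, valBound, h4]; push_cast; rfl
    · simp only [numStep, lipBound, h4, h5]; push_cast; rfl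
    · simp only [numStep, sndBound, h5, h6]; push_cast; rfl

theorem norm_evalList_le {R : ℕ} {z : ℂ} (hz : ‖z‖ ≤ R) (p : List ℤ) :
    ‖evalList z p‖ ≤ valBound R p := by
  induction p with
  | nil => simp [evalList, valBound]
  | cons a p ih =>
    rw [evalList_cons, valBound]
    push_cast
    refine (norm_add_le _ _).trans (add_le_add ?_ ?_)
    · rw [Complex.norm_intCast, Nat.cast_natAbs, Int.cast_abs]
    · rw [norm_mul]; gcongr

theorem norm_evalList_sub_le {R : ℕ} {z w : ℂ} (hz : ‖z‖ ≤ R) (hw : ‖w‖ ≤ R) (p : List ℤ) :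
    ‖evalList z p - evalList w p‖ ≤ lipBound R p * ‖z - w‖ := by
  induction p with
  | nil => simp [evalList, lipBound]
  | cons a p ih =>
    rw [evalList_cons, evalList_cons, lipBound]
    have : (a : ℂ) + z * evalList z p - (a + w * evalList w p) =
      z * (evalList z p - evalList w p) + evalList w p * (z - w) := by ring
    rw [this]
    refine (norm_add_le _ _).trans ?_
    rw [norm_mul, norm_mul]
    have h1 : ‖z‖ * ‖evalList z p - evalList w p‖ ≤ R * (lipBound R p * ‖z - w‖) := by gcongr
    have h2 : ‖evalList w p‖ * ‖z - w‖ ≤ valBound R p * ‖z - w‖ := by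
      gcongr; exact norm_evalList_le hw p
    push_cast
    linarith

theorem norm_derivList_le {R : ℕ} {z : ℂ} (hz : ‖z‖ ≤ R) (p : List ℤ) :
    ‖derivList z p‖ ≤ lipBound R p := by
  induction p with
  | nil => simp [derivList, lipBound]
  | cons a p ih =>
    rw [derivList, lipBound]
    push_cast
    rw [add_comm]
    refine (norm_add_le _ _).trans (add_le_add ?_ (norm_evalList_le hz p))
    rw [norm_mul]; gcongr

theorem norm_second_difference_le {R : ℕ} {c z w : ℂ} {ε : ℝ} (hR : ∀ y, ‖y - c‖ ≤ ε → ‖y‖ ≤ R)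
    (hz : ‖z - c‖ ≤ ε) (hw : ‖w - c‖ ≤ ε) (p : List ℤ) :
    ‖evalList w p - evalList z p - derivList c p * (w - z)‖ ≤ ε * sndBound R p * ‖w - z‖ := by
  have hε : 0 ≤ ε := (norm_nonneg _).trans hz
  have hc : ‖c‖ ≤ R := hR c (by simpa using hε)
  induction p with
  | nil => simp [evalList, derivList, sndBound]
  | cons a p ih =>
    rw [evalList_cons, evalList_cons, derivList, sndBound]
    have : (a : ℂ) + w * evalList w p - (a + z * evalList z p) -
        (evalList c p + c * derivList c p) * (w - z) =
      w * (evalList w p - evalList z p - derivList c p * (w - z)) +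
      ((evalList z p - evalList c p) * (w - z) + (w - c) * (derivList c p * (w - z))) := by ring
    rw [this]
    refine (norm_add_le _ _).trans ((add_le_add_right (norm_add_le _ _) _).trans ?_)
    have h1 : ‖w * (evalList w p - evalList z p - derivList c p * (w - z))‖ ≤
        R * (ε * sndBound R p * ‖w - z‖) := by
      rw [norm_mul]; gcongr; exact hR w hw
    have h2 : ‖(evalList z p - evalList c p) * (w - z)‖ ≤ (lipBound R p * ε) * ‖w - z‖ := by
      rw [norm_mul]; gcongr
      exact (norm_evalList_sub_le (hR z hz) hc p).trans (by gcongr)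
    have h3 : ‖(w - c) * (derivList c p * (w - z))‖ ≤ ε * (lipBound R p * ‖w - z‖) := by
      rw [norm_mul, norm_mul]; gcongr; exact norm_derivList_le hc p
    push_cast
    linarith

theorem norm_center_le {x : Approx} (hs : 0 < x.2.2.1) (h : boundOK x = true) :
    ‖x.center‖ + 1 ≤ x.2.2.2.2 := by
  have h' : x.1.natAbs + x.2.1.natAbs + x.2.2.1 ≤ x.2.2.2.2 * x.2.2.1 := by
    simpa [boundOK] using h
  have hs' : (0 : ℝ) < x.2.2.1 := by exact_mod_cast hs
  have h'' : ((x.1.natAbs : ℕ) : ℝ) + (x.2.1.natAbs : ℕ) + x.2.2.1 ≤ x.2.2.2.2 * x.2.2.1 := by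
    exact_mod_cast h'
  rw [Approx.center, norm_div, Complex.norm_natCast, ← le_sub_iff_add_le, div_le_iff₀ hs']
  refine (norm_add_le _ _).trans ?_
  rw [norm_mul, Complex.norm_intCast, Complex.norm_intCast, norm_I, mul_one]
  rw [Nat.cast_natAbs, Nat.cast_natAbs, Int.cast_abs, Int.cast_abs] at h''
  linarith

theorem sq_norm_int (a b : ℤ) : ‖(a : ℂ) + (b : ℂ) * I‖ ^ 2 = ((a * a + b * b : ℤ) : ℝ) := by
  rw [Complex.sq_norm, Complex.normSq_apply]; simp

theorem inDisc_iff {x : Approx} (hs : 0 < x.2.2.1) (N : ℕ) (h : List ℤ) (c : NumCode) :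
    inDisc x N h c = true ↔
      x.2.2.2.1 * ‖((c.2.2.2 : ℂ) + 1) * evalList x.center h - N * (c.2.1 + c.2.2.1 * I)‖ <
        (N : ℝ) * x.2.2.2.1 - (c.2.2.2 + 1) * lipBound x.2.2.2.2 h := by
  obtain ⟨hS, hP, -, -, hL, -⟩ := num_spec x hs h
  simp only [inDisc, Bool.and_eq_true, decide_eq_true_eq]
  generalize num x h = y at *
  set X1 : ℤ := (c.2.2.2 + 1) * y.1.1 - N * y.2.2.1 * c.2.1 with hX1
  set X2 : ℤ := (c.2.2.2 + 1) * y.1.2 - N * y.2.2.1 * c.2.2.1 with hX2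
  set Y : ℤ := N * y.2.2.1 * x.2.2.2.1 - (c.2.2.2 + 1) * y.2.2.1 * y.2.2.2.2.1 with hY
  have hS' : (0 : ℝ) < y.2.2.1 := by exact_mod_cast hS
  have e1 : (X1 : ℂ) + (X2 : ℂ) * I = (y.2.2.1 : ℂ) *
      (((c.2.2.2 : ℂ) + 1) * evalList x.center h - N * (c.2.1 + c.2.2.1 * I)) := by
    rw [hX1, hX2]; push_cast
    linear_combination ((c.2.2.2 : ℂ) + 1) * hP
  have e2 : (Y : ℝ) = (y.2.2.1 : ℝ) *
      ((N : ℝ) * x.2.2.2.1 - (c.2.2.2 + 1) * lipBound x.2.2.2.2 h) := by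
    rw [hY, hL]; push_cast; ring
  have e3 : (y.2.2.1 : ℝ) * (x.2.2.2.1 *
      ‖((c.2.2.2 : ℂ) + 1) * evalList x.center h - N * (c.2.1 + c.2.2.1 * I)‖) =
      x.2.2.2.1 * ‖(X1 : ℂ) + (X2 : ℂ) * I‖ := by
    rw [e1, norm_mul, Complex.norm_intCast, abs_of_pos hS']; ring
  rw [← mul_lt_mul_iff_right₀ hS', ← e2, e3]
  have hnn : 0 ≤ (x.2.2.2.1 : ℝ) * ‖(X1 : ℂ) + (X2 : ℂ) * I‖ := by positivity
  have hsq : ((x.2.2.2.1 : ℝ) * ‖(X1 : ℂ) + (X2 : ℂ) * I‖) ^ 2 =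
      (((x.2.2.2.1 * x.2.2.2.1) * (X1 * X1 + X2 * X2) : ℤ) : ℝ) := by
    rw [mul_pow, sq_norm_int]; push_cast; ring
  constructor
  · rintro ⟨h1, h2⟩
    have h1' : (0 : ℝ) < Y := by exact_mod_cast h1
    refine lt_of_pow_lt_pow_left₀ 2 h1'.le ?_
    rw [hsq, sq]; exact_mod_cast h2
  · intro h1
    have h1' := hnn.trans_lt h1
    refine ⟨by exact_mod_cast h1', ?_⟩
    have := pow_lt_pow_left₀ h1 hnn two_ne_zero
    rw [hsq, sq (Y : ℝ)] at this
    exact_mod_cast this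

theorem farZero_iff {x : Approx} (hs : 0 < x.2.2.1) (h : List ℤ) :
    farZero x h = true ↔ (lipBound x.2.2.2.2 h : ℝ) < x.2.2.2.1 * ‖evalList x.center h‖ := by
  obtain ⟨hS, hP, -, -, hL, -⟩ := num_spec x hs h
  simp only [farZero, decide_eq_true_eq]
  generalize num x h = y at *
  have hS' : (0 : ℝ) < y.2.2.1 := by exact_mod_cast hS
  have e : (y.2.2.1 : ℝ) * (x.2.2.2.1 * ‖evalList x.center h‖) =
      x.2.2.2.1 * ‖(y.1.1 : ℂ) + (y.1.2 : ℂ) * I‖ := by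
    rw [hP, norm_mul, Complex.norm_intCast, abs_of_pos hS']; ring
  rw [← mul_lt_mul_iff_right₀ hS', e, Iff.comm, ← pow_lt_pow_iff_left₀ (by positivity) (by positivity)
    two_ne_zero, mul_pow (x.2.2.2.1 : ℝ), sq_norm_int, hL, ← Int.cast_lt (R := ℝ)]
  push_cast
  rw [sq, sq]

theorem rootOK_iff {x : Approx} (hs : 0 < x.2.2.1) (f : List ℤ) :
    rootOK x f = true ↔ (x.2.2.2.1 : ℝ) ^ f.length * ‖evalList x.center (f ++ [1])‖ < 1 := by
  obtain ⟨hS, hP, -, -, -, -⟩ := num_spec x hs (f ++ [1])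
  simp only [rootOK, decide_eq_true_eq]
  generalize num x (f ++ [1]) = y at *
  have hS' : (0 : ℝ) < y.2.2.1 := by exact_mod_cast hS
  have e : (y.2.2.1 : ℝ) * ((x.2.2.2.1 : ℝ) ^ f.length * ‖evalList x.center (f ++ [1])‖) =
      (x.2.2.2.1 : ℝ) ^ f.length * ‖(y.1.1 : ℂ) + (y.1.2 : ℂ) * I‖ := by
    rw [hP, norm_mul, Complex.norm_intCast, abs_of_pos hS']; ring
  rw [← mul_lt_mul_iff_right₀ hS', e, mul_one, ← pow_lt_pow_iff_left₀ (by positivity) hS'.le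
    two_ne_zero, mul_pow, sq_norm_int, ← Int.cast_lt (R := ℝ)]
  push_cast
  rw [sq, sq]

theorem uniqOK_iff (R : ℕ) (c : NumCode) :
    uniqOK R c = true ↔ boundOK (codeApprox R c) = true ∧
      (sndBound R c.1 : ℝ) < (c.2.2.2 + 1) * ‖derivList (codeApprox R c).center c.1‖ := by
  obtain ⟨hS, -, hD, -, -, hQ⟩ := num_spec (codeApprox R c) (Nat.succ_pos _) c.1
  simp only [uniqOK, Bool.and_eq_true, decide_eq_true_eq]
  refine and_congr_right fun _ => ?_
  have hR : (codeApprox R c).2.2.2.2 = R := rfl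
  rw [hR] at hQ
  generalize num (codeApprox R c) c.1 = y at *
  have hS' : (0 : ℝ) < y.2.2.1 := by exact_mod_cast hS
  have e : (y.2.2.1 : ℝ) * ((c.2.2.2 + 1) * ‖derivList (codeApprox R c).center c.1‖) =
      (c.2.2.2 + 1) * ‖(y.2.1.1 : ℂ) + (y.2.1.2 : ℂ) * I‖ := by
    rw [hD, norm_mul, Complex.norm_intCast, abs_of_pos hS']; ring
  rw [← mul_lt_mul_iff_right₀ hS', e, Iff.comm, ← pow_lt_pow_iff_left₀ (by positivity) (by positivity)
    two_ne_zero, mul_pow ((c.2.2.2 : ℝ) + 1), sq_norm_int, hQ, ← Int.cast_lt (R := ℝ)]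
  push_cast
  rw [sq, sq]

theorem derivList_eq (c : NumCode) (z : ℂ) :
    derivList z c.1 = Polynomial.aeval z c.poly.derivative := by
  obtain ⟨p, y⟩ := c
  induction p with
  | nil => simp [NumCode.poly, derivList]
  | cons a p ih =>
    have e : NumCode.poly (a :: p, y) = Polynomial.C a + Polynomial.X * NumCode.poly (p, y) := by
      simp only [NumCode.poly, List.length_cons]
      rw [Finset.sum_range_succ', add_comm, Finset.mul_sum]
      congr 1
      · simp
      · refine Finset.sum_congr rfl fun i _ => ?_
        simp only [List.getD_cons_succ]; ring
    have e2 := aeval_poly z (p, y)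
    simp only at ih e2
    simp only [e, derivList, Polynomial.derivative_C, zero_add,
      Polynomial.derivative_mul, Polynomial.derivative_X, one_mul, map_add, map_mul,
      Polynomial.aeval_X, ih, e2]

theorem codeApprox_disc (R : ℕ) (c : NumCode) :
    c.disc = Metric.ball (codeApprox R c).center (1 / ((c.2.2.2 : ℝ) + 1)) := by
  simp [NumCode.disc, Approx.center, codeApprox]

/-- The polynomial of a code that passes `uniqOK` is injective on the disc of the code. -/
theorem represents_of_uniqOK {R : ℕ} {c : NumCode} (h : uniqOK R c = true) {z : ℂ}
    (hz : z ∈ c.disc) (h0 : Polynomial.aeval z c.poly = 0) : c.Represents z := by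
  obtain ⟨hb, hq⟩ := (uniqOK_iff R c).1 h
  have hc := norm_center_le (Nat.succ_pos _) hb
  have hR : (codeApprox R c).2.2.2.2 = R := rfl
  rw [hR] at hc
  set x := (codeApprox R c).center with hx
  have hn : (0 : ℝ) < (c.2.2.2 : ℝ) + 1 := by positivity
  refine ⟨fun hp => ?_, ?_⟩
  · rw [hx, derivList_eq, hp] at hq
    simp only [map_zero, norm_zero, mul_zero] at hq
    exact absurd hq (by simp)
  · refine Set.eq_singleton_iff_unique_mem.2 ⟨⟨hz, h0⟩, fun w ⟨hw, hw0⟩ => ?_⟩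
    by_contra hne
    rw [codeApprox_disc R, Metric.mem_ball, dist_eq_norm] at hz hw
    have hε : 1 / ((c.2.2.2 : ℝ) + 1) ≤ 1 := by
      rw [div_le_one hn]; linarith [(Nat.cast_nonneg c.2.2.2 : (0 : ℝ) ≤ _)]
    have := norm_second_difference_le (R := R) (fun y hy => by
      have := norm_sub_norm_le y x
      linarith) hz.le hw.le c.1
    rw [aeval_poly] at h0 hw0
    rw [h0, hw0, sub_zero, zero_sub, norm_neg, norm_mul] at this
    have h2 := le_of_mul_le_mul_right this (norm_pos_iff.2 (sub_ne_zero.2 hne))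
    rw [one_div, ← div_eq_inv_mul, le_div_iff₀ hn] at h2
    linarith

/-- `θ` is close to the centre of the approximation. -/
structure Approx.Near (x : Approx) (θ : ℂ) : Prop where
  s_pos : 0 < x.2.2.1
  r_pos : 0 < x.2.2.2.1
  bound : boundOK x = true
  near : ‖θ - x.center‖ < 1 / x.2.2.2.1

theorem Approx.Near.norm_sub_le {x : Approx} {θ : ℂ} (h : x.Near θ) (p : List ℤ) :
    x.2.2.2.1 * ‖evalList θ p - evalList x.center p‖ ≤ lipBound x.2.2.2.2 p := by
  have hr : (0 : ℝ) < x.2.2.2.1 := by exact_mod_cast h.r_pos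
  have hc := norm_center_le h.s_pos h.bound
  have h1 : 1 / (x.2.2.2.1 : ℝ) ≤ 1 := by
    rw [div_le_one hr]; exact_mod_cast h.r_pos
  have hθ : ‖θ‖ ≤ x.2.2.2.2 := by
    have := norm_sub_norm_le θ x.center
    linarith [h.near]
  have := norm_evalList_sub_le (w := x.center) hθ (by linarith) p
  have h2 : ‖evalList θ p - evalList x.center p‖ ≤ lipBound x.2.2.2.2 p * (1 / x.2.2.2.1) :=
    this.trans (mul_le_mul_of_nonneg_left h.near.le (Nat.cast_nonneg _))
  calc _ ≤ (x.2.2.2.1 : ℝ) * (lipBound x.2.2.2.2 p * (1 / x.2.2.2.1)) := by gcongr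
    _ = _ := by field_simp

theorem mem_disc_iff {c : NumCode} {N : ℕ} (hN : 0 < N) (z : ℂ) :
    z / N ∈ c.disc ↔ ‖((c.2.2.2 : ℂ) + 1) * z - N * (c.2.1 + c.2.2.1 * I)‖ < N := by
  have hn : ((c.2.2.2 : ℂ) + 1) ≠ 0 := by exact_mod_cast Nat.succ_ne_zero c.2.2.2
  have hN' : (N : ℂ) ≠ 0 := by exact_mod_cast hN.ne'
  have hNr : (0 : ℝ) < N := by exact_mod_cast hN
  have hnr : (0 : ℝ) < (c.2.2.2 : ℝ) + 1 := by positivity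
  have e : z / N - (((c.2.1 : ℂ) + (c.2.2.1 : ℂ) * I) / ((c.2.2.2 : ℂ) + 1)) =
      (((c.2.2.2 : ℂ) + 1) * z - N * (c.2.1 + c.2.2.1 * I)) / (N * ((c.2.2.2 : ℂ) + 1)) := by
    field_simp
  have e2 : ‖((c.2.2.2 : ℂ) + 1)‖ = c.2.2.2 + 1 := by
    have := Complex.norm_natCast (c.2.2.2 + 1); push_cast at this; exact this
  rw [NumCode.disc, Metric.mem_ball, dist_eq_norm, e, norm_div, norm_mul, e2, Complex.norm_natCast,
    div_lt_div_iff₀ (by positivity) hnr, one_mul, mul_lt_mul_iff_left₀ hnr]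

theorem Approx.Near.mem_disc {x : Approx} {θ : ℂ} (hx : x.Near θ) {N : ℕ} (hN : 0 < N)
    {h : List ℤ} {c : NumCode} (hd : inDisc x N h c = true) : evalList θ h / N ∈ c.disc := by
  rw [inDisc_iff hx.s_pos] at hd
  rw [mem_disc_iff hN]
  have hr : (0 : ℝ) < x.2.2.2.1 := by exact_mod_cast hx.r_pos
  have hn : (0 : ℝ) < (c.2.2.2 : ℝ) + 1 := by positivity
  have h1 := hx.norm_sub_le h
  have e : ((c.2.2.2 : ℂ) + 1) * evalList θ h - N * (c.2.1 + c.2.2.1 * I) =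
    ((c.2.2.2 : ℂ) + 1) * (evalList θ h - evalList x.center h) +
    (((c.2.2.2 : ℂ) + 1) * evalList x.center h - N * (c.2.1 + c.2.2.1 * I)) := by ring
  have e2 : ‖((c.2.2.2 : ℂ) + 1)‖ = c.2.2.2 + 1 := by
    have := Complex.norm_natCast (c.2.2.2 + 1); push_cast at this; exact this
  rw [← mul_lt_mul_iff_right₀ hr, e]
  have h2 := mul_le_mul_of_nonneg_left (norm_add_le
    (((c.2.2.2 : ℂ) + 1) * (evalList θ h - evalList x.center h))
    (((c.2.2.2 : ℂ) + 1) * evalList x.center h - N * (c.2.1 + c.2.2.1 * I))) hr.le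
  rw [norm_mul, e2] at h2
  have h3 := mul_le_mul_of_nonneg_left h1 hn.le
  linarith

theorem Approx.Near.inDisc {x : Approx} {θ : ℂ} (hx : x.Near θ) {N : ℕ}
    {h : List ℤ} {c : NumCode}
    (hd : 2 * (c.2.2.2 + 1) * lipBound x.2.2.2.2 h < x.2.2.2.1 *
      (N - ‖((c.2.2.2 : ℂ) + 1) * evalList θ h - N * (c.2.1 + c.2.2.1 * I)‖)) :
    inDisc x N h c = true := by
  rw [inDisc_iff hx.s_pos]
  have hr : (0 : ℝ) < x.2.2.2.1 := by exact_mod_cast hx.r_pos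
  have hn : (0 : ℝ) < (c.2.2.2 : ℝ) + 1 := by positivity
  have h1 := hx.norm_sub_le h
  rw [norm_sub_rev] at h1
  have e : ((c.2.2.2 : ℂ) + 1) * evalList x.center h - N * (c.2.1 + c.2.2.1 * I) =
    ((c.2.2.2 : ℂ) + 1) * (evalList x.center h - evalList θ h) +
    (((c.2.2.2 : ℂ) + 1) * evalList θ h - N * (c.2.1 + c.2.2.1 * I)) := by ring
  have e2 : ‖((c.2.2.2 : ℂ) + 1)‖ = c.2.2.2 + 1 := by
    have := Complex.norm_natCast (c.2.2.2 + 1); push_cast at this; exact this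
  rw [e]
  have h2 := mul_le_mul_of_nonneg_left (norm_add_le
    (((c.2.2.2 : ℂ) + 1) * (evalList x.center h - evalList θ h))
    (((c.2.2.2 : ℂ) + 1) * evalList θ h - N * (c.2.1 + c.2.2.1 * I))) hr.le
  rw [norm_mul, e2] at h2
  have h3 := mul_le_mul_of_nonneg_left h1 hn.le
  linarith

theorem Approx.Near.ne_zero {x : Approx} {θ : ℂ} (hx : x.Near θ) {h : List ℤ}
    (hz : farZero x h = true) : evalList θ h ≠ 0 := by
  intro h0
  rw [farZero_iff hx.s_pos] at hz
  have := hx.norm_sub_le h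
  rw [h0, zero_sub, norm_neg] at this
  linarith

theorem Approx.Near.farZero {x : Approx} {θ : ℂ} (hx : x.Near θ) {h : List ℤ}
    (hz : 2 * (lipBound x.2.2.2.2 h : ℝ) < x.2.2.2.1 * ‖evalList θ h‖) : farZero x h = true := by
  rw [farZero_iff hx.s_pos]
  have hr : (0 : ℝ) < x.2.2.2.1 := by exact_mod_cast hx.r_pos
  have h1 := hx.norm_sub_le h
  have h2 := mul_le_mul_of_nonneg_left (norm_sub_norm_le (evalList θ h) (evalList x.center h)) hr.le
  linarith

end AlgFlow

/-! ### Generators of the monoid of balanced pairs -/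

namespace AlgFlow

section ZeroSum

variable {α : Type*} (f : α → ℤ) {C : ℤ}

theorem exists_perm_bounded_prefix_sums : ∀ (ws : List α) (p : ℤ), (∀ x ∈ ws, |f x| ≤ C) →
    |p| ≤ C → p + (ws.map f).sum = 0 →
    ∃ ws', ws.Perm ws' ∧ ∀ i, |p + ((ws'.take i).map f).sum| ≤ C := by
  intro ws
  induction h : ws.length generalizing ws with
  | zero =>
    intro p _ hp _
    rw [List.length_eq_zero_iff] at h
    subst h
    exact ⟨[], List.Perm.refl _, fun i => by simpa using hp⟩
  | succ n ih =>
    intro p hC hp hsum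
    have hne : ws ≠ [] := by rintro rfl; simp at h
    have hx : ∃ x ∈ ws, |p + f x| ≤ C := by
      rcases le_or_gt p 0 with hp0 | hp0
      · obtain ⟨x, hx, hx0⟩ := List.exists_le_of_sum_le (f := fun _ => (0 : ℤ)) (g := f) hne
          (by simp; linarith)
        refine ⟨x, hx, ?_⟩
        have := abs_le.1 (hC x hx)
        rw [abs_le] at hp ⊢
        constructor <;> linarith
      · obtain ⟨x, hx, hx0⟩ := List.exists_le_of_sum_le (g := fun _ => (0 : ℤ)) (f := f) hne
          (by simp; linarith)
        refine ⟨x, hx, ?_⟩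
        have := abs_le.1 (hC x hx)
        rw [abs_le] at hp ⊢
        constructor <;> linarith
    obtain ⟨x, hx, hpx⟩ := hx
    obtain ⟨s, t, rfl⟩ := List.append_of_mem hx
    have hperm : (s ++ x :: t).Perm (x :: (s ++ t)) := List.perm_middle
    obtain ⟨ws', hw, hb⟩ := ih (s ++ t) (by simp at h ⊢; omega) (p + f x)
      (fun y hy => hC y (hperm.mem_iff.2 (List.mem_cons_of_mem _ hy))) hpx (by
        simp only [List.map_append, List.map_cons, List.sum_append, List.sum_cons] at hsum ⊢
        linarith)
    refine ⟨x :: ws', hperm.trans (hw.cons x), fun i => ?_⟩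
    cases i with
    | zero => simpa using hp
    | succ i => simpa [add_assoc] using hb i

theorem exists_zero_sum_split (ws : List α) (hC : ∀ x ∈ ws, |f x| ≤ C) (hC0 : 0 ≤ C)
    (hsum : (ws.map f).sum = 0) (hlen : 2 * C + 1 < ws.length) :
    ∃ a b, ws.Perm (a ++ b) ∧ a ≠ [] ∧ b ≠ [] ∧ (a.map f).sum = 0 := by
  obtain ⟨w, hw, hb⟩ := exists_perm_bounded_prefix_sums f ws 0 hC (by simpa using hC0)
    (by simpa using hsum)
  simp only [zero_add] at hb
  have hcard : (Finset.Icc (-C) C).card < (Finset.range ws.length).card := by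
    rw [Int.card_Icc, Finset.card_range]; omega
  obtain ⟨i, hi, j, hj, hne, hij⟩ := Finset.exists_ne_map_eq_of_card_lt_of_maps_to hcard
    (f := fun i => ((w.take i).map f).sum) (fun i _ => by
      simpa [abs_le] using hb i)
  wlog hlt : i < j generalizing i j
  · exact this j hj i hi hne.symm hij.symm (lt_of_le_of_ne (not_lt.1 hlt) hne.symm)
  have hjl : j < w.length := by rw [← hw.length_eq]; simpa using hj
  refine ⟨(w.take j).drop i, w.take i ++ w.drop j, ?_, ?_, ?_, ?_⟩
  · refine hw.trans ?_
    have e : w = (w.take i ++ (w.take j).drop i) ++ w.drop j := by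
      conv_lhs => rw [← List.take_append_drop j w, ← List.take_append_drop i (w.take j)]
      rw [List.take_take, min_eq_left hlt.le]
    conv_lhs => rw [e]
    rw [← List.append_assoc]
    exact (List.perm_append_comm).append_right _
  · intro h
    have := congrArg List.length h
    simp at this
    omega
  · intro h
    have := congrArg List.length h
    simp at this
    omega
  · have e : (w.take j) = w.take i ++ (w.take j).drop i := by
      conv_lhs => rw [← List.take_append_drop i (w.take j)]
      rw [List.take_take, min_eq_left hlt.le]
    rw [e, List.map_append, List.sum_append] at hij
    linarith

end ZeroSum

theorem mem_listsUpTo {α : Type*} {G : List α} {L : ℕ} {l : List α} :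
    l ∈ listsUpTo G L ↔ (∀ x ∈ l, x ∈ G) ∧ l.length ≤ L := by
  induction L generalizing l with
  | zero => simp [listsUpTo]; rintro rfl; simp
  | succ L ih =>
    have e : listsUpTo G (L + 1) = [] :: G.flatMap fun g => (listsUpTo G L).map fun l => g :: l :=
      rfl
    rw [e]
    cases l with
    | nil => simp
    | cons x l =>
      simp only [List.mem_cons, List.mem_flatMap, List.mem_map, ih]
      constructor
      · rintro (h | ⟨g, hg, l', hl', h⟩)
        · simp at h
        · obtain ⟨rfl, rfl⟩ := List.cons.inj h
          exact ⟨by rintro y (rfl | hy); exacts [hg, hl'.1 y hy], by simp [hl'.2]⟩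
      · rintro ⟨h1, h2⟩
        exact Or.inr ⟨x, h1 x (Or.inl rfl), l, ⟨fun y hy => h1 y (Or.inr hy), by simpa using h2⟩, rfl⟩

/-- The pair of multisets of a pair of words. -/
def WordPair.toMul (t : WordPair) : Multiset ℕ × Multiset ℕ := (↑t.1, ↑t.2)

/-- The value of `e` on a pair of multisets. -/
def mulVal (e : List ℤ) : Multiset ℕ × Multiset ℕ →+ ℤ where
  toFun t := (t.1.map fun k => e.getD k 0).sum - (t.2.map fun k => e.getD k 0).sum
  map_zero' := by simp
  map_add' t r := by simp; ring

theorem wordSum_eq (e : List ℤ) (w : List ℕ) : wordSum e w = (w.map fun k => e.getD k 0).sum := by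
  induction w with
  | nil => rfl
  | cons k w ih =>
    rw [List.map_cons, List.sum_cons, ← ih]; rfl

theorem pairVal_eq (e : List ℤ) (t : WordPair) : pairVal e t = mulVal e t.toMul := by
  simp [pairVal, wordSum_eq, mulVal, WordPair.toMul]

theorem toMul_pairSum (ws : List WordPair) :
    (pairSum ws).toMul = (ws.map WordPair.toMul).sum := by
  induction ws with
  | nil => rfl
  | cons w ws ih =>
    rw [List.map_cons, List.sum_cons, ← ih]; rfl

theorem pairVal_pairSum (e : List ℤ) (ws : List WordPair) :
    pairVal e (pairSum ws) = (ws.map (pairVal e)).sum := by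
  rw [pairVal_eq, toMul_pairSum, map_list_sum, List.map_map]
  congr 1
  exact List.map_congr_left fun t _ => (pairVal_eq e t).symm

theorem natAbs_le_foldr (e : List ℤ) {G : List WordPair} {g : WordPair} (hg : g ∈ G) :
    (pairVal e g).natAbs ≤ G.foldr (fun g acc => (pairVal e g).natAbs + acc) 0 := by
  induction G with
  | nil => simp at hg
  | cons x G ih =>
    rcases List.mem_cons.1 hg with rfl | h
    · simp
    · exact (ih h).trans (by simp)

theorem mem_closure_genStep (e : List ℤ) (G : List WordPair) (ws : List WordPair)
    (hG : ∀ w ∈ ws, w ∈ G) (hsum : (ws.map (pairVal e)).sum = 0) :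
    (pairSum ws).toMul ∈ AddSubmonoid.closure (WordPair.toMul '' {g | g ∈ genStep e G}) := by
  induction h : ws.length using Nat.strong_induction_on generalizing ws with
  | _ n ih =>
    set C := G.foldr (fun g acc => (pairVal e g).natAbs + acc) 0 with hC
    rcases le_or_gt ws.length (2 * C + 1) with hle | hlt
    · refine AddSubmonoid.subset_closure ⟨pairSum ws, ?_, rfl⟩
      simp only [genStep, Set.mem_ofPred_eq, List.mem_map, List.mem_filter, decide_eq_true_eq]
      exact ⟨ws, ⟨mem_listsUpTo.2 ⟨hG, hle⟩, by rw [pairVal_pairSum, hsum]⟩, rfl⟩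
    · obtain ⟨a, b, hp, ha, hb, h0⟩ := exists_zero_sum_split (C := (C : ℤ)) (pairVal e) ws
        (fun x hx => by
          have := natAbs_le_foldr e (hG x hx)
          rw [← hC] at this
          rw [Int.abs_eq_natAbs]
          exact_mod_cast this) (by positivity) hsum (by exact_mod_cast hlt)
      have hl := hp.length_eq
      rw [List.length_append] at hl
      have ha' := List.length_pos_iff.2 ha
      have hb' := List.length_pos_iff.2 hb
      have h1 : (pairSum ws).toMul = (pairSum a).toMul + (pairSum b).toMul := by
        rw [toMul_pairSum, toMul_pairSum, toMul_pairSum, (hp.map _).sum_eq, List.map_append,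
          List.sum_append]
      have h2 : (b.map (pairVal e)).sum = 0 := by
        rw [(hp.map _).sum_eq, List.map_append, List.sum_append, h0, zero_add] at hsum
        exact hsum
      rw [h1]
      exact add_mem
        (ih a.length (by omega) a (fun w hw => hG w (hp.mem_iff.2 (List.mem_append_left _ hw)))
          h0 rfl)
        (ih b.length (by omega) b (fun w hw => hG w (hp.mem_iff.2 (List.mem_append_right _ hw)))
          h2 rfl)

theorem mem_closure_units (n : ℕ) (t : Multiset ℕ × Multiset ℕ) (h1 : ∀ k ∈ t.1, k < n)
    (h2 : ∀ k ∈ t.2, k < n) :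
    t ∈ AddSubmonoid.closure (WordPair.toMul '' {g | g ∈ gens n []}) := by
  obtain ⟨u, v⟩ := t
  have key1 : ∀ u : Multiset ℕ, (∀ k ∈ u, k < n) → ((u, 0) : Multiset ℕ × Multiset ℕ) ∈
      AddSubmonoid.closure (WordPair.toMul '' {g | g ∈ gens n []}) := by
    intro u
    induction u using Multiset.induction with
    | empty => intro _; exact zero_mem _
    | cons k u ih =>
      intro h
      have : ((k ::ₘ u, 0) : Multiset ℕ × Multiset ℕ) = ({k}, 0) + (u, 0) := by simp
      rw [this]
      refine add_mem (AddSubmonoid.subset_closure ⟨([k], []), ?_, rfl⟩)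
        (ih fun x hx => h x (Multiset.mem_cons_of_mem hx))
      simp [gens, h k (Multiset.mem_cons_self _ _)]
  have key2 : ∀ u : Multiset ℕ, (∀ k ∈ u, k < n) → ((0, u) : Multiset ℕ × Multiset ℕ) ∈
      AddSubmonoid.closure (WordPair.toMul '' {g | g ∈ gens n []}) := by
    intro u
    induction u using Multiset.induction with
    | empty => intro _; exact zero_mem _
    | cons k u ih =>
      intro h
      have : ((0, k ::ₘ u) : Multiset ℕ × Multiset ℕ) = (0, {k}) + (0, u) := by simp
      rw [this]
      refine add_mem (AddSubmonoid.subset_closure ⟨([], [k]), ?_, rfl⟩)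
        (ih fun x hx => h x (Multiset.mem_cons_of_mem hx))
      simp [gens, h k (Multiset.mem_cons_self _ _)]
  have : ((u, v) : Multiset ℕ × Multiset ℕ) = (u, 0) + (0, v) := by simp
  rw [this]
  exact add_mem (key1 u h1) (key2 v h2)

/-- The elements of `gens n eqs` generate the monoid of all pairs of words on which the forms in
`eqs` vanish. -/
theorem mem_closure_gens (n : ℕ) (eqs : List (List ℤ)) (t : Multiset ℕ × Multiset ℕ)
    (h1 : ∀ k ∈ t.1, k < n) (h2 : ∀ k ∈ t.2, k < n) (he : ∀ e ∈ eqs, mulVal e t = 0) :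
    t ∈ AddSubmonoid.closure (WordPair.toMul '' {g | g ∈ gens n eqs}) := by
  induction eqs with
  | nil => exact mem_closure_units n t h1 h2
  | cons e eqs ih =>
    have ht := ih fun e' he' => he e' (List.mem_cons_of_mem _ he')
    obtain ⟨l, hl, rfl⟩ := AddSubmonoid.exists_list_of_mem_closure ht
    have : ∃ ws : List WordPair, (∀ w ∈ ws, w ∈ gens n eqs) ∧ ws.map WordPair.toMul = l := by
      clear ht he h1 h2 ih
      induction l with
      | nil => exact ⟨[], by simp, rfl⟩
      | cons x l ihl =>
        obtain ⟨ws, hws, rfl⟩ := ihl fun y hy => hl y (List.mem_cons_of_mem _ hy)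
        obtain ⟨g, hg, rfl⟩ := hl _ List.mem_cons_self
        refine ⟨g :: ws, ?_, rfl⟩
        rintro w hw
        rcases List.mem_cons.1 hw with rfl | hw
        exacts [hg, hws w hw]
    obtain ⟨ws, hws, rfl⟩ := this
    rw [← toMul_pairSum]
    refine mem_closure_genStep e (gens n eqs) ws hws ?_
    rw [← pairVal_pairSum, pairVal_eq, toMul_pairSum]
    exact he e List.mem_cons_self

theorem gens_spec (n : ℕ) (eqs : List (List ℤ)) : ∀ t ∈ gens n eqs,
    (∀ k ∈ t.1, k < n) ∧ (∀ k ∈ t.2, k < n) ∧ ∀ e ∈ eqs, pairVal e t = 0 := by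
  have hsub : ∀ (P : WordPair → Prop), P ([], []) →
      (∀ w r, P w → P r → P (w.1 ++ r.1, w.2 ++ r.2)) →
      ∀ ws : List WordPair, (∀ w ∈ ws, P w) → P (pairSum ws) := by
    intro P h0 hadd ws
    induction ws with
    | nil => intro _; exact h0
    | cons w ws ih =>
      intro h
      exact hadd w (pairSum ws) (h w List.mem_cons_self)
        (ih fun y hy => h y (List.mem_cons_of_mem _ hy))
  induction eqs with
  | nil =>
    intro t ht
    simp only [gens, List.foldr_nil, List.mem_append, List.mem_map, List.mem_range] at ht
    rcases ht with ⟨k, hk, rfl⟩ | ⟨k, hk, rfl⟩ <;> simp [hk]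
  | cons e eqs ih =>
    intro t ht
    have ht' : t ∈ genStep e (gens n eqs) := ht
    simp only [genStep, List.mem_map, List.mem_filter, decide_eq_true_eq, mem_listsUpTo] at ht'
    obtain ⟨ws, ⟨⟨hws, -⟩, h0⟩, rfl⟩ := ht'
    have := hsub (fun t => (∀ k ∈ t.1, k < n) ∧ (∀ k ∈ t.2, k < n) ∧ ∀ e ∈ eqs, pairVal e t = 0)
      (by simp [pairVal, wordSum]) (by
        rintro w r ⟨a1, a2, a3⟩ ⟨b1, b2, b3⟩
        refine ⟨?_, ?_, ?_⟩
        · intro k hk; rcases List.mem_append.1 hk with h | h; exacts [a1 k h, b1 k h]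
        · intro k hk; rcases List.mem_append.1 hk with h | h; exacts [a2 k h, b2 k h]
        · intro e he
          have h1 := a3 e he
          have h2 := b3 e he
          simp only [pairVal, wordSum_eq, List.map_append, List.sum_append] at h1 h2 ⊢
          linarith) ws (fun w hw => ih w (hws w hw))
    refine ⟨this.1, this.2.1, fun e' he' => ?_⟩
    rcases List.mem_cons.1 he' with rfl | he'
    exacts [h0, this.2.2 e' he']

end AlgFlow

/-! ### Exponential polynomials and the vanishing ideal of the flow -/

namespace AlgFlow

open Finset Polynomial

section ExpPoly

theorem expPoly_derivative {s : Finset ℂ} {p : ℂ → ℂ[X]} {ν : ℂ → ℂ}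
    (h : ∀ t : ℝ, 0 < t → ∑ μ ∈ s, (p μ).eval (t : ℂ) * Complex.exp (ν μ * t) = 0) :
    ∀ t : ℝ, 0 < t → ∑ μ ∈ s, (derivative (p μ) + C (ν μ) * p μ).eval (t : ℂ) *
      Complex.exp (ν μ * t) = 0 := by
  intro t ht
  have hd : HasDerivAt (fun t : ℝ => ∑ μ ∈ s, (p μ).eval (t : ℂ) * Complex.exp (ν μ * t))
      (∑ μ ∈ s, (derivative (p μ) + C (ν μ) * p μ).eval (t : ℂ) * Complex.exp (ν μ * t)) t := by
    refine HasDerivAt.fun_sum fun μ _ => ?_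
    have h1 : HasDerivAt (fun z : ℂ => (p μ).eval z * Complex.exp (ν μ * z))
        ((derivative (p μ)).eval (t : ℂ) * Complex.exp (ν μ * t) +
          (p μ).eval (t : ℂ) * (Complex.exp (ν μ * t) * (ν μ * 1))) (t : ℂ) :=
      ((p μ).hasDerivAt _).mul (((hasDerivAt_id _).const_mul _).cexp)
    refine h1.comp_ofReal.congr_deriv ?_
    simp only [eval_add, eval_mul, eval_C]
    ring
  have hz : (fun t : ℝ => ∑ μ ∈ s, (p μ).eval (t : ℂ) * Complex.exp (ν μ * t)) =ᶠ[nhds t]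
      fun _ => (0 : ℂ) :=
    Filter.eventually_of_mem (Ioi_mem_nhds ht) fun x hx => h x hx
  exact (hd.congr_of_eventuallyEq hz.symm).unique (hasDerivAt_const t (0 : ℂ))

theorem eq_zero_of_eval_pos {p : ℂ[X]} (h : ∀ t : ℝ, 0 < t → p.eval (t : ℂ) = 0) : p = 0 := by
  refine Polynomial.eq_zero_of_infinite_isRoot p
    (Set.Infinite.mono (s := (fun t : ℝ => (t : ℂ)) '' Set.Ioi 0) ?_ ?_)
  · rintro _ ⟨t, ht, rfl⟩; exact h t ht
  · exact (Set.Ioi_infinite (0 : ℝ)).image Complex.ofReal_injective.injOn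

theorem eq_zero_of_derivative_add {c : ℂ} (hc : c ≠ 0) {p : ℂ[X]}
    (h : derivative p + C c * p = 0) : p = 0 := by
  by_contra hp
  have h1 : (C c * p).degree = p.degree := degree_C_mul hc
  have h2 := degree_derivative_lt hp
  rw [eq_neg_of_add_eq_zero_left h, degree_neg, h1] at h2
  exact lt_irrefl _ h2

/-- Exponential polynomials with distinct exponents are linearly independent. -/
theorem expPoly_eq_zero (s : Finset ℂ) (p : ℂ → ℂ[X])
    (h : ∀ t : ℝ, 0 < t → ∑ μ ∈ s, (p μ).eval (t : ℂ) * Complex.exp (μ * t) = 0) :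
    ∀ μ ∈ s, p μ = 0 := by
  induction s using Finset.induction_on generalizing p with
  | empty => simp
  | insert μ₀ s hμ₀ ih =>
    have hs : ∀ μ ∈ s, p μ = 0 := by
      have h0 : ∀ t : ℝ, 0 < t → (p μ₀).eval (t : ℂ) +
          ∑ μ ∈ s, (p μ).eval (t : ℂ) * Complex.exp ((μ - μ₀) * t) = 0 := by
        intro t ht
        have := h t ht
        rw [sum_insert hμ₀] at this
        have h2 := congrArg (· * Complex.exp (-(μ₀ * t))) this
        simp only [add_mul, sum_mul, mul_assoc, ← Complex.exp_add, zero_mul] at h2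
        rw [add_neg_cancel, Complex.exp_zero, mul_one] at h2
        rw [← h2]
        congr 1
        refine sum_congr rfl fun μ _ => ?_
        congr 2
        ring
      let D : ℂ → ℂ[X] → ℂ[X] := fun μ q => derivative q + C (μ - μ₀) * q
      have key : ∀ n, ∀ t : ℝ, 0 < t → ∑ μ ∈ insert μ₀ s,
          ((D μ)^[n] (p μ)).eval (t : ℂ) * Complex.exp ((μ - μ₀) * t) = 0 := by
        intro n
        induction n with
        | zero =>
          intro t ht
          rw [sum_insert hμ₀, ← h0 t ht]
          simp
        | succ n ihn =>
          intro t ht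
          have := expPoly_derivative (p := fun μ => (D μ)^[n] (p μ)) (ν := fun μ => μ - μ₀) ihn t ht
          rw [← this]
          refine sum_congr rfl fun μ _ => ?_
          rw [Function.iterate_succ_apply']
      have hzero : (D μ₀)^[(p μ₀).natDegree + 1] (p μ₀) = 0 := by
        have : D μ₀ = derivative := by funext q; simp [D]
        rw [this]
        exact iterate_derivative_eq_zero (Nat.lt_succ_self _)
      have hD : ∀ μ ∈ s, ∀ n, (D μ)^[n] (p μ) = 0 → p μ = 0 := by
        intro μ hμ n
        have hne : μ - μ₀ ≠ 0 := sub_ne_zero.2 fun e => hμ₀ (e ▸ hμ)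
        induction n with
        | zero => exact id
        | succ n ihn =>
          intro h'
          rw [Function.iterate_succ_apply'] at h'
          exact ihn (eq_zero_of_derivative_add hne h')
      intro μ hμ
      refine hD μ hμ ((p μ₀).natDegree + 1) ?_
      refine ih (fun μ => (D μ)^[(p μ₀).natDegree + 1] (p μ)) (fun t ht => ?_) μ hμ
      have := key ((p μ₀).natDegree + 1) t ht
      rw [sum_insert hμ₀, hzero, eval_zero, zero_mul, zero_add] at this
      have h2 := congrArg (· * Complex.exp (μ₀ * t)) this
      simp only [sum_mul, mul_assoc, ← Complex.exp_add, zero_mul] at h2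
      rw [← h2]
      refine sum_congr rfl fun μ _ => ?_
      congr 2
      ring
    intro μ hμ
    rcases mem_insert.1 hμ with rfl | hμ
    · refine eq_zero_of_eval_pos fun t ht => ?_
      have := h t ht
      rw [sum_insert hμ₀, sum_eq_zero fun μ hμ => by rw [hs μ hμ]; simp, add_zero] at this
      exact (mul_eq_zero.1 this).resolve_right (Complex.exp_ne_zero _)
    · exact hs μ hμ

/-- A linear relation between functions `t ^ k * exp (μ t)` is trivial on the fibres of `(μ, k)`. -/
theorem sum_fiber_eq_zero {ι : Type*} (S : Finset ι) (c : ι → ℂ) (μ : ι → ℂ) (k : ι → ℕ)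
    (h : ∀ t : ℝ, 0 < t → ∑ i ∈ S, c i * ((t : ℂ) ^ k i * Complex.exp (μ i * t)) = 0)
    (δ : ℂ × ℕ) : ∑ i ∈ S with (μ i, k i) = δ, c i = 0 := by
  classical
  let p : ℂ → ℂ[X] := fun ν => ∑ i ∈ S with μ i = ν, C (c i) * X ^ k i
  have hp : ∀ ν ∈ S.image μ, p ν = 0 := by
    refine expPoly_eq_zero _ p fun t ht => ?_
    rw [← h t ht, ← sum_fiberwise_of_maps_to (g := μ) (t := S.image μ)
      fun i hi => mem_image_of_mem μ hi]
    refine sum_congr rfl fun ν _ => ?_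
    simp only [p, eval_finsetSum, sum_mul]
    refine sum_congr rfl fun i hi => ?_
    rw [(mem_filter.1 hi).2]
    simp [mul_assoc]
  by_cases hδ : δ.1 ∈ S.image μ
  · have := congrArg (fun q => q.coeff δ.2) (hp δ.1 hδ)
    simp only [p, finsetSum_coeff, coeff_C_mul, coeff_X_pow, coeff_zero, mul_ite, mul_one,
      mul_zero] at this
    rw [← sum_filter, filter_filter] at this
    rw [← this]
    refine sum_congr (filter_congr fun i _ => ?_) fun _ _ => rfl
    rw [Prod.ext_iff]
    simp only [eq_comm]
  · refine sum_eq_zero fun i hi => ?_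
    rw [mem_filter] at hi
    exact absurd (mem_image.2 ⟨i, hi.1, congrArg Prod.fst hi.2⟩) hδ

end ExpPoly

section Exponential

open scoped Matrix.Norms.Operator

variable {d : ℕ}

theorem exp_eq_of_ode {A : Matrix (Fin d) (Fin d) ℂ} {Y : ℂ → Matrix (Fin d) (Fin d) ℂ}
    (h0 : Y 0 = 1) (hY : ∀ z, HasDerivAt Y (A * Y z) z) (z : ℂ) :
    NormedSpace.exp (z • A) = Y z := by
  have h1 : ∀ z, HasDerivAt (fun z : ℂ => NormedSpace.exp (z • -A) * Y z) 0 z := by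
    intro z
    have := (hasDerivAt_exp_smul_const (𝕂 := ℂ) (-A) z).mul (hY z)
    refine this.congr_deriv ?_
    rw [mul_neg, neg_mul, mul_assoc, neg_add_cancel]
  have h2 : ∀ z, NormedSpace.exp (z • -A) * Y z = 1 := by
    intro z
    have := is_const_of_deriv_eq_zero (fun z => (h1 z).differentiableAt)
      (fun z => (h1 z).deriv) z 0
    simpa [h0] using this
  have h3 : NormedSpace.exp (z • A) * NormedSpace.exp (z • -A) = 1 := by
    rw [← Matrix.exp_add_of_commute]
    · simp
    · simp
  calc NormedSpace.exp (z • A) = NormedSpace.exp (z • A) * (NormedSpace.exp (z • -A) * Y z) := by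
        rw [h2, mul_one]
    _ = Y z := by rw [← mul_assoc, h3, one_mul]

/-- A sum of terms that satisfies the chain conditions is the matrix exponential. -/
theorem exp_eq_sum {n : ℕ} {A : Matrix (Fin d) (Fin d) ℂ} {lam : ℕ → ℂ} {j : ℕ → ℕ}
    {M : ℕ → Matrix (Fin d) (Fin d) ℂ} (hj0 : j 0 = 0) (hjn : j n = 0)
    (hchain : ∀ k < n, j (k + 1) = 0 ∨ (lam (k + 1) = lam k ∧ j (k + 1) = j k + 1))
    (hode : ∀ k < n, A * M k = lam k • M k + (j (k + 1) : ℂ) • M (k + 1))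
    (hinit : ∑ k ∈ range n, (if j k = 0 then M k else 0) = 1) (z : ℂ) :
    NormedSpace.exp (z • A) = ∑ k ∈ range n, (z ^ j k * Complex.exp (lam k * z)) • M k := by
  refine exp_eq_of_ode (Y := fun z => ∑ k ∈ range n, (z ^ j k * Complex.exp (lam k * z)) • M k)
    ?_ (fun z => ?_) z
  · rw [← hinit]
    refine sum_congr rfl fun k _ => ?_
    by_cases h : j k = 0 <;> simp [h]
  · let T : ℕ → Matrix (Fin d) (Fin d) ℂ := fun k =>
      ((j k : ℂ) * z ^ (j k - 1) * Complex.exp (lam k * z)) • M k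
    have hT : ∑ k ∈ range n, T (k + 1) = ∑ k ∈ range n, T k := by
      have h1 := sum_range_succ T n
      rw [sum_range_succ'] at h1
      have h2 : T 0 = 0 := by simp [T, hj0]
      have h3 : T n = 0 := by simp [T, hjn]
      rwa [h2, h3, add_zero, add_zero] at h1
    have hT' : ∀ k ∈ range n, T (k + 1) =
        (z ^ j k * Complex.exp (lam k * z)) • ((j (k + 1) : ℂ) • M (k + 1)) := by
      intro k hk
      simp only [T]
      rcases hchain k (mem_range.1 hk) with h | ⟨h1, h2⟩
      · simp [h]
      · rw [h1, h2, Nat.add_sub_cancel, smul_smul]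
        congr 1
        ring
    have hA : A * ∑ k ∈ range n, (z ^ j k * Complex.exp (lam k * z)) • M k =
        ∑ k ∈ range n, ((z ^ j k * (Complex.exp (lam k * z) * (lam k * 1))) • M k + T k) := by
      rw [sum_add_distrib, ← hT, ← sum_add_distrib, mul_sum]
      refine sum_congr rfl fun k hk => ?_
      rw [Matrix.mul_smul, hode k (mem_range.1 hk), smul_add, hT' k hk, smul_smul]
      congr 2
      ring
    rw [hA]
    refine HasDerivAt.fun_sum fun k _ => ?_
    have h1 : HasDerivAt (fun z : ℂ => z ^ j k * Complex.exp (lam k * z))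
        ((j k : ℂ) * z ^ (j k - 1) * Complex.exp (lam k * z) +
          z ^ j k * (Complex.exp (lam k * z) * (lam k * 1))) z :=
      (hasDerivAt_pow (j k) z).mul (((hasDerivAt_id _).const_mul _).cexp)
    refine (h1.smul_const (M k)).congr_deriv ?_
    rw [add_smul, add_comm]

end Exponential

end AlgFlow

/-! ### Generators of the vanishing ideal -/

namespace AlgFlow

open Finset MvPolynomial

theorem zariskiClosure_eq {K σ : Type*} [Field K] (S : Set (σ → K)) :
    zariskiClosure S = zeroLocus K (vanishingIdeal K S) := by
  apply Set.Subset.antisymm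
  · refine Set.sInter_subset_of_mem ⟨⟨_, rfl⟩, fun x hx p hp => hp x hx⟩
  · rintro x hx _ ⟨⟨I, rfl⟩, hS⟩ p hp
    exact hx p fun y hy => hS hy p hp

variable {d : ℕ}

/-- The linear form with coefficients `E`. -/
noncomputable def linForm (E : Matrix (Fin d) (Fin d) ℂ) : MvPolynomial (Fin d × Fin d) ℂ :=
  ∑ a, ∑ b, C (E a b) * X (a, b)

theorem aeval_linForm (E : Matrix (Fin d) (Fin d) ℂ) (x : Fin d × Fin d → ℂ) :
    aeval x (linForm E) = ∑ a, ∑ b, E a b * x (a, b) := by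
  simp [linForm]

/-- The data of an expansion `exp (t A) = ∑ t ^ j_k * exp (λ_k t) * M_k`, with forms dual to the
matrices `M_k`. -/
structure Expansion (A : Matrix (Fin d) (Fin d) ℂ) (n : ℕ) (lam : ℕ → ℂ) (j : ℕ → ℕ)
    (M E : ℕ → Matrix (Fin d) (Fin d) ℂ) : Prop where
  exp_eq : ∀ z : ℂ,
    NormedSpace.exp (z • A) = ∑ k ∈ range n, (z ^ j k * Complex.exp (lam k * z)) • M k
  dual : ∀ k < n, ∀ l < n, ∑ a, ∑ b, E k a b * M l a b = if k = l then 1 else 0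

variable {A : Matrix (Fin d) (Fin d) ℂ} {n : ℕ} {lam : ℕ → ℂ} {j : ℕ → ℕ}
  {M E : ℕ → Matrix (Fin d) (Fin d) ℂ}

theorem Expansion.aeval_linForm_flow (h : Expansion A n lam j M E) (z : ℂ) {k : ℕ} (hk : k < n) :
    aeval (fun ab : Fin d × Fin d => NormedSpace.exp (z • A) ab.1 ab.2) (linForm (E k)) =
      z ^ j k * Complex.exp (lam k * z) := by
  rw [aeval_linForm, h.exp_eq z]
  simp only [Matrix.sum_apply, Matrix.smul_apply, smul_eq_mul, mul_sum]
  have : ∀ a b : Fin d, ∑ l ∈ range n,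
      E k a b * (z ^ j l * Complex.exp (lam l * z) * M l a b) = ∑ l ∈ range n,
      (z ^ j l * Complex.exp (lam l * z)) * (E k a b * M l a b) := fun a b =>
    sum_congr rfl fun l _ => by ring
  simp only [this]
  rw [sum_congr rfl fun a _ => sum_comm, sum_comm]
  simp only [← mul_sum]
  rw [sum_congr rfl fun l hl => by rw [h.dual k hk l (mem_range.1 hl)]]
  simp [hk]

/-- The generators of the vanishing ideal of the flow. -/
theorem Expansion.vanishingIdeal_eq (h : Expansion A n lam j M E)
    {I : Ideal (MvPolynomial (Fin d × Fin d) ℂ)} (hI : I ≤ vanishingIdeal ℂ (flow A))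
    (hlin : ∀ a b, X (a, b) - ∑ k ∈ range n, C (M k a b) * linForm (E k) ∈ I)
    (hbin : ∀ u v : Multiset ℕ, (∀ k ∈ u, k < n) → (∀ k ∈ v, k < n) →
      (u.map lam).sum = (v.map lam).sum → (u.map j).sum = (v.map j).sum →
      (u.map fun k => linForm (E k)).prod - (v.map fun k => linForm (E k)).prod ∈ I) :
    vanishingIdeal ℂ (flow A) = I := by
  refine le_antisymm (fun p hp => ?_) hI
  classical
  let mk := Ideal.Quotient.mk I
  -- the polynomial in the coordinates with respect to the terms
  let P : MvPolynomial (Fin n) ℂ :=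
    aeval (fun ab : Fin d × Fin d => ∑ k : Fin n, C (M k ab.1 ab.2) * X k) p
  have hev : ∀ (y : Fin n → ℂ), aeval y P =
      aeval (fun ab : Fin d × Fin d => ∑ k : Fin n, M k ab.1 ab.2 * y k) p := by
    intro y
    have := comp_aeval_apply (R := ℂ) (f := fun ab : Fin d × Fin d =>
      ∑ k : Fin n, (C (M k ab.1 ab.2) * X k : MvPolynomial (Fin n) ℂ)) (aeval y) p
    rw [this]
    simp
  have hP0 : ∀ t : ℝ, 0 < t → ∑ a ∈ P.support, P.coeff a *
      ((t : ℂ) ^ (a.toMultiset.map fun k : Fin n => j k).sum *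
        Complex.exp ((a.toMultiset.map fun k : Fin n => lam k).sum * t)) = 0 := by
    intro t ht
    have h1 : aeval (fun k : Fin n => (t : ℂ) ^ j k * Complex.exp (lam k * t)) P = 0 := by
      rw [hev, ← hp (fun ab => NormedSpace.exp ((t : ℂ) • A) ab.1 ab.2) ⟨t, ht.le, rfl⟩]
      congr 2
      funext ab
      rw [h.exp_eq, Matrix.sum_apply, sum_range]
      exact sum_congr rfl fun k _ => by rw [Matrix.smul_apply, smul_eq_mul, mul_comm]
    rw [← h1, aeval_def, eval₂_eq]
    refine sum_congr rfl fun a _ => ?_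
    congr 1
    have h2 : ∀ s : Multiset (Fin n), (t : ℂ) ^ (s.map fun k : Fin n => j k).sum *
        Complex.exp ((s.map fun k : Fin n => lam k).sum * t) =
        (s.map fun k : Fin n => (t : ℂ) ^ j k * Complex.exp (lam k * t)).prod := by
      intro s
      induction s using Multiset.induction with
      | empty => simp
      | cons k s ih =>
        simp only [Multiset.map_cons, Multiset.sum_cons, Multiset.prod_cons, ← ih]
        rw [pow_add, add_mul, Complex.exp_add]
        ring
    rw [h2, Finsupp.toMultiset_map, Finsupp.prod_toMultiset,
      Finsupp.prod_mapDomain_index (fun _ => pow_zero _) (fun _ _ _ => pow_add _ _ _)]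
    rfl
  have hfib := sum_fiber_eq_zero P.support P.coeff _ _ hP0
  -- the images of the coordinates in the quotient
  have hmk : mk p = aeval (fun k : Fin n => mk (linForm (E k))) P := by
    have h1 := comp_aeval_apply (R := ℂ) (f := fun ab : Fin d × Fin d =>
      ∑ k : Fin n, (C (M k ab.1 ab.2) * X k : MvPolynomial (Fin n) ℂ))
      (aeval (R := ℂ) fun k : Fin n => mk (linForm (E k))) p
    rw [h1]
    have h2 : mk p = aeval (R := ℂ) (fun ab : Fin d × Fin d => mk (X ab)) p := by
      have := comp_aeval_apply (R := ℂ) (f := fun ab : Fin d × Fin d =>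
        (X ab : MvPolynomial (Fin d × Fin d) ℂ)) (Ideal.Quotient.mkₐ ℂ I) p
      rw [aeval_X_left_apply] at this
      exact this
    rw [h2]
    congr 2
    funext ab
    have h3 := (Ideal.Quotient.eq (I := I)).2 (hlin ab.1 ab.2)
    rw [show mk (X ab) = mk (∑ k ∈ range n, C (M k ab.1 ab.2) * linForm (E k)) from h3, sum_range,
      map_sum, map_sum]
    refine sum_congr rfl fun k _ => ?_
    rw [map_mul, map_mul, aeval_X, aeval_C]
    rfl
  let w : (Fin n →₀ ℕ) → MvPolynomial (Fin d × Fin d) ℂ ⧸ I := fun a =>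
    (a.toMultiset.map fun k : Fin n => mk (linForm (E k))).prod
  have hw : ∀ a b : Fin n →₀ ℕ,
      ((a.toMultiset.map fun k : Fin n => lam k).sum, (a.toMultiset.map fun k : Fin n => j k).sum) =
      ((b.toMultiset.map fun k : Fin n => lam k).sum, (b.toMultiset.map fun k : Fin n => j k).sum) →
      w a = w b := by
    intro a b hab
    obtain ⟨h1, h2⟩ := Prod.ext_iff.1 hab
    have := hbin (a.toMultiset.map Fin.val) (b.toMultiset.map Fin.val)
      (by simp +contextual) (by simp +contextual)
      (by simpa [Multiset.map_map] using h1) (by simpa [Multiset.map_map] using h2)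
    have := (Ideal.Quotient.eq (I := I)).2 this
    rw [Multiset.map_map, Multiset.map_map, map_multiset_prod, map_multiset_prod, Multiset.map_map,
      Multiset.map_map] at this
    exact this
  rw [← Ideal.Quotient.eq_zero_iff_mem]
  change mk p = 0
  have hsum : mk p = ∑ a ∈ P.support, algebraMap ℂ _ (P.coeff a) * w a := by
    rw [hmk, aeval_def, eval₂_eq]
    refine sum_congr rfl fun a _ => ?_
    congr 1
    simp only [w]
    rw [Finsupp.toMultiset_map, Finsupp.prod_toMultiset,
      Finsupp.prod_mapDomain_index (fun _ => pow_zero _) (fun _ _ _ => pow_add _ _ _)]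
    rfl
  let deg : (Fin n →₀ ℕ) → ℂ × ℕ := fun a =>
    ((a.toMultiset.map fun k : Fin n => lam k).sum, (a.toMultiset.map fun k : Fin n => j k).sum)
  rw [hsum, ← sum_fiberwise_of_maps_to (g := deg) (t := P.support.image deg)
    fun i hi => mem_image_of_mem deg hi]
  refine sum_eq_zero fun δ hδ => ?_
  obtain ⟨b, -, rfl⟩ := mem_image.1 hδ
  have : ∀ a ∈ P.support.filter (fun a => deg a = deg b),
      algebraMap ℂ (MvPolynomial (Fin d × Fin d) ℂ ⧸ I) (P.coeff a) * w a =
      algebraMap ℂ (MvPolynomial (Fin d × Fin d) ℂ ⧸ I) (P.coeff a) * w b := by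
    intro a ha
    rw [hw a b (mem_filter.1 ha).2]
  rw [sum_congr rfl this, ← sum_mul, ← map_sum, hfib (deg b), map_zero, zero_mul]

end AlgFlow

/-! ### Existence of the expansion of the exponential -/

namespace AlgFlow

open Finset Polynomial
open scoped Function

section Chains

variable {F : Type*}

/-- The indices `(μ, i), …, (μ, i + m - 1)`. -/
def chainIdx (μ : F) : ℕ → ℕ → List (F × ℕ)
  | 0, _ => []
  | m + 1, i => (μ, i) :: chainIdx μ m (i + 1)

theorem mem_chainIdx {μ : F} {m i : ℕ} {x : F × ℕ} :
    x ∈ chainIdx μ m i ↔ x.1 = μ ∧ i ≤ x.2 ∧ x.2 < i + m := by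
  induction m generalizing i with
  | zero => simp [chainIdx]
  | succ m ih =>
    rw [chainIdx, List.mem_cons, ih, Prod.ext_iff]
    constructor
    · rintro (⟨h1, h2⟩ | ⟨h1, h2, h3⟩)
      · simp only at h1 h2; exact ⟨h1, by omega, by omega⟩
      · exact ⟨h1, by omega, by omega⟩
    · rintro ⟨h1, h2, h3⟩
      rcases eq_or_ne x.2 i with h | h
      · exact Or.inl ⟨h1, h⟩
      · exact Or.inr ⟨h1, by omega, by omega⟩

theorem nodup_chainIdx (μ : F) (m i : ℕ) : (chainIdx μ m i).Nodup := by
  induction m generalizing i with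
  | zero => exact List.nodup_nil
  | succ m ih =>
    rw [chainIdx, List.nodup_cons, mem_chainIdx]
    exact ⟨fun h => by simp only at h; omega, ih _⟩

variable [Field F] {d : ℕ}

/-- The chain conditions for the terms with the indices in a list. -/
def ChainCond (A : Matrix (Fin d) (Fin d) F) (v : F × ℕ → Matrix (Fin d) (Fin d) F) :
    List (F × ℕ) → Prop
  | [] => True
  | x :: l => ((l.headD (0, 0)).2 = 0 ∨
      ((l.headD (0, 0)).1 = x.1 ∧ (l.headD (0, 0)).2 = x.2 + 1)) ∧
      A * v x = x.1 • v x + ((l.headD (0, 0)).2 : F) • v (l.headD (0, 0)) ∧ ChainCond A v l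

variable {A : Matrix (Fin d) (Fin d) F} {v : F × ℕ → Matrix (Fin d) (Fin d) F}

theorem ChainCond.append {l₁ l₂ : List (F × ℕ)} (h₁ : ChainCond A v l₁) (h₂ : ChainCond A v l₂)
    (h0 : (l₂.headD (0, 0)).2 = 0) : ChainCond A v (l₁ ++ l₂) := by
  induction l₁ with
  | nil => exact h₂
  | cons x l ih =>
    obtain ⟨a, b, c⟩ := h₁
    cases l with
    | nil =>
      refine ⟨Or.inl h0, ?_, h₂⟩
      change A * v x = x.1 • v x + ((l₂.headD (0, 0)).2 : F) • v (l₂.headD (0, 0))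
      rw [h0]
      simpa using b
    | cons y l => exact ⟨a, b, ih c⟩

theorem chainCond_chainIdx (μ : F) (hv : ∀ i, A * v (μ, i) = μ • v (μ, i) +
    ((i + 1 : ℕ) : F) • v (μ, i + 1)) (m i : ℕ) (h0 : v (μ, i + m) = 0) :
    ChainCond A v (chainIdx μ m i) := by
  induction m generalizing i with
  | zero => trivial
  | succ m ih =>
    refine ⟨?_, ?_, ih (i + 1) (by rw [← h0]; congr 2; omega)⟩
    · cases m with
      | zero => exact Or.inl rfl
      | succ m => exact Or.inr ⟨rfl, rfl⟩
    · rw [hv i]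
      cases m with
      | zero => rw [zero_add] at h0; simp [chainIdx, h0]
      | succ m => rfl

theorem ChainCond.getD {l : List (F × ℕ)} (h : ChainCond A v l) {k : ℕ} (hk : k < l.length) :
    ((l.getD (k + 1) (0, 0)).2 = 0 ∨ ((l.getD (k + 1) (0, 0)).1 = (l.getD k (0, 0)).1 ∧
      (l.getD (k + 1) (0, 0)).2 = (l.getD k (0, 0)).2 + 1)) ∧
    A * v (l.getD k (0, 0)) = (l.getD k (0, 0)).1 • v (l.getD k (0, 0)) +
      ((l.getD (k + 1) (0, 0)).2 : F) • v (l.getD (k + 1) (0, 0)) := by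
  induction l generalizing k with
  | nil => simp at hk
  | cons x l ih =>
    obtain ⟨a, b, c⟩ := h
    have e : l.headD (0, 0) = l.getD 0 (0, 0) := by cases l <;> rfl
    rw [e] at a b
    cases k with
    | zero => exact ⟨a, b⟩
    | succ k =>
      simp only [List.getD_cons_succ]
      exact ih c (by simpa using hk)

end Chains

theorem exists_dual_of_linearIndependent {F : Type*} [Field F] {d n : ℕ}
    {v : Fin n → Matrix (Fin d) (Fin d) F} (hv : LinearIndependent F v) :
    ∃ E : Fin n → Matrix (Fin d) (Fin d) F, ∀ k l,
      ∑ a, ∑ b, E k a b * v l a b = if k = l then 1 else 0 := by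
  obtain ⟨g, hg⟩ := LinearMap.exists_leftInverse_of_injective _
    (LinearMap.ker_eq_bot.2 hv)
  refine ⟨fun k => Matrix.of fun a b => g (Matrix.single a b 1) k, fun k l => ?_⟩
  have h1 : g (v l) = Finsupp.single l 1 := by
    have := LinearMap.congr_fun hg (Finsupp.single l 1)
    simpa using this
  have h2 : g (v l) k = ∑ a, ∑ b, v l a b * g (Matrix.single a b 1) k := by
    conv_lhs => rw [Matrix.matrix_eq_sum_single (v l)]
    simp only [map_sum, Finsupp.finsetSum_apply]
    refine sum_congr rfl fun a _ => sum_congr rfl fun b _ => ?_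
    rw [show Matrix.single a b (v l a b) = v l a b • Matrix.single a b (1 : F) by simp, map_smul]
    rfl
  rw [h1, Finsupp.single_apply] at h2
  simp only [Matrix.of_apply, eq_comm (a := k)]
  rw [h2]
  exact sum_congr rfl fun a _ => sum_congr rfl fun b _ => mul_comm _ _

section Spectral

variable {F : Type*} [Field F] {d : ℕ} (A : Matrix (Fin d) (Fin d) F)

/-- The spectral projections of a matrix over an algebraically closed field. -/
theorem exists_spectral_projections [IsAlgClosed F] :
    ∃ (s : Finset F) (E : F → Matrix (Fin d) (Fin d) F) (m : F → ℕ), ∑ μ ∈ s, E μ = 1 ∧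
      (∀ μ ∈ s, ∀ ν ∈ s, μ ≠ ν → E μ * E ν = 0) ∧
      (∀ μ ∈ s, (A - Matrix.scalar (Fin d) μ) ^ m μ * E μ = 0) ∧
      (∀ μ ∈ s, Commute A (E μ)) := by
  classical
  rcases Nat.eq_zero_or_pos d with rfl | hd
  · exact ⟨∅, fun _ => 0, fun _ => 0, Subsingleton.elim _ _, by simp, by simp, by simp⟩
  let χ := A.charpoly
  have hχ : aeval A χ = 0 := Matrix.aeval_self_charpoly A
  have hmonic : χ.Monic := A.charpoly_monic
  have hsplit : χ = ∏ μ ∈ χ.roots.toFinset, (X - C μ) ^ χ.rootMultiplicity μ := by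
    have h1 := (IsAlgClosed.splits χ).eq_prod_roots
    rw [hmonic.leadingCoeff, C_1, one_mul] at h1
    conv_lhs => rw [h1]
    rw [Finset.prod_multiset_map_count]
    exact Finset.prod_congr rfl fun μ _ => by rw [Polynomial.count_roots]
  let s := χ.roots.toFinset
  let h : F → F[X] := fun μ => (X - C μ) ^ χ.rootMultiplicity μ
  have hne : s.Nonempty := by
    have hdeg : χ.degree ≠ 0 := by
      rw [A.charpoly_degree_eq_dim]; simp; omega
    obtain ⟨r, hr⟩ := IsAlgClosed.exists_root χ hdeg
    exact ⟨r, by simpa [s] using ⟨hmonic.ne_zero, hr⟩⟩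
  have hcop : Pairwise (IsCoprime on fun i : s => h i) := by
    intro μ ν hμν
    refine IsCoprime.pow ?_
    exact Polynomial.pairwise_coprime_X_sub_C (s := fun x : s => (x : F)) Subtype.val_injective hμν
  obtain ⟨c, hc⟩ := (exists_sum_eq_one_iff_pairwise_coprime hne).2 hcop
  let g : F → F[X] := fun μ => c μ * ∏ ν ∈ s \ {μ}, h ν
  have hprod : ∀ μ ∈ s, h μ * g μ = c μ * χ := by
    intro μ hμ
    rw [hsplit]
    change _ = c μ * ∏ ν ∈ s, h ν
    simp only [g]
    rw [← Finset.mul_prod_erase s h hμ, Finset.sdiff_singleton_eq_erase]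
    ring
  refine ⟨s, fun μ => aeval A (g μ), fun μ => χ.rootMultiplicity μ, ?_, ?_, ?_, ?_⟩
  · rw [← map_sum, hc, map_one]
  · intro μ hμ ν hν hne
    have : h μ ∣ g ν := by
      refine Dvd.dvd.mul_left (Finset.dvd_prod_of_mem h ?_) _
      simp [hμ, hne]
    obtain ⟨q, hq⟩ := this
    rw [← map_mul, hq, show g μ * (h μ * q) = (h μ * g μ) * q by ring, hprod μ hμ, map_mul, map_mul,
      hχ, mul_zero, zero_mul]
  · intro μ hμ
    have : (A - Matrix.scalar (Fin d) μ) ^ χ.rootMultiplicity μ = aeval A (h μ) := by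
      simp only [h, map_pow, map_sub, aeval_X, aeval_C]
      rfl
    rw [this, ← map_mul, hprod μ hμ, map_mul, hχ, mul_zero]
  · intro μ _
    have := (Commute.all (X : F[X]) (g μ)).map (aeval A)
    rwa [aeval_X] at this

theorem sum_range_getD {α M : Type*} [AddCommMonoid M] (l : List α) (x : α) (φ : α → M) :
    ∑ k ∈ range l.length, φ (l.getD k x) = (l.map φ).sum := by
  induction l with
  | nil => simp
  | cons y l ih =>
    rw [List.length_cons, sum_range_succ', List.map_cons, List.sum_cons, ← ih, add_comm]
    simp

/-- Powers of a matrix applied to complementary projections are linearly independent. -/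
theorem linearIndependent_spectral [CharZero F] {s : Finset F}
    {E : F → Matrix (Fin d) (Fin d) F} (hsum : ∑ μ ∈ s, E μ = 1)
    (horth : ∀ μ ∈ s, ∀ ν ∈ s, μ ≠ ν → E μ * E ν = 0) (hcomm : ∀ μ ∈ s, Commute A (E μ))
    {m : F → ℕ} (hm : ∀ μ ∈ s, (A - Matrix.scalar (Fin d) μ) ^ m μ * E μ = 0)
    (hmin : ∀ μ ∈ s, ∀ i < m μ, (A - Matrix.scalar (Fin d) μ) ^ i * E μ ≠ 0)
    {T : Finset (F × ℕ)} (hT : ∀ x ∈ T, x.1 ∈ s ∧ x.2 < m x.1) (g : F × ℕ → F)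
    (hg : ∑ x ∈ T, g x • ((x.2.factorial : F)⁻¹ •
      ((A - Matrix.scalar (Fin d) x.1) ^ x.2 * E x.1)) = 0) : ∀ x ∈ T, g x = 0 := by
  classical
  have hid : ∀ μ ∈ s, E μ * E μ = E μ := by
    intro μ hμ
    have h1 : E μ * ∑ ν ∈ s, E ν = E μ := by rw [hsum, mul_one]
    rw [mul_sum, Finset.sum_eq_single_of_mem μ hμ fun ν hν hne => horth μ hμ ν hν hne.symm] at h1
    exact h1
  have hcomm' : ∀ μ ∈ s, ∀ ν : F, ∀ i, Commute (E μ) ((A - Matrix.scalar (Fin d) ν) ^ i) := by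
    intro μ hμ ν i
    refine Commute.pow_right (Commute.sub_right (hcomm μ hμ).symm ?_) i
    exact (Matrix.scalar_commute ν (fun r => mul_comm _ _) (E μ)).symm
  have hz : ∀ μ ∈ s, ∀ i, m μ ≤ i → (A - Matrix.scalar (Fin d) μ) ^ i * E μ = 0 := by
    intro μ hμ i hi
    rw [← Nat.sub_add_cancel hi, pow_add, mul_assoc, hm μ hμ, mul_zero]
  rintro ⟨μ, i⟩ hx
  induction i using Nat.strong_induction_on with
  | _ i ih =>
    obtain ⟨hμ, hi⟩ := hT _ hx
    simp only at hμ hi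
    have h1 := congrArg (fun Z => (A - Matrix.scalar (Fin d) μ) ^ (m μ - 1 - i) * (E μ * Z)) hg
    simp only [mul_zero, mul_sum] at h1
    rw [Finset.sum_eq_single_of_mem (μ, i) hx] at h1
    · simp only [Matrix.mul_smul] at h1
      rw [← mul_assoc (E μ), (hcomm' μ hμ μ i).eq, mul_assoc _ (E μ), hid μ hμ, ← mul_assoc,
        ← pow_add, smul_smul] at h1
      have h2 := (smul_eq_zero.1 h1).resolve_right (hmin μ hμ _ (by omega))
      exact (mul_eq_zero.1 h2).resolve_right
        (inv_ne_zero (by exact_mod_cast Nat.factorial_ne_zero i))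
    · rintro ⟨ν, k⟩ hν hne
      obtain ⟨hν', hk⟩ := hT _ hν
      simp only at hν' hk
      simp only [Matrix.mul_smul]
      rw [← mul_assoc (E μ), (hcomm' μ hμ ν k).eq, mul_assoc _ (E μ)]
      by_cases hνμ : ν = μ
      · subst hνμ
        have hki : k ≠ i := fun h => hne (by rw [h])
        rcases lt_or_gt_of_ne hki with h | h
        · rw [ih k h hν, zero_smul]
        · rw [hid ν hν', ← mul_assoc, ← pow_add, hz ν hν' _ (by omega), smul_zero, smul_zero]
      · rw [horth μ hμ ν hν' (Ne.symm hνμ), mul_zero, mul_zero, smul_zero, smul_zero]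

/-- Algebraic form of the expansion of the exponential of a matrix. -/
theorem exists_chain_expansion [IsAlgClosed F] [CharZero F] :
    ∃ (n : ℕ) (lam : ℕ → F) (j : ℕ → ℕ) (M E : ℕ → Matrix (Fin d) (Fin d) F),
      j 0 = 0 ∧ j n = 0 ∧
      (∀ k < n, j (k + 1) = 0 ∨ (lam (k + 1) = lam k ∧ j (k + 1) = j k + 1)) ∧
      (∀ k < n, A * M k = lam k • M k + (j (k + 1) : F) • M (k + 1)) ∧
      ∑ k ∈ range n, (if j k = 0 then M k else 0) = 1 ∧
      ∀ k < n, ∀ l < n, ∑ a, ∑ b, E k a b * M l a b = if k = l then 1 else 0 := by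
  classical
  obtain ⟨s, E, m₀, hsum, horth, hm₀, hcomm⟩ := exists_spectral_projections A
  have hex : ∀ μ, ∃ i, μ ∈ s → (A - Matrix.scalar (Fin d) μ) ^ i * E μ = 0 :=
    fun μ => ⟨m₀ μ, hm₀ μ⟩
  let m : F → ℕ := fun μ => Nat.find (hex μ)
  have hm : ∀ μ ∈ s, (A - Matrix.scalar (Fin d) μ) ^ m μ * E μ = 0 :=
    fun μ => Nat.find_spec (hex μ)
  have hmin : ∀ μ ∈ s, ∀ i < m μ, (A - Matrix.scalar (Fin d) μ) ^ i * E μ ≠ 0 :=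
    fun μ hμ i hi h => Nat.find_min (hex μ) hi fun _ => h
  let v : F × ℕ → Matrix (Fin d) (Fin d) F := fun x =>
    (x.2.factorial : F)⁻¹ • ((A - Matrix.scalar (Fin d) x.1) ^ x.2 * E x.1)
  have hv : ∀ μ i, A * v (μ, i) = μ • v (μ, i) + ((i + 1 : ℕ) : F) • v (μ, i + 1) := by
    intro μ i
    have h1 : ((i + 1 : ℕ) : F) * ((i + 1).factorial : F)⁻¹ = (i.factorial : F)⁻¹ := by
      have : ((i + 1 : ℕ) : F) ≠ 0 := by exact_mod_cast Nat.succ_ne_zero i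
      rw [Nat.factorial_succ, Nat.cast_mul]
      have : (i.factorial : F) ≠ 0 := by exact_mod_cast Nat.factorial_ne_zero i
      field_simp
    simp only [v]
    rw [smul_smul ((i + 1 : ℕ) : F), h1, pow_succ', Matrix.mul_smul, smul_comm μ, ← smul_add]
    congr 1
    rw [mul_assoc, sub_mul, Matrix.scalar_apply, ← Matrix.smul_eq_diagonal_mul]
    abel
  let l : List (F × ℕ) := s.toList.flatMap fun μ => chainIdx μ (m μ) 0
  have hmem : ∀ x, x ∈ l ↔ x.1 ∈ s ∧ x.2 < m x.1 := by
    intro x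
    simp only [l, List.mem_flatMap, Finset.mem_toList, mem_chainIdx]
    constructor
    · rintro ⟨μ, hμ, rfl, -, h⟩; exact ⟨hμ, by simpa using h⟩
    · rintro ⟨h1, h2⟩; exact ⟨x.1, h1, rfl, by omega, by omega⟩
  have hnodup : l.Nodup := by
    rw [List.nodup_flatMap]
    refine ⟨fun μ _ => nodup_chainIdx μ _ _, ?_⟩
    refine s.nodup_toList.imp fun {μ ν} hne => ?_
    intro x hx hx'
    exact hne ((mem_chainIdx.1 hx).1.symm.trans (mem_chainIdx.1 hx').1)
  have hhead : ∀ (μ : F) n, ((chainIdx μ n 0).headD (0, 0)).2 = 0 := by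
    intro μ n; cases n <;> rfl
  have hl : ChainCond A v l ∧ (l.headD (0, 0)).2 = 0 := by
    have : ∀ t : List F, (∀ μ ∈ t, μ ∈ s) →
        ChainCond A v (t.flatMap fun μ => chainIdx μ (m μ) 0) ∧
        ((t.flatMap fun μ => chainIdx μ (m μ) 0).headD (0, 0)).2 = 0 := by
      intro t
      induction t with
      | nil => intro _; exact ⟨trivial, rfl⟩
      | cons μ t ih =>
        intro ht
        obtain ⟨h1, h2⟩ := ih fun ν hν => ht ν (List.mem_cons_of_mem _ hν)
        rw [List.flatMap_cons]
        refine ⟨ChainCond.append (chainCond_chainIdx μ (hv μ) _ _ ?_) h1 h2, ?_⟩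
        · simp only [v, zero_add]
          rw [hm μ (ht μ List.mem_cons_self), smul_zero]
        · have := hhead μ (m μ)
          cases h : chainIdx μ (m μ) 0 with
          | nil => exact h2
          | cons y u => rw [h] at this; exact this
    exact this _ fun μ hμ => by simpa using hμ
  have hinit : (l.map fun x => if x.2 = 0 then v x else 0).sum = 1 := by
    have h1 : ∀ μ n i, 0 < i →
        ((chainIdx μ n i).map fun x => if x.2 = 0 then v x else 0).sum = 0 := by
      intro μ n i hi
      refine List.sum_eq_zero fun y hy => ?_
      obtain ⟨x, hx, rfl⟩ := List.mem_map.1 hy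
      rw [if_neg (by have := (mem_chainIdx.1 hx).2.1; omega)]
    have h2 : ∀ μ ∈ s, ((chainIdx μ (m μ) 0).map fun x => if x.2 = 0 then v x else 0).sum =
        E μ := by
      intro μ hμ
      have h3 := hm μ hμ
      cases h : m μ with
      | zero => rw [h, pow_zero, one_mul] at h3; simp [chainIdx, h3]
      | succ n =>
        rw [chainIdx, List.map_cons, List.sum_cons, h1 μ n 1 one_pos]
        simp [v]
    have h3 : ∀ t : List F, (∀ μ ∈ t, μ ∈ s) → ((t.flatMap fun μ => chainIdx μ (m μ) 0).map
        fun x => if x.2 = 0 then v x else 0).sum = (t.map E).sum := by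
      intro t
      induction t with
      | nil => intro _; rfl
      | cons μ t ih =>
        intro ht
        rw [List.flatMap_cons, List.map_append, List.sum_append, h2 μ (ht μ List.mem_cons_self),
          ih fun ν hν => ht ν (List.mem_cons_of_mem _ hν), List.map_cons, List.sum_cons]
    rw [h3 _ fun μ hμ => by simpa using hμ, Finset.sum_map_toList, hsum]
  have hind : LinearIndependent F fun k : Fin l.length => v (l.get k) := by
    rw [linearIndependent_iff']
    intro t g hg k hk
    let g' : F × ℕ → F := fun x => if h : ∃ k, l.get k = x then g h.choose else 0
    have hinj : Function.Injective l.get := List.nodup_iff_injective_get.1 hnodup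
    have hg' : ∀ k, g' (l.get k) = g k := by
      intro k
      have h : ∃ k', l.get k' = l.get k := ⟨k, rfl⟩
      simp only [g', dif_pos h]
      rw [hinj h.choose_spec]
    have := linearIndependent_spectral A hsum horth hcomm hm hmin (T := t.image l.get)
      (fun x hx => by
        obtain ⟨k, -, rfl⟩ := mem_image.1 hx
        exact (hmem _).1 (List.get_mem _ _)) g' (by
        rw [sum_image fun _ _ _ _ h => hinj h, ← hg]
        exact sum_congr rfl fun k _ => by rw [hg']) (l.get k) (mem_image_of_mem _ hk)
    rwa [hg'] at this
  obtain ⟨D, hD⟩ := exists_dual_of_linearIndependent hind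
  refine ⟨l.length, fun k => (l.getD k (0, 0)).1, fun k => (l.getD k (0, 0)).2,
    fun k => v (l.getD k (0, 0)), fun k => if h : k < l.length then D ⟨k, h⟩ else 0,
    ?_, ?_, fun k hk => (hl.1.getD hk).1, fun k hk => (hl.1.getD hk).2, ?_, ?_⟩
  · have e : l.headD (0, 0) = l.getD 0 (0, 0) := by cases l <;> rfl
    change (l.getD 0 (0, 0)).2 = 0
    rw [← e]; exact hl.2
  · simp
  · rw [sum_range_getD l (0, 0) fun x => if x.2 = 0 then v x else 0, hinit]
  · intro k hk i hi
    have h1 : l.getD i (0, 0) = l.get ⟨i, hi⟩ := by simp [List.getD, hi]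
    simp only [dif_pos hk, h1]
    rw [hD]
    simp

end Spectral

end AlgFlow

/-! ### Number fields with a certified generator -/

namespace AlgFlow

open Finset Polynomial

/-- The polynomial with the given coordinates. -/
noncomputable def coordPoly (m : ℕ) (v : List ℤ) : ℤ[X] :=
  ∑ i ∈ range m, C (v.getD i 0) * X ^ i

theorem aeval_coordPoly (m : ℕ) (v : List ℤ) (θ : ℂ) : aeval θ (coordPoly m v) = kval m θ v := by
  simp [coordPoly, kval]

theorem coeff_coordPoly (m : ℕ) (v : List ℤ) (i : ℕ) :
    (coordPoly m v).coeff i = if i < m then v.getD i 0 else 0 := by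
  simp [coordPoly, finsetSum_coeff, coeff_X_pow]

theorem degree_coordPoly_lt (m : ℕ) (v : List ℤ) : (coordPoly m v).degree < m := by
  rw [degree_lt_iff_coeff_zero]
  intro i hi
  rw [coeff_coordPoly, if_neg (by omega)]

/-- The monic polynomial with the given lower coefficients. -/
noncomputable def monicPoly (f : List ℤ) : ℤ[X] := X ^ f.length + coordPoly f.length f

theorem monicPoly_monic (f : List ℤ) : (monicPoly f).Monic :=
  monic_X_pow_add (degree_coordPoly_lt _ _)

theorem natDegree_monicPoly (f : List ℤ) : (monicPoly f).natDegree = f.length := by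
  refine natDegree_eq_of_degree_eq_some ?_
  rw [monicPoly, degree_add_eq_left_of_degree_lt, degree_X_pow]
  rw [degree_X_pow]; exact degree_coordPoly_lt _ _

theorem aeval_monicPoly (f : List ℤ) (θ : ℂ) :
    aeval θ (monicPoly f) = kval f.length θ f + θ ^ f.length := by
  rw [monicPoly, map_add, aeval_coordPoly, map_pow, aeval_X, add_comm]

theorem isRootOf_iff {f : List ℤ} {θ : ℂ} : IsRootOf f θ ↔ aeval θ (monicPoly f) = 0 := by
  rw [aeval_monicPoly, IsRootOf]

theorem evalList_append_one (f : List ℤ) (z : ℂ) :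
    evalList z (f ++ [1]) = aeval z (monicPoly f) := by
  rw [aeval_monicPoly, evalList_eq_sum, List.length_append, List.length_singleton, sum_range_succ,
    kval]
  congr 1
  · refine sum_congr rfl fun i hi => ?_
    have := mem_range.1 hi
    simp [List.getD, List.getElem?_append, this]
  · simp [List.getD]

theorem IsRootOf.isIntegral {f : List ℤ} {θ : ℂ} (h : IsRootOf f θ) : IsIntegral ℤ θ :=
  ⟨monicPoly f, monicPoly_monic f, by
    have := isRootOf_iff.1 h
    rwa [aeval_def] at this⟩

theorem powIndep_iff {m : ℕ} {θ : ℂ} (hθ : IsIntegral ℤ θ) :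
    PowIndep m θ ↔ m ≤ (minpoly ℤ θ).natDegree := by
  have hmap := minpoly.isIntegrallyClosed_eq_field_fractions' ℚ hθ
  have hdeg : (minpoly ℚ θ).natDegree = (minpoly ℤ θ).natDegree := by
    rw [hmap, (minpoly.monic hθ).natDegree_map]
  constructor
  · intro h
    by_contra! hlt
    have h1 := h (vec m (minpoly ℤ θ).coeff) (by
      rw [kval_vec, ← minpoly.aeval ℤ θ, aeval_eq_sum_range' hlt]
      simp [Algebra.smul_def]) _ hlt
    rw [getD_vec, if_pos hlt, coeff_natDegree, (minpoly.monic hθ).leadingCoeff] at h1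
    exact one_ne_zero h1
  · intro hm v hv i hi
    have hz : aeval θ ((coordPoly m v).map (algebraMap ℤ ℚ)) = 0 := by
      rw [aeval_map_algebraMap, aeval_coordPoly, hv]
    have h0 : (coordPoly m v).map (algebraMap ℤ ℚ) = 0 := by
      by_contra hne
      have h1 := minpoly.degree_le_of_ne_zero ℚ θ hne hz
      have h2 : ((coordPoly m v).map (algebraMap ℤ ℚ)).degree < m :=
        (degree_map_le).trans_lt (degree_coordPoly_lt m v)
      have h3 : (m : WithBot ℕ) ≤ (minpoly ℚ θ).degree := by
        rw [degree_eq_natDegree (minpoly.ne_zero (hθ.tower_top (A := ℚ))), hdeg]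
        exact_mod_cast hm
      exact absurd (h3.trans h1) (not_le.2 h2)
    have h4 := (Polynomial.map_eq_zero_iff (algebraMap ℤ ℚ).injective_int).1 h0
    have := coeff_coordPoly m v i
    rw [h4, coeff_zero, if_pos hi] at this
    exact this.symm

theorem mem_box {B m : ℕ} {v : List ℤ} :
    v ∈ box B m ↔ v.length = m ∧ ∀ x ∈ v, |x| ≤ B := by
  induction m generalizing v with
  | zero =>
    have e : box B 0 = [[]] := rfl
    rw [e, List.mem_singleton, List.length_eq_zero_iff]
    constructor
    · rintro rfl; simp
    · exact fun h => h.1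
  | succ m ih =>
    have e : box B (m + 1) = (List.range (2 * B + 1)).flatMap fun (i : ℕ) =>
      (box B m).map fun l => ((i : ℤ) - (B : ℤ)) :: l := rfl
    rw [e]
    simp only [List.mem_flatMap, List.mem_range, List.mem_map, ih]
    constructor
    · rintro ⟨i, hi, l, ⟨h1, h2⟩, rfl⟩
      refine ⟨by simp [h1], ?_⟩
      intro x hx
      rcases List.mem_cons.1 hx with rfl | hx
      · rw [abs_le]; constructor <;> omega
      · exact h2 x hx
    · rintro ⟨h1, h2⟩
      cases v with
      | nil => simp at h1
      | cons x v =>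
        have hx := abs_le.1 (h2 x List.mem_cons_self)
        refine ⟨(x + B).toNat, by omega, v, ⟨by simpa using h1, fun y hy =>
          h2 y (List.mem_cons_of_mem _ hy)⟩, ?_⟩
        congr 1
        omega

theorem foldr_natAbs (f : List ℤ) : f.foldr (fun a acc => a.natAbs + acc) 0 =
    ∑ i ∈ range f.length, (f.getD i 0).natAbs := by
  induction f with
  | nil => rfl
  | cons a f ih =>
    rw [List.length_cons, sum_range_succ', List.foldr_cons, ih, add_comm]
    simp

theorem norm_root_le {f : List ℤ} {z : ℂ} (hz : aeval z (monicPoly f) = 0) :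
    ‖z‖ ≤ 1 + ((f.foldr (fun a acc => a.natAbs + acc) 0 : ℕ) : ℝ) := by
  rw [aeval_monicPoly] at hz
  rw [foldr_natAbs]
  push_cast
  by_contra! h
  have hS : (0 : ℝ) ≤ ∑ i ∈ range f.length, ((f.getD i 0).natAbs : ℝ) :=
    sum_nonneg fun _ _ => Nat.cast_nonneg _
  have h1 : 1 < ‖z‖ := by linarith
  rcases Nat.eq_zero_or_pos f.length with h0 | h0
  · rw [h0, pow_zero, kval] at hz
    simp at hz
  have h2 : ‖z‖ ^ f.length ≤ (∑ i ∈ range f.length, ((f.getD i 0).natAbs : ℝ)) *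
      ‖z‖ ^ (f.length - 1) := by
    rw [← norm_pow, eq_neg_of_add_eq_zero_right hz, norm_neg, kval, sum_mul]
    refine (norm_sum_le _ _).trans (sum_le_sum fun i hi => ?_)
    rw [norm_mul, norm_pow, Complex.norm_intCast, Nat.cast_natAbs, Int.cast_abs]
    gcongr
    · exact h1.le
    · have := mem_range.1 hi; omega
  rw [← Nat.sub_add_cancel h0, pow_succ', Nat.sub_add_cancel h0] at h2
  have h3 := le_of_mul_le_mul_right h2 (by positivity)
  linarith

theorem powIndep_of_boxOK {x : Approx} {f : List ℤ} {θ : ℂ} (hx : x.Near θ) (hf : IsRootOf f θ)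
    (hbox : boxOK x f = true) : PowIndep f.length θ := by
  have hint := hf.isIntegral
  rw [powIndep_iff hint]
  by_contra! hlt
  set g := minpoly ℤ θ with hg
  have hmonic : g.Monic := minpoly.monic hint
  have hdvd : g ∣ monicPoly f := minpoly.isIntegrallyClosed_dvd hint (isRootOf_iff.1 hf)
  set S := f.foldr (fun a acc => a.natAbs + acc) 0 with hS
  have hcoeff : ∀ i, |g.coeff i| ≤ boxBound f := by
    intro i
    have h1 := coeff_bdd_of_roots_le (B := 1 + S) (d := f.length) (algebraMap ℤ ℂ) hmonic
      (IsAlgClosed.splits _) hlt.le (fun z hz => by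
        refine norm_root_le ?_
        have : aeval z g = 0 := by
          have := isRoot_of_mem_roots hz
          rwa [IsRoot.def, eval_map, ← aeval_def] at this
        obtain ⟨q, hq⟩ := hdvd
        rw [hq, map_mul, this, zero_mul]) i
    rw [coeff_map, max_eq_left (by simp)] at h1
    have h2 : (f.length.choose (f.length / 2) : ℝ) ≤ 2 ^ f.length := by
      exact_mod_cast Nat.choose_le_two_pow _ _
    have h3 : (|g.coeff i| : ℝ) ≤ (1 + S) ^ f.length * 2 ^ f.length := by
      rw [eq_intCast, Complex.norm_intCast] at h1
      exact h1.trans (by gcongr)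
    rw [boxBound, ← hS]
    rw [← mul_pow, mul_comm] at h3
    exact_mod_cast h3
  have hmem : vec f.length g.coeff ∈ box (boxBound f) f.length := by
    rw [mem_box, length_vec]
    refine ⟨rfl, fun y hy => ?_⟩
    obtain ⟨i, -, rfl⟩ := List.mem_map.1 hy
    exact hcoeff i
  have hval : kval f.length θ (vec f.length g.coeff) = 0 := by
    rw [kval_vec, ← minpoly.aeval ℤ θ, ← hg, aeval_eq_sum_range' hlt]
    simp [Algebra.smul_def]
  have h1 := List.all_eq_true.1 hbox _ hmem
  rcases Bool.or_eq_true _ _ ▸ h1 with h1 | h1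
  · have := keq_iff.1 h1 _ hlt
    rw [getD_vec, if_pos hlt, coeff_natDegree, hmonic.leadingCoeff] at this
    simp at this
  · refine hx.ne_zero h1 ?_
    rw [evalList_eq_sum, length_vec]
    exact hval

/-- A root of the monic polynomial exists near the centre. -/
theorem exists_root_near {x : Approx} {f : List ℤ} (hs : 0 < x.2.2.1) (hr : 0 < x.2.2.2.1)
    (hb : boundOK x = true) (h : rootOK x f = true) : ∃ θ, IsRootOf f θ ∧ x.Near θ := by
  rw [rootOK_iff hs, evalList_append_one] at h
  have hr' : (0 : ℝ) < x.2.2.2.1 := by exact_mod_cast hr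
  by_contra! hne
  have hfar : ∀ z ∈ ((monicPoly f).map (algebraMap ℤ ℂ)).roots,
      1 / (x.2.2.2.1 : ℝ) ≤ ‖x.center - z‖ := by
    intro z hz
    by_contra! hlt
    have h0 : aeval z (monicPoly f) = 0 := by
      have := isRoot_of_mem_roots hz
      rwa [IsRoot.def, eval_map, ← aeval_def] at this
    exact hne z (isRootOf_iff.2 h0) ⟨hs, hr, hb, by rwa [norm_sub_rev]⟩
  have hmon : ((monicPoly f).map (algebraMap ℤ ℂ)).Monic := (monicPoly_monic f).map _
  have h1 := (IsAlgClosed.splits ((monicPoly f).map (algebraMap ℤ ℂ))).eq_prod_roots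
  rw [hmon.leadingCoeff, C_1, one_mul] at h1
  have hcard : ((monicPoly f).map (algebraMap ℤ ℂ)).roots.card = f.length := by
    rw [IsAlgClosed.card_roots_eq_natDegree, (monicPoly_monic f).natDegree_map,
      natDegree_monicPoly]
  have h2 : aeval x.center (monicPoly f) =
      ((((monicPoly f).map (algebraMap ℤ ℂ)).roots).map fun z => x.center - z).prod := by
    rw [aeval_def, ← eval_map]
    conv_lhs => rw [h1]
    rw [eval_multiset_prod, Multiset.map_map]
    simp
  have h3 : ∀ s : Multiset ℂ, (∀ z ∈ s, 1 / (x.2.2.2.1 : ℝ) ≤ ‖x.center - z‖) →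
      1 ≤ (x.2.2.2.1 : ℝ) ^ s.card * ‖(s.map fun z => x.center - z).prod‖ := by
    intro s
    induction s using Multiset.induction with
    | empty => simp
    | cons z s ih =>
      intro hs
      have a1 := ih fun y hy => hs y (Multiset.mem_cons_of_mem hy)
      have a2 := hs z (Multiset.mem_cons_self z s)
      rw [div_le_iff₀ hr'] at a2
      rw [Multiset.card_cons, Multiset.map_cons, Multiset.prod_cons, norm_mul, pow_succ]
      calc (1 : ℝ) ≤ (‖x.center - z‖ * x.2.2.2.1) * ((x.2.2.2.1 : ℝ) ^ s.card *
            ‖(s.map fun z => x.center - z).prod‖) := one_le_mul_of_one_le_of_one_le a2 a1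
        _ = _ := by ring
  have h4 := h3 _ hfar
  rw [hcard, ← h2] at h4
  linarith

/-- Coordinates for finitely many algebraic numbers. -/
theorem exists_coordinates (S : Finset ℂ) (hS : ∀ z ∈ S, IsAlgebraic ℚ z) :
    ∃ (f : List ℤ) (θ : ℂ) (N : ℕ), 0 < f.length ∧ IsRootOf f θ ∧ PowIndep f.length θ ∧ 0 < N ∧
      ∀ z ∈ S, ∃ h : List ℤ, kval f.length θ h = N * z := by
  let K := IntermediateField.adjoin ℚ (S : Set ℂ)
  have : FiniteDimensional ℚ K :=
    IntermediateField.finiteDimensional_adjoin fun z hz => (hS z hz).isIntegral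
  obtain ⟨α, hα⟩ : ∃ α : K, @IntermediateField.adjoin ℚ _ K _ K.algebra' {α} = ⊤ :=
    @Field.exists_primitive_element ℚ K _ _ K.algebra' _ _
  have hK : IntermediateField.adjoin ℚ {(α : ℂ)} = K := by
    have h := IntermediateField.lift_adjoin_simple ℚ K α
    rw [hα, IntermediateField.lift_top] at h
    exact h.symm
  have halg : IsAlgebraic ℤ (α : ℂ) :=
    (IsFractionRing.isAlgebraic_iff ℤ ℚ ℂ).2
      ((Algebra.IsAlgebraic.isAlgebraic (R := ℚ) α).algebraMap)
  obtain ⟨c, hc, hint⟩ := halg.exists_integral_multiple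
  set θ : ℂ := c • (α : ℂ) with hθ
  have hαθ : (α : ℂ) ∈ IntermediateField.adjoin ℚ {θ} := by
    have h1 : (α : ℂ) = ((c : ℚ)⁻¹) • θ := by
      rw [hθ, ← Int.cast_smul_eq_zsmul ℚ, smul_smul, inv_mul_cancel₀ (by exact_mod_cast hc),
        one_smul]
    rw [h1]
    exact IntermediateField.smul_mem _ (IntermediateField.mem_adjoin_simple_self ℚ θ)
  have hKθ : K ≤ IntermediateField.adjoin ℚ {θ} := by
    rw [← hK, IntermediateField.adjoin_simple_le_iff]; exact hαθ
  have hintQ : IsIntegral ℚ θ := hint.tower_top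
  set m := (minpoly ℤ θ).natDegree with hm
  have hdeg : (minpoly ℚ θ).natDegree = m := by
    rw [minpoly.isIntegrallyClosed_eq_field_fractions' ℚ hint, (minpoly.monic hint).natDegree_map]
  have hmpos : 0 < m := minpoly.natDegree_pos hint
  let f := vec m (minpoly ℤ θ).coeff
  have hfl : f.length = m := length_vec _ _
  have hsingle : ∀ z ∈ K, ∃ (N : ℕ) (h : List ℤ), 0 < N ∧ kval m θ h = N * z := by
    intro z hz
    have h1 : z ∈ (IntermediateField.adjoin ℚ {θ}).toSubalgebra := hKθ hz
    rw [IntermediateField.adjoin_simple_toSubalgebra_of_isAlgebraic hintQ.isAlgebraic,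
      Algebra.adjoin_singleton_eq_range_aeval] at h1
    obtain ⟨p, rfl⟩ := h1
    let q := p %ₘ minpoly ℚ θ
    have hq : aeval θ q = aeval θ p := aeval_modByMonic_eq_self_of_root (minpoly.aeval ℚ θ)
    have hqd : q.natDegree < m := by
      rw [← hdeg]
      exact natDegree_modByMonic_lt _ (minpoly.monic hintQ) (minpoly.ne_one ℚ θ)
    let N := ∏ i ∈ range m, (q.coeff i).den
    refine ⟨N, vec m fun i => (q.coeff i).num * ((N / (q.coeff i).den : ℕ) : ℤ),
      Finset.prod_pos fun i _ => (q.coeff i).den_pos, ?_⟩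
    change _ = (N : ℂ) * aeval θ p
    rw [kval_vec, ← hq, aeval_eq_sum_range' hqd, mul_sum]
    refine sum_congr rfl fun i hi => ?_
    obtain ⟨k, hk⟩ := Finset.dvd_prod_of_mem (fun i => (q.coeff i).den) hi
    change N = (q.coeff i).den * k at hk
    have hd : ((q.coeff i).den : ℂ) ≠ 0 := by exact_mod_cast (q.coeff i).den_ne_zero
    rw [hk, Nat.mul_div_cancel_left _ (q.coeff i).den_pos, Algebra.smul_def, eq_ratCast,
      Rat.cast_def]
    push_cast
    field_simp
  refine ⟨f, θ, ?_⟩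
  rw [hfl]
  have hroot : IsRootOf f θ := by
    rw [IsRootOf, hfl, kval_vec]
    have h1 := minpoly.aeval ℤ θ
    rw [aeval_eq_sum_range, sum_range_succ, coeff_natDegree, (minpoly.monic hint).leadingCoeff,
      one_smul] at h1
    rw [← h1]
    congr 1
    exact sum_congr rfl fun i _ => by simp [Algebra.smul_def]
  have hsub : ∀ T : Finset ℂ, T ⊆ S → ∃ N : ℕ, 0 < N ∧ ∀ z ∈ T, ∃ h : List ℤ,
      kval m θ h = N * z := by
    intro T
    induction T using Finset.induction_on with
    | empty => intro _; exact ⟨1, one_pos, by simp⟩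
    | insert y T _ ih =>
      intro hT
      obtain ⟨N, hN, hh⟩ := ih fun z hz => hT (mem_insert_of_mem hz)
      obtain ⟨N', h', hN', hy⟩ := hsingle y
        (IntermediateField.subset_adjoin _ _ (hT (mem_insert_self _ _)))
      refine ⟨N * N', Nat.mul_pos hN hN', fun z hz => ?_⟩
      rcases mem_insert.1 hz with rfl | hz
      · exact ⟨ksmul m N h', by rw [kval_ksmul, hy]; push_cast; ring⟩
      · obtain ⟨h, hz⟩ := hh z hz
        exact ⟨ksmul m N' h, by rw [kval_ksmul, hz]; push_cast; ring⟩
  obtain ⟨N, hN, hh⟩ := hsub S subset_rfl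
  exact ⟨N, hmpos, hroot, (powIndep_iff hint).2 le_rfl, hN, hh⟩

end AlgFlow

/-! ### Soundness of the certificate checker -/

namespace AlgFlow

open Finset MvPolynomial

section Values

variable {d m N : ℕ} {θ : ℂ} {f : List ℤ}

theorem sum_map_range {R : Type*} [AddCommMonoid R] (n : ℕ) (g : ℕ → R) :
    ((List.range n).map g).sum = ∑ i ∈ range n, g i := by
  induction n with
  | zero => rfl
  | succ n ih => rw [List.range_succ, List.map_append, List.sum_append, ih, sum_range_succ]; simp

/-- The variable with the given indices, or `1` if they are out of range. -/
noncomputable def natVar (d : ℕ) (p : ℕ × ℕ) : MvPolynomial (Fin d × Fin d) ℂ :=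
  if h : p.1 < d ∧ p.2 < d then X (⟨p.1, h.1⟩, ⟨p.2, h.2⟩) else 1

theorem natVar_fin (a b : Fin d) : natVar d (a, b) = X (a, b) := by
  rw [natVar, dif_pos ⟨a.2, b.2⟩]

/-- The monomial of a word. -/
noncomputable def wordMon (d : ℕ) (w : List (ℕ × ℕ)) : MvPolynomial (Fin d × Fin d) ℂ :=
  (w.map (natVar d)).prod

/-- The polynomial of a sum of words. -/
noncomputable def wval (m d : ℕ) (θ : ℂ) (p : WPoly) : MvPolynomial (Fin d × Fin d) ℂ :=
  (p.map fun t => C (kval m θ t.2) * wordMon d t.1).sum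

/-- The matrix of a matrix of coordinate vectors with common denominator `N`. -/
noncomputable def toMat (m d N : ℕ) (θ : ℂ) (M : KMat) : Matrix (Fin d) (Fin d) ℂ :=
  Matrix.of fun a b => kval m θ (ent M a b) / N

theorem wval_cons (t : List (ℕ × ℕ) × List ℤ) (p : WPoly) :
    wval m d θ (t :: p) = C (kval m θ t.2) * wordMon d t.1 + wval m d θ p := by
  simp [wval]

theorem wval_append (p q : WPoly) : wval m d θ (p ++ q) = wval m d θ p + wval m d θ q := by
  simp [wval]

theorem wval_flatMap {α : Type*} (l : List α) (g : α → WPoly) :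
    wval m d θ (l.flatMap g) = (l.map fun a => wval m d θ (g a)).sum := by
  induction l with
  | nil => simp [wval]
  | cons a l ih => rw [List.flatMap_cons, wval_append, ih, List.map_cons, List.sum_cons]

theorem wval_wscale (hm : 0 < f.length) (hf : IsRootOf f θ) (h : List ℤ) (p : WPoly) :
    wval f.length d θ (wscale f h p) = C (kval f.length θ h) * wval f.length d θ p := by
  induction p with
  | nil => simp [wval, wscale]
  | cons t p ih =>
    have e : wscale f h (t :: p) = (t.1, kmul f h t.2) :: wscale f h p := rfl
    rw [e, wval_cons, ih, wval_cons, kval_kmul hm hf, C_mul]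
    ring

theorem wval_wmul (hm : 0 < f.length) (hf : IsRootOf f θ) (p q : WPoly) :
    wval f.length d θ (wmul f p q) = wval f.length d θ p * wval f.length d θ q := by
  rw [wmul, wval_flatMap]
  have : ∀ t : List (ℕ × ℕ) × List ℤ,
      wval f.length d θ (q.map fun r => (t.1 ++ r.1, kmul f t.2 r.2)) =
      C (kval f.length θ t.2) * wordMon d t.1 * wval f.length d θ q := by
    intro t
    induction q with
    | nil => simp [wval]
    | cons r q ih =>
      rw [List.map_cons, wval_cons, ih, wval_cons, kval_kmul hm hf, C_mul, wordMon, wordMon,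
        wordMon, List.map_append, List.prod_append]
      ring
  simp only [this]
  rw [List.sum_map_mul_right]
  rfl

theorem wval_lform (hN : 0 < N) (E : KMat) :
    wval m d θ (lform d E) = C (N : ℂ) * linForm (toMat m d N θ E) := by
  have hN' : (N : ℂ) ≠ 0 := by exact_mod_cast hN.ne'
  rw [lform, wval_flatMap, sum_map_range, sum_range, linForm, mul_sum]
  refine sum_congr rfl fun a _ => ?_
  rw [wval, List.map_map, sum_map_range, sum_range, mul_sum]
  refine sum_congr rfl fun b _ => ?_
  simp only [Function.comp, wordMon, List.map_cons, List.map_nil, List.prod_cons, List.prod_nil,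
    mul_one, natVar_fin]
  rw [← mul_assoc, ← C_mul, toMat, Matrix.of_apply, mul_div_cancel₀ _ hN']

theorem wval_wordProd (hm : 0 < f.length) (hf : IsRootOf f θ) (hN : 0 < N) (ts : List Term)
    (w : List ℕ) : wval f.length d θ (wordProd f d ts w) = C ((N : ℂ) ^ w.length) *
      (w.map fun k => linForm (toMat f.length d N θ (tm ts k).2.2.2)).prod := by
  induction w with
  | nil => simp [wordProd, wval, wordMon, kval_const hm]
  | cons k w ih =>
    have e : wordProd f d ts (k :: w) = wmul f (lform d (tm ts k).2.2.2) (wordProd f d ts w) := rfl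
    rw [e, wval_wmul hm hf, ih, wval_lform hN, List.length_cons, pow_succ, C_mul, List.map_cons,
      List.prod_cons]
    ring

theorem wval_linGen (hm : 0 < f.length) (hf : IsRootOf f θ) (hN : 0 < N) (ts : List Term)
    (a b : Fin d) : wval f.length d θ (linGen f N d ts a b) = C ((N : ℂ) * N) *
      (X (a, b) - ∑ k ∈ range ts.length, C (toMat f.length d N θ (tm ts k).2.2.1 a b) *
        linForm (toMat f.length d N θ (tm ts k).2.2.2)) := by
  have hN' : (N : ℂ) ≠ 0 := by exact_mod_cast hN.ne'
  rw [linGen, wval_cons, wval_flatMap, sum_map_range, mul_sub, mul_sum, sub_eq_add_neg,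
    ← sum_neg_distrib]
  congr 1
  · simp [wordMon, natVar_fin, kval_const hm]
  · refine sum_congr rfl fun k _ => ?_
    rw [wval_wscale hm hf, wval_lform hN, kval_ksmul, toMat, toMat, Matrix.of_apply]
    rw [← mul_assoc, ← mul_assoc, ← C_mul, ← C_mul, ← neg_mul, ← C_neg]
    congr 2
    push_cast
    field_simp

theorem wval_binGen (hm : 0 < f.length) (hf : IsRootOf f θ) (hN : 0 < N) (ts : List Term)
    (t : WordPair) : wval f.length d θ (binGen f N d ts t) =
      C ((N : ℂ) ^ t.1.length * (N : ℂ) ^ t.2.length) *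
      ((t.1.map fun k => linForm (toMat f.length d N θ (tm ts k).2.2.2)).prod -
        (t.2.map fun k => linForm (toMat f.length d N θ (tm ts k).2.2.2)).prod) := by
  rw [binGen, wval_append, wval_wscale hm hf, wval_wscale hm hf, wval_wordProd hm hf hN,
    wval_wordProd hm hf hN, kval_const hm, kval_const hm]
  push_cast
  simp only [C_mul, C_neg]
  ring

end Values

section Relations

variable {n m : ℕ} {θ : ℂ} {ts : List Term}

theorem sum_map_kval (g : ℕ → List ℤ) (u : Multiset ℕ) :
    (u.map fun k => kval m θ (g k)).sum =
      ∑ i ∈ range m, (((u.map fun k => (g k).getD i 0).sum : ℤ) : ℂ) * θ ^ i := by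
  induction u using Multiset.induction with
  | empty => simp
  | cons k u ih =>
    rw [Multiset.map_cons, Multiset.sum_cons, ih, kval, ← sum_add_distrib]
    refine sum_congr rfl fun i _ => ?_
    rw [Multiset.map_cons, Multiset.sum_cons]
    push_cast
    ring

theorem getD_map_tm (g : Term → ℤ) (hg : g ([], 0, [], []) = 0) (k : ℕ) :
    (ts.map g).getD k 0 = g (tm ts k) := by
  rw [tm, ← hg, List.getD_map]

theorem relEqs_iff (hθ : PowIndep m θ) (t : Multiset ℕ × Multiset ℕ) :
    (∀ e ∈ relEqs m ts, mulVal e t = 0) ↔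
      (t.1.map fun k => kval m θ (tm ts k).1).sum = (t.2.map fun k => kval m θ (tm ts k).1).sum ∧
      (t.1.map fun k => (tm ts k).2.1).sum = (t.2.map fun k => (tm ts k).2.1).sum := by
  have h1 : mulVal (ts.map fun T => (T.2.1 : ℤ)) t = 0 ↔
      (t.1.map fun k => (tm ts k).2.1).sum = (t.2.map fun k => (tm ts k).2.1).sum := by
    have e : ∀ u : Multiset ℕ, (u.map fun k => (ts.map fun T => (T.2.1 : ℤ)).getD k 0).sum =
        (((u.map fun k => (tm ts k).2.1).sum : ℕ) : ℤ) := by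
      intro u
      rw [Nat.cast_multiset_sum, Multiset.map_map]
      congr 1
      exact Multiset.map_congr rfl fun k _ => getD_map_tm (fun T => (T.2.1 : ℤ)) rfl k
    change _ - _ = (0 : ℤ) ↔ _
    rw [e, e, sub_eq_zero]
    exact Nat.cast_inj
  have h2 : ∀ i, mulVal (ts.map fun T => T.1.getD i 0) t =
      (t.1.map fun k => (tm ts k).1.getD i 0).sum - (t.2.map fun k => (tm ts k).1.getD i 0).sum := by
    intro i
    change (_ - _ : ℤ) = _
    simp only [getD_map_tm (ts := ts) (fun T => T.1.getD i 0) rfl]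
  have h3 : (∀ i < m, mulVal (ts.map fun T => T.1.getD i 0) t = 0) ↔
      (t.1.map fun k => kval m θ (tm ts k).1).sum =
        (t.2.map fun k => kval m θ (tm ts k).1).sum := by
    rw [sum_map_kval, sum_map_kval]
    constructor
    · intro h
      refine sum_congr rfl fun i hi => ?_
      have := h i (mem_range.1 hi)
      rw [h2, sub_eq_zero] at this
      rw [this]
    · intro h i hi
      have := hθ (vec m fun i => mulVal (ts.map fun T => T.1.getD i 0) t) (by
        rw [kval_vec]
        simp only [h2]
        push_cast
        simp only [sub_mul, sum_sub_distrib]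
        push_cast at h
        rw [h, sub_self]) i hi
      rwa [getD_vec, if_pos hi] at this
  rw [← h1, ← h3, relEqs, List.forall_mem_cons, and_comm]
  simp

end Relations

/-- The expansion of the matrix exponential that a certificate provides. -/
theorem expansion_of_checks {d N : ℕ} {θ : ℂ} {f : List ℤ} {AA : KMat} {ts : List Term}
    (hm : 0 < f.length) (hf : IsRootOf f θ) (hN : 0 < N) (hchain : chainOK ts = true)
    (hode : odeOK f N d AA ts = true) (hinit : initOK f N d ts = true)
    (hdual : dualOK f N d ts = true) :
    Expansion (toMat f.length d N θ AA) ts.length (fun k => kval f.length θ (tm ts k).1 / N)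
      (fun k => (tm ts k).2.1) (fun k => toMat f.length d N θ (tm ts k).2.2.1)
      (fun k => toMat f.length d N θ (tm ts k).2.2.2) := by
  have hN' : (N : ℂ) ≠ 0 := by exact_mod_cast hN.ne'
  simp only [chainOK, Bool.and_eq_true, Bool.or_eq_true, decide_eq_true_eq, List.all_eq_true,
    List.mem_range] at hchain
  simp only [odeOK, List.all_eq_true, List.mem_range] at hode
  simp only [initOK, List.all_eq_true, List.mem_range] at hinit
  simp only [dualOK, List.all_eq_true, List.mem_range] at hdual
  refine ⟨fun z => exp_eq_sum hchain.1 (by simp [tm]) ?_ ?_ ?_ z, ?_⟩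
  · intro k hk
    refine (hchain.2 k hk).imp id fun h => ⟨?_, h.2⟩
    simp only [h.1]
  · intro k hk
    ext a b
    have h := kval_eq_of_keq (θ := θ) (hode k hk a a.2 b b.2)
    simp only [kval_ksum, kval_kadd, kval_ksmul, kval_kmul hm hf, sum_range] at h
    simp only [Matrix.mul_apply, toMat, Matrix.add_apply, Matrix.smul_apply, Matrix.of_apply,
      smul_eq_mul]
    have e : ∀ c : Fin d, kval f.length θ (ent AA a c) / N *
        (kval f.length θ (ent (tm ts k).2.2.1 c b) / N) = kval f.length θ (ent AA a c) *
        kval f.length θ (ent (tm ts k).2.2.1 c b) / (N * N) := fun c => by field_simp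
    rw [sum_congr rfl fun c _ => e c, ← sum_div, h]
    push_cast
    field_simp
  · ext a b
    have h := kval_eq_of_keq (θ := θ) (hinit a a.2 b b.2)
    rw [kval_ksum, kval_const hm] at h
    have e : ∀ k, ((if (tm ts k).2.1 = 0 then toMat f.length d N θ (tm ts k).2.2.1 else 0) :
        Matrix (Fin d) (Fin d) ℂ) a b = kval f.length θ
        (bif decide ((tm ts k).2.1 = 0) then ent (tm ts k).2.2.1 a b else []) / N := by
      intro k
      by_cases hk : (tm ts k).2.1 = 0 <;> simp [hk, toMat, kval_nil]
    rw [Matrix.sum_apply, sum_congr rfl fun k _ => e k, ← sum_div, h]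
    by_cases hab : a = b
    · subst hab; simp [hN']
    · have : (a : ℕ) ≠ b := fun h => hab (Fin.ext h)
      simp [this, Matrix.one_apply_ne hab]
  · intro k hk l hl
    have h := kval_eq_of_keq (θ := θ) (hdual k hk l hl)
    simp only [kval_ksum, kval_const hm, kval_kmul hm hf, sum_range] at h
    simp only [toMat, Matrix.of_apply, div_mul_div_comm]
    rw [sum_congr rfl fun a _ => (sum_div _ _ _).symm, ← sum_div, h]
    by_cases hkl : k = l <;> simp [hkl, hN']

/-- The generators that belong to an expansion generate the vanishing ideal. -/
theorem span_idealGens {d N : ℕ} {θ : ℂ} {f : List ℤ} {A : Matrix (Fin d) (Fin d) ℂ}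
    {ts : List Term} (hm : 0 < f.length) (hf : IsRootOf f θ) (hθ : PowIndep f.length θ)
    (hN : 0 < N)
    (hA : Expansion A ts.length (fun k => kval f.length θ (tm ts k).1 / N)
      (fun k => (tm ts k).2.1) (fun k => toMat f.length d N θ (tm ts k).2.2.1)
      (fun k => toMat f.length d N θ (tm ts k).2.2.2)) :
    vanishingIdeal ℂ (flow A) =
      Ideal.span {p | p ∈ (idealGens f N d ts).map (wval f.length d θ)} := by
  have hN' : (N : ℂ) ≠ 0 := by exact_mod_cast hN.ne'
  have hunit : ∀ {I : Ideal (MvPolynomial (Fin d × Fin d) ℂ)} {a : ℂ} {p}, a ≠ 0 →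
      C a * p ∈ I → p ∈ I := by
    intro I a p ha h
    have := I.mul_mem_left (C a⁻¹) h
    rwa [← mul_assoc, ← C_mul, inv_mul_cancel₀ ha, C_1, one_mul] at this
  have hrel : ∀ t : Multiset ℕ × Multiset ℕ, (∀ e ∈ relEqs f.length ts, mulVal e t = 0) ↔
      (t.1.map fun k => kval f.length θ (tm ts k).1 / N).sum =
        (t.2.map fun k => kval f.length θ (tm ts k).1 / N).sum ∧
      (t.1.map fun k => (tm ts k).2.1).sum = (t.2.map fun k => (tm ts k).2.1).sum := by
    intro t
    rw [relEqs_iff hθ, Multiset.sum_map_div, Multiset.sum_map_div, div_left_inj' hN']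
  refine hA.vanishingIdeal_eq ?_ ?_ ?_
  · rw [Ideal.span_le]
    rintro p hp _ ⟨t, -, rfl⟩
    obtain ⟨W, hW, rfl⟩ := List.mem_map.1 hp
    rcases List.mem_append.1 hW with hW | hW
    · simp only [List.mem_flatMap, List.mem_map, List.mem_range] at hW
      obtain ⟨a, ha, b, hb, rfl⟩ := hW
      have e := wval_linGen hm hf hN ts (⟨a, ha⟩ : Fin d) ⟨b, hb⟩
      simp only at e
      rw [e, map_mul, map_sub, map_sum, aeval_X, sub_eq_zero.2, mul_zero]
      have e2 := congrFun (congrFun (hA.exp_eq t) ⟨a, ha⟩) ⟨b, hb⟩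
      rw [Matrix.sum_apply] at e2
      refine e2.trans (sum_congr rfl fun k hk => ?_)
      rw [map_mul, hA.aeval_linForm_flow _ (mem_range.1 hk), aeval_C, Matrix.smul_apply,
        smul_eq_mul, mul_comm]
      rfl
    · obtain ⟨w, hw, rfl⟩ := List.mem_map.1 hW
      obtain ⟨h1, h2, h3⟩ := gens_spec _ _ w hw
      have h4 := (hrel w.toMul).1 fun e he => by rw [← pairVal_eq]; exact h3 e he
      have key : ∀ l : List ℕ, (∀ k ∈ l, k < ts.length) →
          aeval (fun ab : Fin d × Fin d => NormedSpace.exp ((t : ℂ) • A) ab.1 ab.2)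
            (l.map fun k => linForm (toMat f.length d N θ (tm ts k).2.2.2)).prod =
          (t : ℂ) ^ (l.map fun k => (tm ts k).2.1).sum *
            Complex.exp ((l.map fun k => kval f.length θ (tm ts k).1 / N).sum * t) := by
        intro l hl
        induction l with
        | nil => simp
        | cons k l ih =>
          simp only [List.map_cons, List.prod_cons, List.sum_cons, map_mul]
          rw [ih fun x hx => hl x (List.mem_cons_of_mem _ hx),
            hA.aeval_linForm_flow _ (hl k List.mem_cons_self), pow_add, add_mul, Complex.exp_add]
          ring
      simp only [WordPair.toMul, Multiset.map_coe, Multiset.sum_coe] at h4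
      rw [wval_binGen hm hf hN, map_mul, map_sub, key _ h1, key _ h2, h4.1, h4.2, sub_self,
        mul_zero]
  · intro a b
    refine hunit (mul_ne_zero hN' hN') ?_
    rw [← wval_linGen hm hf hN]
    refine Ideal.subset_span (List.mem_map_of_mem (List.mem_append_left _ ?_))
    simp only [List.mem_flatMap, List.mem_map, List.mem_range]
    exact ⟨a, a.2, b, b.2, rfl⟩
  · intro u v hu hv h1 h2
    have hmem := mem_closure_gens ts.length (relEqs f.length ts) (u, v) hu hv
      ((hrel (u, v)).2 ⟨h1, h2⟩)
    refine AddSubmonoid.closure_induction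
      (motive := fun t _ => (t.1.map fun k => linForm (toMat f.length d N θ (tm ts k).2.2.2)).prod -
        (t.2.map fun k => linForm (toMat f.length d N θ (tm ts k).2.2.2)).prod ∈
        Ideal.span {p | p ∈ (idealGens f N d ts).map (wval f.length d θ)}) ?_ ?_ ?_ hmem
    · rintro _ ⟨g, hg, rfl⟩
      refine hunit (mul_ne_zero (pow_ne_zero g.1.length hN') (pow_ne_zero g.2.length hN')) ?_
      simp only [WordPair.toMul, Multiset.map_coe, Multiset.prod_coe]
      rw [← wval_binGen hm hf hN]
      exact Ideal.subset_span (List.mem_map_of_mem (List.mem_append_right _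
        (List.mem_map_of_mem hg)))
    · simp
    · intro x y _ _ hx hy
      simp only [Prod.fst_add, Prod.snd_add, Multiset.map_add, Multiset.prod_add]
      have := Ideal.add_mem _ (Ideal.mul_mem_left _
        (x.1.map fun k => linForm (toMat f.length d N θ (tm ts k).2.2.2)).prod hy)
        (Ideal.mul_mem_right
        (y.2.map fun k => linForm (toMat f.length d N θ (tm ts k).2.2.2)).prod _ hx)
      convert this using 1
      ring

section Codes

variable {d : ℕ}

theorem wordMon_eq_prod (w : List (ℕ × ℕ)) : wordMon d w =
    ∏ ij : Fin d × Fin d, X ij ^ (((expTable d w).getD ij.1 []).getD ij.2 0) := by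
  have e : ∀ ij : Fin d × Fin d, ((expTable d w).getD ij.1 []).getD ij.2 0 =
      (w.filter fun x => decide (x = ((ij.1 : ℕ), (ij.2 : ℕ)))).length := by
    intro ij
    simp [expTable, List.getD]
  simp only [e]
  clear e
  induction w with
  | nil => simp [wordMon]
  | cons x w ih =>
    have e1 : wordMon d (x :: w) = natVar d x * wordMon d w := by simp [wordMon]
    have e2 : natVar d x = ∏ ij : Fin d × Fin d,
        (X ij : MvPolynomial (Fin d × Fin d) ℂ) ^
          (if x = ((ij.1 : ℕ), (ij.2 : ℕ)) then 1 else 0) := by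
      by_cases h : x.1 < d ∧ x.2 < d
      · rw [natVar, dif_pos h, prod_eq_single (⟨x.1, h.1⟩, ⟨x.2, h.2⟩)]
        · simp
        · intro ij _ hij
          rw [if_neg, pow_zero]
          rintro rfl
          exact hij rfl
        · simp
      · rw [natVar, dif_neg h, prod_eq_one]
        intro ij _
        rw [if_neg, pow_zero]
        rintro rfl
        exact h ⟨ij.1.2, ij.2.2⟩
    rw [e1, ih, e2, ← prod_mul_distrib]
    refine prod_congr rfl fun ij _ => ?_
    rw [← pow_add, List.filter_cons]
    by_cases h : x = ((ij.1 : ℕ), (ij.2 : ℕ)) <;> simp [h, add_comm]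

theorem kval_mem_of_repOK {f : List ℤ} {x : Approx} {θ : ℂ} {N : ℕ} {h : List ℤ} {c : NumCode}
    (hm : 0 < f.length) (hf : IsRootOf f θ) (hθ : PowIndep f.length θ) (hx : x.Near θ)
    (hN : 0 < N) (hr : repOK f x N h c = true) :
    kval f.length θ h / N ∈ {w ∈ c.disc | Polynomial.aeval w c.poly = 0} := by
  rw [repOK, Bool.and_eq_true, keq_khorner_iff hm hf hθ c hN] at hr
  refine ⟨?_, hr.1⟩
  rw [← evalList_trunc]
  exact hx.mem_disc hN hr.2

theorem MatCode.Represents.length_eq {c : MatCode} {A : Matrix (Fin d) (Fin d) ℂ}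
    (h : c.Represents A) : c.length = d := by
  simpa using List.Forall₂.length_eq h

theorem MatCode.Represents.entry {c : MatCode} {A : Matrix (Fin d) (Fin d) ℂ}
    (h : c.Represents A) (a b : Fin d) :
    ((c.getD a []).getD b ([], 0, 0, 0)).Represents (A a b) := by
  have hd := h.length_eq
  obtain ⟨h1, h2⟩ := List.forall₂_iff_get.1 h
  have ha : (a : ℕ) < c.length := by omega
  have h3 := h2 a ha (by simp)
  obtain ⟨h4, h5⟩ := List.forall₂_iff_get.1 h3
  have hb : (b : ℕ) < (c.get ⟨a, ha⟩).length := by rw [h4]; simp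
  have h6 := h5 b hb (by simp)
  have e : (c.getD a []).getD b ([], 0, 0, 0) = (c.get ⟨a, ha⟩).get ⟨b, hb⟩ := by
    simp at hb
    simp [List.getD, ha, hb]
  rw [e]
  simpa using h6

/-- The codes that belong to polynomials with certified coefficients. -/
theorem represents_of_dictOK {f : List ℤ} {x : Approx} {θ : ℂ} {D : List NumCode}
    {Ws : List WPoly} (hm : 0 < f.length) (hf : IsRootOf f θ) (hθ : PowIndep f.length θ)
    (hx : x.Near θ) (hD : dictOK f x D Ws = true) :
    List.Forall₂ (PolyCode.Represents (d := d))
      (Ws.map fun W => W.map fun t => (expTable d t.1, lookupCode D t.2))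
      (Ws.map (wval f.length d θ)) := by
  rw [List.forall₂_map_left_iff, List.forall₂_map_right_iff, List.forall₂_same]
  intro W hW
  rw [PolyCode.Represents]
  refine ⟨W.map fun t => C (kval f.length θ t.2) * wordMon d t.1, ?_, by rw [wval]⟩
  rw [List.forall₂_map_left_iff, List.forall₂_map_right_iff, List.forall₂_same]
  intro t ht
  rw [TermCode.Represents]
  refine ⟨kval f.length θ t.2, ?_, by rw [wordMon_eq_prod]⟩
  simp only [dictOK, List.all_eq_true, Bool.and_eq_true] at hD
  obtain ⟨h1, h2⟩ := hD W hW t ht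
  have h3 := kval_mem_of_repOK hm hf hθ hx one_pos h1
  rw [Nat.cast_one, div_one] at h3
  exact represents_of_uniqOK h2 h3.1 h3.2

end Codes

/-- A certificate that passes the test yields a correct output. -/
theorem certOut_correct {d : ℕ} {A : Matrix (Fin d) (Fin d) ℂ} {c : MatCode}
    (hc : c.Represents A) {T : Cert} (hT : certOK c T = true) :
    ∃ ps : List (MvPolynomial (Fin d × Fin d) ℂ),
      List.Forall₂ PolyCode.Represents (certOut c T) ps ∧
      zeroLocus ℂ (Ideal.span {p | p ∈ ps}) = zariskiClosure (flow A) ∧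
      Ideal.span {p | p ∈ ps} = vanishingIdeal ℂ (flow A) := by
  obtain ⟨f, x, N, AA, ts, D⟩ := T
  have hd := hc.length_eq
  simp only [certOK, hd, Bool.and_eq_true] at hT
  obtain ⟨⟨⟨⟨⟨⟨hfield, hinput⟩, hchain⟩, hode⟩, hinit⟩, hdual⟩, hdict⟩ := hT
  simp only [fieldOK, Bool.and_eq_true, decide_eq_true_eq] at hfield
  obtain ⟨⟨⟨⟨⟨⟨hm, hN⟩, hs⟩, hr⟩, hb⟩, hroot⟩, hbox⟩ := hfield
  obtain ⟨θ, hf, hx⟩ := exists_root_near hs hr hb hroot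
  have hθ := powIndep_of_boxOK hx hf hbox
  have hA : A = toMat f.length d N θ AA := by
    ext a b
    simp only [inputOK, hd, List.all_eq_true, List.mem_range] at hinput
    have h1 := kval_mem_of_repOK hm hf hθ hx hN (hinput a a.2 b b.2)
    rw [(hc.entry a b).2] at h1
    exact h1.symm
  have hexp := expansion_of_checks hm hf hN hchain hode hinit hdual
  rw [← hA] at hexp
  have hspan := span_idealGens hm hf hθ hN hexp
  refine ⟨(idealGens f N d ts).map (wval f.length d θ), ?_, by rw [← hspan, zariskiClosure_eq],
    hspan.symm⟩
  have := represents_of_dictOK (d := d) hm hf hθ hx hdict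
  rw [certOut, hd]
  exact this

end AlgFlow

/-! ### Completeness of the certificate checker -/

namespace AlgFlow

open Finset Filter Topology

section Approximation

theorem exists_gaussian_near (z : ℂ) {s : ℕ} (hs : 0 < s) {R : ℕ} (hR : 2 * ‖z‖ + 2 ≤ R) :
    ∃ u v : ℤ, ‖z - ((u : ℂ) + (v : ℂ) * Complex.I) / (s : ℂ)‖ < 1 / s ∧
      u.natAbs + v.natAbs + s ≤ R * s := by
  have hs1 : (1 : ℝ) ≤ s := by exact_mod_cast hs
  have hs0 : (s : ℂ) ≠ 0 := by exact_mod_cast hs.ne'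
  have h1 := abs_sub_round (s * z.re)
  have h2 := abs_sub_round (s * z.im)
  set u := round (s * z.re)
  set v := round (s * z.im)
  refine ⟨u, v, ?_, ?_⟩
  · have e : z - ((u : ℂ) + (v : ℂ) * Complex.I) / (s : ℂ) =
        (s * z - ((u : ℂ) + (v : ℂ) * Complex.I)) / s := by field_simp
    rw [e, norm_div, Complex.norm_natCast]
    refine div_lt_div_of_pos_right ?_ (by linarith)
    rw [← sq_lt_one_iff₀ (norm_nonneg _), Complex.sq_norm, Complex.normSq_apply]
    have r1 : (s * z - ((u : ℂ) + (v : ℂ) * Complex.I)).re = s * z.re - u := by simp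
    have r2 : (s * z - ((u : ℂ) + (v : ℂ) * Complex.I)).im = s * z.im - v := by simp
    rw [r1, r2]
    rw [abs_le] at h1 h2
    nlinarith
  · have hz1 := Complex.abs_re_le_norm z
    have hz2 := Complex.abs_im_le_norm z
    have a1 : |(u : ℝ)| ≤ s * ‖z‖ + 1 / 2 := by
      have := abs_sub_abs_le_abs_sub (u : ℝ) (s * z.re)
      rw [abs_sub_comm (u : ℝ), abs_mul, Nat.abs_cast] at this
      have := mul_le_mul_of_nonneg_left hz1 (by linarith : (0 : ℝ) ≤ s)
      linarith
    have a2 : |(v : ℝ)| ≤ s * ‖z‖ + 1 / 2 := by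
      have := abs_sub_abs_le_abs_sub (v : ℝ) (s * z.im)
      rw [abs_sub_comm (v : ℝ), abs_mul, Nat.abs_cast] at this
      have := mul_le_mul_of_nonneg_left hz2 (by linarith : (0 : ℝ) ≤ s)
      linarith
    have h3 := mul_le_mul_of_nonneg_right hR (by linarith : (0 : ℝ) ≤ s)
    have h4 : ((u.natAbs + v.natAbs + s : ℕ) : ℝ) ≤ ((R * s : ℕ) : ℝ) := by
      push_cast
      rw [Nat.cast_natAbs, Nat.cast_natAbs, Int.cast_abs, Int.cast_abs]
      nlinarith
    exact_mod_cast h4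

/-- Good approximations of a root pass the tests. -/
theorem exists_approx {f : List ℤ} {θ : ℂ} (hf : IsRootOf f θ) {R : ℕ} (hR : 2 * ‖θ‖ + 2 ≤ R)
    {r : ℕ} (hr : 0 < r) :
    ∃ x : Approx, x.2.2.2.1 = r ∧ x.2.2.2.2 = R ∧ x.Near θ ∧ rootOK x f = true := by
  set L := lipBound R (f ++ [1]) with hL
  set s := r ^ f.length * L + r with hs
  have hs0 : 0 < s := by omega
  have hsr : (0 : ℝ) < s := by exact_mod_cast hs0
  have hr' : (0 : ℝ) < r := by exact_mod_cast hr
  obtain ⟨u, v, h1, h2⟩ := exists_gaussian_near θ hs0 hR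
  have hb : boundOK (u, v, s, r, R) = true := by simpa [boundOK] using h2
  refine ⟨(u, v, s, r, R), rfl, rfl, ⟨hs0, hr, hb, h1.trans_le ?_⟩, ?_⟩
  · change 1 / (s : ℝ) ≤ 1 / (r : ℝ)
    refine one_div_le_one_div_of_le hr' ?_
    exact_mod_cast (by omega : r ≤ s)
  · rw [rootOK_iff hs0]
    set c := Approx.center (u, v, s, r, R) with hc
    have hcR : ‖c‖ ≤ R := by
      have := norm_center_le (x := (u, v, s, r, R)) hs0 hb
      change ‖c‖ + 1 ≤ (R : ℝ) at this
      linarith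
    have h3 := norm_evalList_sub_le hcR (by linarith [norm_nonneg θ] : ‖θ‖ ≤ R) (f ++ [1])
    rw [evalList_append_one f θ, isRootOf_iff.1 hf, sub_zero, ← hL] at h3
    have h4 : ‖c - θ‖ < 1 / s := by rw [norm_sub_rev]; exact h1
    change (r : ℝ) ^ f.length * ‖evalList c (f ++ [1])‖ < 1
    calc (r : ℝ) ^ f.length * ‖evalList c (f ++ [1])‖
        ≤ (r : ℝ) ^ f.length * (L * (1 / s)) := by gcongr; exact h3.trans (by gcongr)
      _ < 1 := by
        rw [← mul_assoc, mul_one_div, div_lt_one hsr, hs]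
        push_cast
        linarith

theorem exists_simple_root_poly {z : ℂ} (hz : IsAlgebraic ℚ z) :
    ∃ p : Polynomial ℤ, Polynomial.aeval z p = 0 ∧ Polynomial.aeval z p.derivative ≠ 0 := by
  have hex : ∃ n, ∃ p : Polynomial ℤ, p ≠ 0 ∧ Polynomial.aeval z p = 0 ∧ p.natDegree = n := by
    obtain ⟨p, h0, hp⟩ := (IsFractionRing.isAlgebraic_iff ℤ ℚ ℂ).2 hz
    exact ⟨_, p, h0, hp, rfl⟩
  classical
  obtain ⟨p, h0, hp, hn⟩ := Nat.find_spec hex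
  refine ⟨p, hp, fun hd => ?_⟩
  have hpos : 0 < p.natDegree := by
    by_contra! h
    obtain ⟨a, rfl⟩ := Polynomial.natDegree_eq_zero.1 (Nat.le_zero.1 h)
    rw [Polynomial.aeval_C] at hp
    have : a = 0 := by simpa using hp
    exact h0 (by rw [this, Polynomial.C_0])
  have hlt := Polynomial.natDegree_derivative_lt hpos.ne'
  rw [hn] at hlt
  refine Nat.find_min hex hlt ⟨_, fun h => ?_, hd, rfl⟩
  have := Polynomial.derivative_eq_zero.1 h
  omega

theorem exists_uniqOK {z : ℂ} (hz : IsAlgebraic ℚ z) {R : ℕ} (hR : 2 * ‖z‖ + 2 ≤ R) :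
    ∃ c : NumCode, uniqOK R c = true ∧ z ∈ c.disc ∧ Polynomial.aeval z c.poly = 0 := by
  obtain ⟨p, hp, hp'⟩ := exists_simple_root_poly hz
  set a := (List.range (p.natDegree + 1)).map p.coeff with ha
  choose u v h1 h2 using fun n : ℕ => exists_gaussian_near z n.succ_pos hR
  let cd : ℕ → NumCode := fun n => (a, u n, v n, n)
  have hpoly : ∀ n, (cd n).poly = p := fun n => NumCode.poly_ofList p _
  have hcen : ∀ n, (codeApprox R (cd n)).center =
      ((u n : ℂ) + (v n : ℂ) * Complex.I) / ((n.succ : ℕ) : ℂ) := fun n => rfl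
  have hlim : Tendsto (fun n => (codeApprox R (cd n)).center) atTop (𝓝 z) := by
    rw [tendsto_iff_norm_sub_tendsto_zero]
    refine squeeze_zero (fun _ => norm_nonneg _) (fun n => ?_)
      tendsto_one_div_add_atTop_nhds_zero_nat
    rw [hcen, norm_sub_rev]
    refine (h1 n).le.trans_eq ?_
    push_cast
    rfl
  have hder : Tendsto (fun n => ‖Polynomial.aeval (codeApprox R (cd n)).center p.derivative‖)
      atTop (𝓝 ‖Polynomial.aeval z p.derivative‖) :=
    ((Polynomial.continuous_aeval _).tendsto z |>.comp hlim).norm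
  have hinf := (tendsto_natCast_atTop_atTop (R := ℝ)).atTop_add
    (tendsto_const_nhds (x := (1 : ℝ))) |>.atTop_mul_pos (norm_pos_iff.2 hp') hder
  obtain ⟨n, hn⟩ := (hinf.eventually (eventually_gt_atTop (sndBound R a : ℝ))).exists
  refine ⟨cd n, (uniqOK_iff R _).2 ⟨?_, ?_⟩, ?_, by rw [hpoly, hp]⟩
  · exact decide_eq_true (h2 n)
  · rw [derivList_eq, hpoly]
    exact hn
  · rw [codeApprox_disc R, Metric.mem_ball, dist_eq_norm, hcen]
    refine (h1 n).trans_eq ?_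
    push_cast
    rfl

theorem eventually_const_lt_mul (a : ℝ) {b : ℝ} (hb : 0 < b) :
    ∀ᶠ r : ℕ in atTop, a < r * b :=
  (tendsto_natCast_atTop_atTop.atTop_mul_const hb).eventually_gt_atTop a

theorem eventually_repOK {f : List ℤ} {θ : ℂ} {N : ℕ} {h : List ℤ} {c : NumCode} (R : ℕ)
    (hm : 0 < f.length) (hf : IsRootOf f θ) (hθ : PowIndep f.length θ) (hN : 0 < N)
    (hd : kval f.length θ h / N ∈ c.disc)
    (h0 : Polynomial.aeval (kval f.length θ h / N) c.poly = 0) :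
    ∀ᶠ r : ℕ in atTop, ∀ x : Approx, x.2.2.2.1 = r → x.2.2.2.2 = R → x.Near θ →
      repOK f x N h c = true := by
  rw [mem_disc_iff hN] at hd
  filter_upwards [eventually_const_lt_mul
    (2 * (c.2.2.2 + 1) * lipBound R (trunc f.length h)) (sub_pos.2 hd)] with r hr x hxr hxR hx
  rw [repOK, Bool.and_eq_true, keq_khorner_iff hm hf hθ c hN]
  refine ⟨h0, hx.inDisc ?_⟩
  rw [hxr, hxR, evalList_trunc]
  exact hr

theorem eventually_boxOK {f : List ℤ} {θ : ℂ} (R : ℕ) (hθ : PowIndep f.length θ) :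
    ∀ᶠ r : ℕ in atTop, ∀ x : Approx, x.2.2.2.1 = r → x.2.2.2.2 = R → x.Near θ →
      boxOK x f = true := by
  have : ∀ v ∈ {v | v ∈ box (boxBound f) f.length}, ∀ᶠ r : ℕ in atTop, ∀ x : Approx,
      x.2.2.2.1 = r → x.2.2.2.2 = R → x.Near θ →
      (keq f.length v [] || farZero x v) = true := by
    intro v hv
    have hl := (mem_box.1 hv).1
    by_cases hk : kval f.length θ v = 0
    · filter_upwards with r x _ _ _
      rw [Bool.or_eq_true]
      exact Or.inl (keq_of_kval_eq hθ (by rw [hk, kval_nil]))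
    · have he : evalList θ v = kval f.length θ v := by rw [evalList_eq_sum, hl, kval]
      filter_upwards [eventually_const_lt_mul (2 * lipBound R v) (norm_pos_iff.2 hk)]
        with r hr x hxr hxR hx
      rw [Bool.or_eq_true]
      refine Or.inr (hx.farZero ?_)
      rw [hxr, hxR, he]
      exact hr
  filter_upwards [(eventually_all_finite (List.finite_toSet _)).2 this] with r hr x h1 h2 h3
  exact List.all_eq_true.2 fun v hv => hr v hv x h1 h2 h3

end Approximation

theorem exists_algebraic_expansion {d : ℕ} {A : Matrix (Fin d) (Fin d) ℂ}
    (hA : ∀ a b, IsAlgebraic ℚ (A a b)) :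
    ∃ (n : ℕ) (lam : ℕ → ℂ) (j : ℕ → ℕ) (M E : ℕ → Matrix (Fin d) (Fin d) ℂ),
      (∀ k, IsAlgebraic ℚ (lam k)) ∧ (∀ k a b, IsAlgebraic ℚ (M k a b)) ∧
      (∀ k a b, IsAlgebraic ℚ (E k a b)) ∧ j 0 = 0 ∧ j n = 0 ∧
      (∀ k < n, j (k + 1) = 0 ∨ (lam (k + 1) = lam k ∧ j (k + 1) = j k + 1)) ∧
      (∀ k < n, A * M k = lam k • M k + (j (k + 1) : ℂ) • M (k + 1)) ∧
      ∑ k ∈ range n, (if j k = 0 then M k else 0) = 1 ∧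
      ∀ k < n, ∀ l < n, ∑ a, ∑ b, E k a b * M l a b = if k = l then 1 else 0 := by
  let F := algebraicClosure ℚ ℂ
  have : IsAlgClosed F := (algebraicClosure.isAlgClosure ℚ ℂ).isAlgClosed
  have halg : ∀ x : F, IsAlgebraic ℚ (x : ℂ) := fun x => mem_algebraicClosure_iff.1 x.2
  let A' : Matrix (Fin d) (Fin d) F := Matrix.of fun a b =>
    ⟨A a b, mem_algebraicClosure_iff.2 (hA a b)⟩
  let φ : Matrix (Fin d) (Fin d) F →+* Matrix (Fin d) (Fin d) ℂ := (algebraMap F ℂ).mapMatrix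
  have hφ : φ A' = A := rfl
  have hsmul : ∀ (x : F) M, φ (x • M) = (x : ℂ) • φ M := fun x M => by
    ext a b
    exact map_mul (algebraMap F ℂ) _ _
  obtain ⟨n, lam, j, M, E, h1, h2, h3, h4, h5, h6⟩ := exists_chain_expansion A'
  refine ⟨n, fun k => lam k, j, fun k => φ (M k), fun k => φ (E k), fun k => halg _,
    fun k a b => halg _, fun k a b => halg _, h1, h2, ?_, ?_, ?_, ?_⟩
  · intro k hk
    refine (h3 k hk).imp id fun h => ⟨congrArg _ h.1, h.2⟩
  · intro k hk
    have := congrArg φ (h4 k hk)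
    rw [map_mul, map_add, hφ, hsmul, hsmul] at this
    rw [this]
    simp
  · have := congrArg φ h5
    rw [map_sum, map_one] at this
    rw [← this]
    refine sum_congr rfl fun k _ => ?_
    split_ifs
    · rfl
    · exact (map_zero φ).symm
  · intro k hk l hl
    have := congrArg (algebraMap F ℂ) (h6 k hk l hl)
    simp only [map_sum, map_mul] at this
    change ∑ a, ∑ b, algebraMap F ℂ (E k a b) * algebraMap F ℂ (M l a b) = _
    rw [this]
    split_ifs <;> simp

section Certificate

variable {d m N : ℕ} {θ : ℂ}

/-- The matrix of the coordinates of the entries of a matrix. -/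
def coordMat (g : ℂ → List ℤ) (M : Matrix (Fin d) (Fin d) ℂ) : KMat :=
  List.ofFn fun a => List.ofFn fun b => g (M a b)

theorem ent_coordMat (g : ℂ → List ℤ) (M : Matrix (Fin d) (Fin d) ℂ) (a b : Fin d) :
    ent (coordMat g M) a b = g (M a b) := by
  simp [ent, coordMat, List.getD]

/-- The terms of an expansion. -/
def coordTerms (g : ℂ → List ℤ) (n : ℕ) (lam : ℕ → ℂ) (j : ℕ → ℕ)
    (M E : ℕ → Matrix (Fin d) (Fin d) ℂ) : List Term :=
  (List.range n).map fun k => (g (lam k), j k, coordMat g (M k), coordMat g (E k))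

theorem tm_coordTerms {g : ℂ → List ℤ} {n : ℕ} {lam : ℕ → ℂ} {j : ℕ → ℕ}
    {M E : ℕ → Matrix (Fin d) (Fin d) ℂ} {k : ℕ} (hk : k < n) :
    tm (coordTerms g n lam j M E) k =
      (g (lam k), j k, coordMat g (M k), coordMat g (E k)) := by
  simp [tm, coordTerms, List.getD, hk]

theorem tm_coordTerms_self {g : ℂ → List ℤ} {n : ℕ} {lam : ℕ → ℂ} {j : ℕ → ℕ}
    {M E : ℕ → Matrix (Fin d) (Fin d) ℂ} :
    tm (coordTerms g n lam j M E) n = ([], 0, [], []) := by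
  simp [tm, coordTerms, List.getD]

theorem length_coordTerms {g : ℂ → List ℤ} {n : ℕ} {lam : ℕ → ℂ} {j : ℕ → ℕ}
    {M E : ℕ → Matrix (Fin d) (Fin d) ℂ} : (coordTerms g n lam j M E).length = n := by
  simp [coordTerms]

/-- The algebraic part of a certificate. -/
theorem exists_algebraic_certificate {A : Matrix (Fin d) (Fin d) ℂ}
    (hA : ∀ a b, IsAlgebraic ℚ (A a b)) :
    ∃ (f : List ℤ) (θ : ℂ) (N : ℕ) (AA : KMat) (ts : List Term), 0 < f.length ∧ IsRootOf f θ ∧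
      PowIndep f.length θ ∧ 0 < N ∧ (∀ a b : Fin d, kval f.length θ (ent AA a b) = N * A a b) ∧
      chainOK ts = true ∧ odeOK f N d AA ts = true ∧ initOK f N d ts = true ∧
      dualOK f N d ts = true := by
  classical
  obtain ⟨n, lam, j, M, E, hlam, hM, hE, hj0, hjn, hchain, hode, hinit, hdual⟩ :=
    exists_algebraic_expansion hA
  let S : Finset ℂ := (univ.image fun p : Fin d × Fin d => A p.1 p.2) ∪ (range n).image lam ∪
    ((range n ×ˢ univ).image fun p : ℕ × Fin d × Fin d => M p.1 p.2.1 p.2.2) ∪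
    ((range n ×ˢ univ).image fun p : ℕ × Fin d × Fin d => E p.1 p.2.1 p.2.2)
  obtain ⟨f, θ, N, hm, hf, hθ, hN, hS⟩ := exists_coordinates S (by
    intro z hz
    simp only [S, mem_union, mem_image] at hz
    rcases hz with ((⟨p, -, rfl⟩ | ⟨k, -, rfl⟩) | ⟨p, -, rfl⟩) | ⟨p, -, rfl⟩
    · exact hA _ _
    · exact hlam _
    · exact hM _ _ _
    · exact hE _ _ _)
  have hex : ∃ g : ℂ → List ℤ, ∀ z ∈ S, kval f.length θ (g z) = N * z := by
    refine ⟨fun z => if h : z ∈ S then (hS z h).choose else [], fun z hz => ?_⟩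
    simp only [dif_pos hz]
    exact (hS z hz).choose_spec
  obtain ⟨g, hg⟩ := hex
  have gA : ∀ a b, kval f.length θ (g (A a b)) = N * A a b := fun a b => hg _ (by
    simp only [S, mem_union, mem_image]
    exact Or.inl (Or.inl (Or.inl ⟨(a, b), mem_univ _, rfl⟩)))
  have gl : ∀ k < n, kval f.length θ (g (lam k)) = N * lam k := fun k hk => hg _ (by
    simp only [S, mem_union, mem_image]
    exact Or.inl (Or.inl (Or.inr ⟨k, mem_range.2 hk, rfl⟩)))
  have gM : ∀ k < n, ∀ a b, kval f.length θ (g (M k a b)) = N * M k a b := fun k hk a b => hg _ (by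
    simp only [S, mem_union, mem_image]
    exact Or.inl (Or.inr ⟨(k, a, b), by simp [hk], rfl⟩))
  have gE : ∀ k < n, ∀ a b, kval f.length θ (g (E k a b)) = N * E k a b := fun k hk a b => hg _ (by
    simp only [S, mem_union, mem_image]
    exact Or.inr ⟨(k, a, b), by simp [hk], rfl⟩)
  have hjt : ∀ k ≤ n, (tm (coordTerms g n lam j M E) k).2.1 = j k := by
    intro k hk
    rcases hk.lt_or_eq with hk | rfl
    · rw [tm_coordTerms hk]
    · rw [tm_coordTerms_self, hjn]
  refine ⟨f, θ, N, coordMat g A, coordTerms g n lam j M E, hm, hf, hθ, hN, ?_, ?_, ?_, ?_, ?_⟩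
  · intro a b
    rw [ent_coordMat, gA]
  · simp only [chainOK, Bool.and_eq_true, Bool.or_eq_true, decide_eq_true_eq, List.all_eq_true,
      List.mem_range, length_coordTerms]
    refine ⟨by rw [hjt 0 (Nat.zero_le _), hj0], fun k hk => ?_⟩
    rw [hjt k hk.le, hjt (k + 1) hk]
    rcases (Nat.succ_le_of_lt hk).lt_or_eq with hk1 | hk1
    · refine (hchain k hk).imp id fun h => ⟨?_, h.2⟩
      rw [tm_coordTerms hk, tm_coordTerms hk1, h.1]
    · left
      rw [← hjn]
      congr 1
  · simp only [odeOK, List.all_eq_true, List.mem_range, length_coordTerms]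
    intro k hk a ha b hb
    lift a to Fin d using ha
    lift b to Fin d using hb
    refine keq_of_kval_eq hθ ?_
    have h1 := congrFun (congrFun (hode k hk) a) b
    simp only [Matrix.mul_apply, Matrix.add_apply, Matrix.smul_apply, smul_eq_mul] at h1
    rw [kval_ksum, kval_kadd, kval_ksmul, kval_kmul hm hf, sum_range, tm_coordTerms hk,
      hjt (k + 1) hk]
    simp only [kval_kmul hm hf, ent_coordMat, gA, gM k hk, gl k hk]
    have h2 : (j (k + 1) : ℂ) * kval f.length θ
        (ent (tm (coordTerms g n lam j M E) (k + 1)).2.2.1 a b) =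
        N * (j (k + 1) * M (k + 1) a b) := by
      rcases (Nat.succ_le_of_lt hk).lt_or_eq with hk1 | hk1
      · rw [tm_coordTerms hk1, ent_coordMat, gM _ hk1]
        ring
      · have : j (k + 1) = 0 := by rw [← hjn]; congr 1
        simp [this]
    push_cast
    rw [mul_assoc (N : ℂ) (j (k + 1) : ℂ), h2]
    have h3 : ∑ c : Fin d, (N : ℂ) * A a c * (N * M k c b) =
        N * N * ∑ c : Fin d, A a c * M k c b := by
      rw [mul_sum]
      exact sum_congr rfl fun c _ => by ring
    rw [h3, h1]
    ring
  · simp only [initOK, List.all_eq_true, List.mem_range]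
    intro a ha b hb
    lift a to Fin d using ha
    lift b to Fin d using hb
    refine keq_of_kval_eq hθ ?_
    have h1 := congrFun (congrFun hinit a) b
    rw [Matrix.sum_apply] at h1
    rw [kval_ksum, kval_const hm, length_coordTerms]
    have h2 : ∀ k ∈ range n, kval f.length θ (bif decide
        ((tm (coordTerms g n lam j M E) k).2.1 = 0) then
        ent (tm (coordTerms g n lam j M E) k).2.2.1 a b else []) =
        N * (if j k = 0 then M k else 0) a b := by
      intro k hk
      have hk := mem_range.1 hk
      rw [tm_coordTerms hk]
      by_cases h0 : j k = 0 <;> simp [h0, ent_coordMat, gM k hk, kval_nil]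
    rw [sum_congr rfl h2, ← mul_sum, h1, Matrix.one_apply]
    by_cases hab : a = b
    · simp [hab]
    · have : (a : ℕ) ≠ b := fun h => hab (Fin.ext h)
      simp [hab, this]
  · simp only [dualOK, List.all_eq_true, List.mem_range, length_coordTerms]
    intro k hk l hl
    refine keq_of_kval_eq hθ ?_
    have h1 := hdual k hk l hl
    simp only [kval_ksum, kval_const hm, sum_range, kval_kmul hm hf, tm_coordTerms hk,
      tm_coordTerms hl, ent_coordMat, gM l hl, gE k hk]
    have h3 : ∑ a : Fin d, ∑ b : Fin d, (N : ℂ) * E k a b * (N * M l a b) =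
        N * N * ∑ a : Fin d, ∑ b : Fin d, E k a b * M l a b := by
      simp only [mul_sum]
      exact sum_congr rfl fun a _ => sum_congr rfl fun b _ => by ring
    rw [h3, h1]
    by_cases hkl : k = l <;> simp [hkl]

theorem isAlgebraic_kval (hθ : IsAlgebraic ℚ θ) (h : List ℤ) : IsAlgebraic ℚ (kval m θ h) := by
  have : ∀ n, IsAlgebraic ℚ (kval n θ h) := by
    intro n
    induction n with
    | zero => simpa [kval] using isAlgebraic_zero
    | succ n ih =>
      rw [kval, sum_range_succ]
      exact ih.add ((isAlgebraic_intCast _).mul (hθ.pow n))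
  exact this m

theorem exists_dictionary (H : List (List ℤ)) (φ : List ℤ → NumCode) :
    ∃ D : List NumCode, ∀ h ∈ H, lookupCode D h = φ h := by
  obtain ⟨K, hK⟩ := ((List.finite_toSet H).image (Encodable.encode (α := List ℤ))).bddAbove
  refine ⟨(List.range (K + 1)).map fun i =>
    ((Encodable.decode (α := List ℤ) i).map φ).getD ([], 0, 0, 0), fun h hh => ?_⟩
  have h1 : Encodable.encode h < K + 1 := Nat.lt_succ_of_le (hK ⟨h, hh, rfl⟩)
  simp [lookupCode, List.getD, h1]

/-- Every code of a matrix has a certificate. -/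
theorem exists_certificate {A : Matrix (Fin d) (Fin d) ℂ} {c : MatCode} (hc : c.Represents A) :
    ∃ T : Cert, certOK c T = true := by
  have hd := hc.length_eq
  have hA : ∀ a b, IsAlgebraic ℚ (A a b) := fun a b =>
    (NumCode.exists_represents_iff _).1 ⟨_, hc.entry a b⟩
  obtain ⟨f, θ, N, AA, ts, hm, hf, hθ, hN, hAA, hchain, hode, hinit, hdual⟩ :=
    exists_algebraic_certificate hA
  have hN' : (N : ℂ) ≠ 0 := by exact_mod_cast hN.ne'
  have hθalg : IsAlgebraic ℚ θ := (hf.isIntegral.tower_top (A := ℚ)).isAlgebraic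
  set Ws := idealGens f N d ts with hWs
  let H : List (List ℤ) := Ws.flatten.map Prod.snd
  have hH : ∀ W ∈ Ws, ∀ t ∈ W, t.2 ∈ H := fun W hW t ht =>
    List.mem_map_of_mem (List.mem_flatten.2 ⟨W, hW, ht⟩)
  obtain ⟨B, hB⟩ := ((List.finite_toSet H).image fun h => ‖kval f.length θ h‖).bddAbove
  obtain ⟨R, hR⟩ := exists_nat_ge (max (2 * ‖θ‖ + 2) (2 * B + 2))
  have hex : ∀ h, ∃ cd : NumCode, h ∈ H → uniqOK R cd = true ∧ kval f.length θ h ∈ cd.disc ∧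
      Polynomial.aeval (kval f.length θ h) cd.poly = 0 := by
    intro h
    by_cases hh : h ∈ H
    · have h1 : ‖kval f.length θ h‖ ≤ B := hB ⟨h, hh, rfl⟩
      obtain ⟨cd, h2⟩ := exists_uniqOK (isAlgebraic_kval (m := f.length) hθalg h)
        (R := R) (by linarith [le_max_right (2 * ‖θ‖ + 2) (2 * B + 2)])
      exact ⟨cd, fun _ => h2⟩
    · exact ⟨([], 0, 0, 0), fun h => absurd h hh⟩
  choose φ hφ using hex
  obtain ⟨D, hD⟩ := exists_dictionary H φ
  have ev1 : ∀ᶠ r : ℕ in atTop, ∀ h ∈ {h | h ∈ H}, ∀ x : Approx, x.2.2.2.1 = r →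
      x.2.2.2.2 = R → x.Near θ → repOK f x 1 h (φ h) = true :=
    (eventually_all_finite (List.finite_toSet H)).2 fun h hh =>
      eventually_repOK R hm hf hθ one_pos (by simpa using (hφ h hh).2.1)
        (by simpa using (hφ h hh).2.2)
  have ev2 : ∀ᶠ r : ℕ in atTop, ∀ p : Fin d × Fin d, ∀ x : Approx, x.2.2.2.1 = r →
      x.2.2.2.2 = R → x.Near θ →
      repOK f x N (ent AA p.1 p.2) ((c.getD p.1 []).getD p.2 ([], 0, 0, 0)) = true := by
    refine eventually_all.2 fun p => ?_
    have e : kval f.length θ (ent AA p.1 p.2) / N = A p.1 p.2 := by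
      rw [hAA, mul_div_cancel_left₀ _ hN']
    have h1 : A p.1 p.2 ∈ {w ∈ ((c.getD p.1 []).getD p.2 ([], 0, 0, 0) : NumCode).disc |
        Polynomial.aeval w ((c.getD p.1 []).getD p.2 ([], 0, 0, 0) : NumCode).poly = 0} := by
      rw [(hc.entry p.1 p.2).2]; rfl
    exact eventually_repOK R hm hf hθ hN (by rw [e]; exact h1.1) (by rw [e]; exact h1.2)
  obtain ⟨r, h1, h2, h3, hr⟩ := (ev1.and (ev2.and ((eventually_boxOK R hθ).and
    (eventually_gt_atTop 0)))).exists
  obtain ⟨x, hxr, hxR, hx, hroot⟩ := exists_approx hf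
    ((le_max_left _ _).trans hR : 2 * ‖θ‖ + 2 ≤ R) hr
  refine ⟨(f, x, N, AA, ts, D), ?_⟩
  simp only [certOK, hd, Bool.and_eq_true]
  refine ⟨⟨⟨⟨⟨⟨?_, ?_⟩, hchain⟩, hode⟩, hinit⟩, hdual⟩, ?_⟩
  · simp only [fieldOK, Bool.and_eq_true, decide_eq_true_eq]
    exact ⟨⟨⟨⟨⟨⟨hm, hN⟩, hx.s_pos⟩, hx.r_pos⟩, hx.bound⟩, hroot⟩, h3 x hxr hxR hx⟩
  · simp only [inputOK, hd, List.all_eq_true, List.mem_range]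
    exact fun a ha b hb => h2 (⟨a, ha⟩, ⟨b, hb⟩) x hxr hxR hx
  · simp only [dictOK, List.all_eq_true, Bool.and_eq_true]
    intro W hW t ht
    have ht' := hH W hW t ht
    rw [hD _ ht', hxR]
    exact ⟨h1 _ ht' x hxr hxR hx, (hφ _ ht').1⟩

end Certificate

end AlgFlow

theorem mainTheorem7 :
    ∃ F : AlgFlow.MatCode →. List AlgFlow.PolyCode, Partrec F ∧
      ∀ (d : ℕ) (A : Matrix (Fin d) (Fin d) ℂ) (c : AlgFlow.MatCode), c.Represents A →
        ∃ out ∈ F c, ∃ ps : List (MvPolynomial (Fin d × Fin d) ℂ),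
          List.Forall₂ AlgFlow.PolyCode.Represents out ps ∧
          MvPolynomial.zeroLocus ℂ (Ideal.span {p | p ∈ ps}) =
            AlgFlow.zariskiClosure (AlgFlow.flow A) ∧
          Ideal.span {p | p ∈ ps} = MvPolynomial.vanishingIdeal ℂ (AlgFlow.flow A) := by
  obtain ⟨F, hF, h⟩ := AlgFlow.partrec_search AlgFlow.primrec_certOK AlgFlow.primrec_certOut
  refine ⟨F, hF, fun d A c hc => ?_⟩
  obtain ⟨T, hT, hout⟩ := h c (AlgFlow.exists_certificate hc)
  exact ⟨_, hout, AlgFlow.certOut_correct hc hT⟩
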